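/- Let $\ell, N>0$ and consider the Riemannian metric $$ds^2=\frac{dr^2}{A(r)}+4N^2A(r)\,\sigma_3^2+B(r)(\sigma_1^2+\sigma_2^2),\qquad A(r)=\frac{r^2+N^2-2mr+\ell^{-2}(r^4-6N^2r^2-3N^4)}{r^2-N^2},\qquad B(r)=r^2-N^2,$$ for $r>r_+$, where the $\sigma_i$ are the left-invariant one-forms of $SU(2)$ with $d\sigma_1=\sigma_2\wedge\sigma_3$ and cyclic permutations. The complete Einstein manifold $(\mathcal M,g)$, $\mathrm{Ric}=\Lambda g$ with $\Lambda=-3/\ell^2$, is one of the following. * AdS-Taub-Nut: $r_+=N$ and $m=N(\ell^2-4N^2)/\ell^2$; a single point (the nut) is added at $r=r_+$, and $\mathcal M$ is diffeomorphic to $\mathbb R^4$. * AdS-Taub-Bolt$^\pm$, defined for $\ell/N\ge 2\sqrt{3(2+\sqrt3)}$: $r_+=r_{b\pm}=\dfrac{\ell^2\pm\sqrt{\ell^4-48N^2\ell^2+144N^4}}{12N}$ and $m=\dfrac{r_+^4+(\ell^2-6N^2)r_+^2+N^2(\ell^2-3N^2)}{2\ell^2r_+}$; a two-sphere (the bolt)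 is added at $r=r_+$, and $\mathcal M$ is diffeomorphic to the blow-up of $\mathbb C^2$ at the origin. Let $\mathcal H$ be the real Hilbert space of symmetric tensor fields $h_{ab}$ on $\mathcal M$ with $\nabla^ah_{ab}=0$, $h^a{}_a=0$ and $\int_{\mathcal M}h_{ab}h^{ab}\,dV<\infty$ (the $L^2$-closure of the fields of class $C^2$ with these properties), with inner product $\langle h,k\rangle=\int_{\mathcal M}h_{ab}k^{ab}\,dV$. Let $$(\widetilde\Delta_Lh)_{ab}=(\Delta_Lh)_{ab}-2\Lambda h_{ab}=-\nabla^e\nabla_eh_{ab}-2R_{acbd}h^{cd},$$ where $\Delta_L$ is the Lichnerowicz Laplacian, be regarded as a linear operator in $\mathcal H$ whose domain consists of the $h\in\mathcal H$ of class $C^2$ on $\mathcal M$ such that $\widetilde\Delta_Lh\in\mathcal H$. The continuous spectrum $C\sigma(A)$ of a linear operator $A$ in $\mathcal H$ is the set of $\lambda\in\mathbb R$ for which $A-\lambda I$ is injective on the domain of $A$ and the inverse $(A-\lambda I)^{-1}$, defined on the range of $A-\lambda I$, is unbounded. Then, for each of the three families of instantons and all admissible $\ell,N$, $$\{\lambda\in\mathbb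 R:\lambda>9/(4\ell^2)\}\subseteq C\sigma(\widetilde\Delta_L).$$ -/

import Mathlib

open MeasureTheory

noncomputable section

namespace AdSTaubNUT

/-! ### Riemannian geometry in a coordinate chart of dimension four

A field of covariant 2-tensors is given by its coordinate components `h x i j = h_{ij}(x)`. -/

/-- Points of a coordinate chart. -/
abbrev Pt : Type := Fin 4 → ℝ

/-- Components of a covariant 2-tensor field. -/
abbrev Field : Type := Pt → Fin 4 → Fin 4 → ℝ

/-- The partial derivative `∂_i f`. -/
def pd (i : Fin 4) (f : Pt → ℝ) (x : Pt) : ℝ := fderiv ℝ f x (Pi.single i 1)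

/-- The inverse metric `g^{ij}`. -/
def ginv (g : Field) (x : Pt) (i j : Fin 4) : ℝ := (Matrix.of (g x))⁻¹ i j

/-- Christoffel symbols `Γ^k_{ij}` of the Levi-Civita connection. -/
def christoffel (g : Field) (x : Pt) (k i j : Fin 4) : ℝ :=
  1 / 2 * ∑ l, ginv g x k l *
    (pd i (fun y => g y l j) x + pd j (fun y => g y l i) x - pd l (fun y => g y i j) x)

/-- The curvature `R^a_{bcd} = ∂_c Γ^a_{db} - ∂_d Γ^a_{cb} + Γ^a_{ce} Γ^e_{db} - Γ^a_{de} Γ^e_{cb}`. -/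
def riemannUp (g : Field) (x : Pt) (a b c d : Fin 4) : ℝ :=
  pd c (fun y => christoffel g y a d b) x - pd d (fun y => christoffel g y a c b) x +
    ∑ e, (christoffel g x a c e * christoffel g x e d b -
      christoffel g x a d e * christoffel g x e c b)

/-- The curvature with all indices down, `R_{abcd}`; the Ricci tensor is `g^{ac} R_{abcd}`. -/
def riemann (g : Field) (x : Pt) (a b c d : Fin 4) : ℝ :=
  ∑ e, g x a e * riemannUp g x e b c d

/-- `∇_c h_{ab}`. -/
def cov (g h : Field) (x : Pt) (c a b : Fin 4) : ℝ :=
  pd c (fun y => h y a b) x -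
    ∑ d, (christoffel g x d c a * h x d b + christoffel g x d c b * h x a d)

/-- `∇_d ∇_c h_{ab}`. -/
def cov2 (g h : Field) (x : Pt) (d c a b : Fin 4) : ℝ :=
  pd d (fun y => cov g h y c a b) x -
    ∑ e, (christoffel g x e d c * cov g h x e a b + christoffel g x e d a * cov g h x c e b +
      christoffel g x e d b * cov g h x c a e)

/-- The trace `h^a_a`. -/
def trace (g h : Field) (x : Pt) : ℝ := ∑ a, ∑ b, ginv g x a b * h x a b

/-- The divergence `∇^a h_{ab}`. -/
def divergence (g h : Field) (x : Pt) (b : Fin 4) : ℝ :=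
  ∑ a, ∑ c, ginv g x a c * cov g h x c a b

/-- The components `h^{cd}` with both indices raised. -/
def raise (g h : Field) (x : Pt) (c d : Fin 4) : ℝ :=
  ∑ e, ∑ f, ginv g x c e * ginv g x d f * h x e f

/-- The modified Lichnerowicz operator `- ∇^e ∇_e h_{ab} - 2 R_{acbd} h^{cd}`
(which is `Δ_L h - 2 Λ h` when `Ric = Λ g`). -/
def modLich (g h : Field) : Field := fun x a b =>
  -(∑ c, ∑ d, ginv g x c d * cov2 g h x c d a b) -
    2 * ∑ c, ∑ d, riemann g x a c b d * raise g h x c d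

/-- Pull-back of a covariant 2-tensor field along a map. -/
def pullback (Φ : Pt → Pt) (h : Field) : Field := fun y i j =>
  ∑ a, ∑ b, pd i (fun z => Φ z a) y * pd j (fun z => Φ z b) y * h (Φ y) a b

/-! ### The three families of instantons -/

/-- The three families. -/
inductive Kind
  | nut
  | boltPlus
  | boltMinus

/-- An AdS-Taub-Nut, AdS-Taub-Bolt⁺ or AdS-Taub-Bolt⁻ instanton, given by its NUT charge `N > 0`
and its radius `ℓ > 0` (so `Λ = -3/ℓ²`); the bolts exist in the stated range of `ℓ/N`. -/
structure Instanton where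
  kind : Kind
  N : ℝ
  ℓ : ℝ
  N_pos : 0 < N
  ℓ_pos : 0 < ℓ
  bolt_range : kind ≠ Kind.nut → 2 * √(3 * (2 + √3)) ≤ ℓ / N

namespace Instanton

variable (I : Instanton)

/-- The value `r_+` of the radial coordinate at the nut or bolt. -/
def rPlus : ℝ :=
  match I.kind with
  | Kind.nut => I.N
  | Kind.boltPlus =>
      (I.ℓ ^ 2 + √(I.ℓ ^ 4 - 48 * I.N ^ 2 * I.ℓ ^ 2 + 144 * I.N ^ 4)) / (12 * I.N)
  | Kind.boltMinus =>
      (I.ℓ ^ 2 - √(I.ℓ ^ 4 - 48 * I.N ^ 2 * I.ℓ ^ 2 + 144 * I.N ^ 4)) / (12 * I.N)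

/-- The mass parameter `m`. -/
def mass : ℝ :=
  match I.kind with
  | Kind.nut => I.N * (I.ℓ ^ 2 - 4 * I.N ^ 2) / I.ℓ ^ 2
  | _ => (I.rPlus ^ 4 + (I.ℓ ^ 2 - 6 * I.N ^ 2) * I.rPlus ^ 2 +
      I.N ^ 2 * (I.ℓ ^ 2 - 3 * I.N ^ 2)) / (2 * I.ℓ ^ 2 * I.rPlus)

/-- The metric function `A(r)`. -/
def A (r : ℝ) : ℝ :=
  (r ^ 2 + I.N ^ 2 - 2 * I.mass * r +
    (r ^ 4 - 6 * I.N ^ 2 * r ^ 2 - 3 * I.N ^ 4) / I.ℓ ^ 2) / (r ^ 2 - I.N ^ 2)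

/-- The metric function `B(r)`. -/
def B (r : ℝ) : ℝ := r ^ 2 - I.N ^ 2

end Instanton

/-! The complement of the nut or bolt is `(r_+, ∞) × SU(2)`. We identify it with `ℝ⁴ ∖ {0}`, where
`ℝ⁴ = ℂ²` has the complex coordinates `u = x₀ + i x₁`, `v = x₂ + i x₃`, by
`(r, q) ↦ √(r - r_+) q`, `q ∈ S³ = SU(2)`. Thus `r = r_+ + |u|² + |v|²`. -/

/-- `|x|²`. -/
def normSq (x : Pt) : ℝ := ∑ i, x i ^ 2

/-- Components of the radial one-form `x · dx = dr / 2`. -/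
def w0 (x : Pt) : Fin 4 → ℝ := x

/-- Components of `Re (u dv - v du)`. -/
def w1 (x : Pt) : Fin 4 → ℝ := ![-x 2, x 3, x 0, -x 1]

/-- Components of `Im (u dv - v du)`. -/
def w2 (x : Pt) : Fin 4 → ℝ := ![-x 3, -x 2, x 1, x 0]

/-- Components of `Im (ū du + v̄ dv)`. -/
def w3 (x : Pt) : Fin 4 → ℝ := ![-x 1, x 0, -x 3, x 2]

/-- The left-invariant one-form `σ₁` of `SU(2)`. The three forms satisfy `dσ₁ = σ₂ ∧ σ₃` and its
cyclic permutations; `σ₁² + σ₂²` is the metric of the unit two-sphere and `σ₃ = dψ + cos θ dφ`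
in Euler angles with `ψ` of period `4π`. -/
def σ1 (x : Pt) (i : Fin 4) : ℝ := 2 / normSq x * w1 x i

/-- The left-invariant one-form `σ₂`. -/
def σ2 (x : Pt) (i : Fin 4) : ℝ := 2 / normSq x * w2 x i

/-- The left-invariant one-form `σ₃`. -/
def σ3 (x : Pt) (i : Fin 4) : ℝ := 2 / normSq x * w3 x i

/-- The dense chart `ℝ⁴ ∖ {0}`. -/
def dense : Set Pt := {0}ᶜ

/-- Chart `(u, z) ↦ (u, u z)` of the blow-up of `ℂ²` at the origin. -/
def blowUp0 (y : Pt) : Pt := ![y 0, y 1, y 0 * y 2 - y 1 * y 3, y 0 * y 3 + y 1 * y 2]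

/-- Chart `(v, z) ↦ (v z, v)` of the blow-up of `ℂ²` at the origin. -/
def blowUp1 (y : Pt) : Pt := ![y 0 * y 2 - y 1 * y 3, y 0 * y 3 + y 1 * y 2, y 0, y 1]

namespace Instanton

variable (I : Instanton)

/-- The radial function. -/
def rad (x : Pt) : ℝ := I.rPlus + normSq x

/-- The metric `dr²/A + 4N²A σ₃² + B (σ₁² + σ₂²)`. -/
def metric : Field := fun x i j =>
  (2 * w0 x i) * (2 * w0 x j) / I.A (I.rad x)
    + 4 * I.N ^ 2 * I.A (I.rad x) * (σ3 x i * σ3 x j)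
    + I.B (I.rad x) * (σ1 x i * σ1 x j + σ2 x i * σ2 x j)

/-- The orthonormal frame dual to `dr/√A, √B σ₁, √B σ₂, 2N√A σ₃`. -/
def frame (x : Pt) : Fin 4 → Fin 4 → ℝ :=
  ![fun i => √(I.A (I.rad x)) * (w0 x i / (2 * normSq x)),
    fun i => w1 x i / 2 / √(I.B (I.rad x)),
    fun i => w2 x i / 2 / √(I.B (I.rad x)),
    fun i => w3 x i / 2 / (2 * I.N * √(I.A (I.rad x)))]

/-- The parametrisations that cover the instanton together with the dense chart `ℝ⁴ ∖ {0}`: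
for a nut a single point is added and the manifold is `ℝ⁴`; for a bolt a two-sphere is added,
on which the circles generated by `σ₃` collapse, and the manifold is the blow-up of `ℂ²` at `0`. -/
def charts : Set (Pt → Pt) :=
  match I.kind with
  | Kind.nut => {id}
  | _ => {blowUp0, blowUp1}

/-- The field, given on the dense chart, is (the restriction of) a tensor field of class `C²` on
the whole instanton. The value at `0` of the coordinate components carries no information. -/
def IsC2 (h : Field) : Prop :=
  (∀ i j, ContDiffOn ℝ 2 (fun x => h x i j) dense) ∧
  ∀ Φ ∈ I.charts, ∃ k : Field, (∀ i j, ContDiff ℝ 2 (fun y => k y i j)) ∧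
    ∀ y, Φ y ∈ dense → k y = pullback Φ h y

/-- Symmetric, trace-free, divergence-free. -/
def IsTT (h : Field) : Prop :=
  ∀ x ∈ dense, (∀ i j, h x i j = h x j i) ∧ trace I.metric h x = 0 ∧
    ∀ b, divergence I.metric h x b = 0

/-- The Riemannian volume measure; the nut or bolt is a null set. -/
def vol : Measure Pt :=
  volume.withDensity fun x => ENNReal.ofReal √(Matrix.of (I.metric x)).det

/-- The space in which the components of a tensor with respect to an orthonormal frame live, with
norm given by `‖h‖² = ∑ (h(e_a, e_b))² = h_{ab} h^{ab}`. -/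
abbrev Comp : Type := EuclideanSpace ℝ (Fin 4 × Fin 4)

/-- Orthonormal frame components. -/
def frameComp (h : Field) (x : Pt) : Comp :=
  WithLp.toLp 2 fun p => ∑ i, ∑ j, I.frame x p.1 i * I.frame x p.2 j * h x i j

/-- The Hilbert space of square-integrable covariant 2-tensor fields, with
`⟨h, k⟩ = ∫ h_{ab} k^{ab} dV`; a field is represented by its orthonormal frame components. -/
abbrev L2 : Type := Lp Comp 2 I.vol

end Instanton

/-! ### Elementary facts: positivity and smoothness -/

lemma normSq_pos {x : Pt} (hx : x ∈ dense) : 0 < normSq x := by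
  have h0 : ∃ i, x i ≠ 0 := by
    by_contra hc
    push Not at hc
    exact hx (funext hc)
  obtain ⟨i, hi⟩ := h0
  exact Finset.sum_pos' (fun j _ => sq_nonneg (x j)) ⟨i, Finset.mem_univ i, by positivity⟩

lemma isOpen_dense : IsOpen dense := isOpen_compl_singleton

namespace Instanton

variable (I : Instanton)

lemma ell_sq_gt (h : I.kind ≠ Kind.nut) : 12 * I.N ^ 2 < I.ℓ ^ 2 := by
  have hN := I.N_pos
  have h1 := I.bolt_range h
  have h3 : 2 ≤ √(3 * (2 + √3)) := by
    apply Real.le_sqrt_of_sq_le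
    nlinarith [Real.sqrt_nonneg 3]
  have h4 : 4 ≤ I.ℓ / I.N := by linarith
  rw [le_div_iff₀ hN] at h4
  nlinarith

lemma N_le_rPlus : I.N ≤ I.rPlus := by
  have hN := I.N_pos
  have hl := I.ℓ_pos
  unfold rPlus
  rcases hk : I.kind with _ | _ | _
  · exact le_rfl
  · have h := I.ell_sq_gt (by simp [hk])
    simp only
    rw [le_div_iff₀ (by positivity)]
    nlinarith [Real.sqrt_nonneg (I.ℓ ^ 4 - 48 * I.N ^ 2 * I.ℓ ^ 2 + 144 * I.N ^ 4)]
  · have h := I.ell_sq_gt (by simp [hk])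
    simp only
    rw [le_div_iff₀ (by positivity)]
    have : √(I.ℓ ^ 4 - 48 * I.N ^ 2 * I.ℓ ^ 2 + 144 * I.N ^ 4) ≤ I.ℓ ^ 2 - 12 * I.N ^ 2 := by
      apply Real.sqrt_le_iff.2 ⟨by linarith, ?_⟩
      nlinarith [mul_pos (pow_pos hN 2) (pow_pos hl 2)]
    nlinarith

lemma B_pos {r : ℝ} (hr : I.rPlus < r) : 0 < I.B r := by
  have hN := I.N_pos
  have := I.N_le_rPlus
  unfold B
  nlinarith

/-- Both at a nut and at a bolt the mass is such that `A(r_+) (r_+² - N²) = 0`. -/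
lemma mass_eq : 2 * I.mass * I.rPlus * I.ℓ ^ 2 =
    I.rPlus ^ 4 + (I.ℓ ^ 2 - 6 * I.N ^ 2) * I.rPlus ^ 2 + I.N ^ 2 * (I.ℓ ^ 2 - 3 * I.N ^ 2) := by
  have hl := I.ℓ_pos
  have hr : I.rPlus ≠ 0 := (lt_of_lt_of_le I.N_pos I.N_le_rPlus).ne'
  rcases hk : I.kind with _ | _ | _
  · have h1 : I.rPlus = I.N := by simp [rPlus, hk]
    have h2 : I.mass = I.N * (I.ℓ ^ 2 - 4 * I.N ^ 2) / I.ℓ ^ 2 := by simp [mass, hk]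
    rw [h1, h2]
    field_simp
    ring
  · have h2 : I.mass = (I.rPlus ^ 4 + (I.ℓ ^ 2 - 6 * I.N ^ 2) * I.rPlus ^ 2 +
      I.N ^ 2 * (I.ℓ ^ 2 - 3 * I.N ^ 2)) / (2 * I.ℓ ^ 2 * I.rPlus) := by simp [mass, hk]
    rw [h2]
    field_simp
  · have h2 : I.mass = (I.rPlus ^ 4 + (I.ℓ ^ 2 - 6 * I.N ^ 2) * I.rPlus ^ 2 +
      I.N ^ 2 * (I.ℓ ^ 2 - 3 * I.N ^ 2)) / (2 * I.ℓ ^ 2 * I.rPlus) := by simp [mass, hk]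
    rw [h2]
    field_simp

lemma A_pos {r : ℝ} (hr : I.rPlus < r) : 0 < I.A r := by
  have hN := I.N_pos
  have hl := I.ℓ_pos
  have h1 := I.N_le_rPlus
  have h2 := I.mass_eq
  have h0 : 0 < I.rPlus := lt_of_lt_of_le hN h1
  refine div_pos ?_ (I.B_pos hr)
  generalize I.rPlus = a at *
  generalize I.mass = m at *
  have hp : I.N ^ 2 < r * a := by nlinarith
  have hc : 0 < r * a * (r ^ 2 + r * a + a ^ 2) + (I.ℓ ^ 2 - 6 * I.N ^ 2) * (r * a)
      - I.N ^ 2 * (I.ℓ ^ 2 - 3 * I.N ^ 2) := by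
    have e1 : 0 ≤ r * a * (r - a) ^ 2 := by
      have : 0 < r * a := by nlinarith
      positivity
    have e2 : 0 < I.ℓ ^ 2 * (r * a - I.N ^ 2) := mul_pos (by positivity) (by linarith)
    nlinarith [sq_nonneg (r * a - I.N ^ 2)]
  have key : (r ^ 2 + I.N ^ 2 - 2 * m * r +
      (r ^ 4 - 6 * I.N ^ 2 * r ^ 2 - 3 * I.N ^ 4) / I.ℓ ^ 2) * (a * I.ℓ ^ 2) =
      (r - a) * (r * a * (r ^ 2 + r * a + a ^ 2) + (I.ℓ ^ 2 - 6 * I.N ^ 2) * (r * a)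
      - I.N ^ 2 * (I.ℓ ^ 2 - 3 * I.N ^ 2)) := by
    field_simp
    linear_combination -r * h2
  have h3 := mul_pos (sub_pos.2 hr) hc
  rw [← key] at h3
  exact pos_of_mul_pos_left h3 (by positivity)

lemma rad_gt {x : Pt} (hx : x ∈ dense) : I.rPlus < I.rad x := by
  unfold rad
  linarith [normSq_pos hx]

/-- The rows are `w0`, `w1`, `w2`, `w3`. -/
def wMat (x : Pt) : Matrix (Fin 4) (Fin 4) ℝ := Matrix.of ![w0 x, w1 x, w2 x, w3 x]

/-- The coefficients of the metric with respect to `w0`, `w1`, `w2`, `w3`. -/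
def coef (x : Pt) : Fin 4 → ℝ :=
  ![4 / I.A (I.rad x), I.B (I.rad x) * (2 / normSq x) ^ 2, I.B (I.rad x) * (2 / normSq x) ^ 2,
    4 * I.N ^ 2 * I.A (I.rad x) * (2 / normSq x) ^ 2]

/-- The coefficients of the frame with respect to `w0`, `w1`, `w2`, `w3`. -/
def frameCoef (x : Pt) : Fin 4 → ℝ :=
  ![√(I.A (I.rad x)) / (2 * normSq x), 1 / 2 / √(I.B (I.rad x)), 1 / 2 / √(I.B (I.rad x)),
    1 / 2 / (2 * I.N * √(I.A (I.rad x)))]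

lemma wMat_mul (x : Pt) : wMat x * (wMat x).transpose = normSq x • 1 := by
  ext i j
  fin_cases i <;> fin_cases j <;>
    simp [wMat, Matrix.mul_apply, Fin.sum_univ_four, w0, w1, w2, w3, normSq] <;> ring

lemma metric_eq (x : Pt) : Matrix.of (I.metric x) =
    (wMat x).transpose * Matrix.diagonal (I.coef x) * wMat x := by
  ext i j
  simp only [Matrix.of_apply, Matrix.mul_apply, Matrix.transpose_apply,
    Fin.sum_univ_four, metric, coef, wMat, σ1, σ2, σ3]
  simp
  ring

lemma frame_eq (x : Pt) : Matrix.of (I.frame x) = Matrix.diagonal (I.frameCoef x) * wMat x := by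
  ext i j
  fin_cases i <;> simp [frame, frameCoef, wMat] <;> ring

lemma coef_mul {x : Pt} (hx : x ∈ dense) (a : Fin 4) :
    normSq x ^ 2 * (I.frameCoef x a ^ 2 * I.coef x a) = 1 := by
  have hN := I.N_pos
  have hA := I.A_pos (I.rad_gt hx)
  have hB := I.B_pos (I.rad_gt hx)
  have hs := normSq_pos hx
  have hsA : √(I.A (I.rad x)) ^ 2 = I.A (I.rad x) := Real.sq_sqrt hA.le
  have hsB : √(I.B (I.rad x)) ^ 2 = I.B (I.rad x) := Real.sq_sqrt hB.le
  fin_cases a <;> simp [frameCoef, coef, div_pow, mul_pow, hsA, hsB] <;> field_simp <;> norm_num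

/-- The frame is orthonormal. -/
lemma frame_orthonormal {x : Pt} (hx : x ∈ dense) :
    Matrix.of (I.frame x) * Matrix.of (I.metric x) * (Matrix.of (I.frame x)).transpose = 1 := by
  have h : Matrix.of (I.frame x) * Matrix.of (I.metric x) * (Matrix.of (I.frame x)).transpose =
      Matrix.diagonal (I.frameCoef x) * (wMat x * (wMat x).transpose) *
        Matrix.diagonal (I.coef x) * (wMat x * (wMat x).transpose) *
        Matrix.diagonal (I.frameCoef x) := by
    rw [metric_eq, frame_eq, Matrix.transpose_mul, Matrix.diagonal_transpose]
    simp only [Matrix.mul_assoc]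
  rw [h, wMat_mul]
  simp only [Matrix.mul_smul, Matrix.smul_mul, Matrix.mul_one, Matrix.diagonal_mul_diagonal,
    smul_smul]
  ext i j
  by_cases hij : i = j
  · subst hij
    have := I.coef_mul hx i
    simp
    linear_combination this
  · simp [Matrix.diagonal_apply_ne _ hij, Matrix.one_apply_ne hij]

lemma det_metric_pos {x : Pt} (hx : x ∈ dense) : 0 < (Matrix.of (I.metric x)).det := by
  have h := congrArg Matrix.det (I.frame_orthonormal hx)
  rw [Matrix.det_mul, Matrix.det_mul, Matrix.det_transpose, Matrix.det_one] at h
  by_contra hc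
  nlinarith [mul_nonneg (sq_nonneg (Matrix.of (I.frame x)).det) (neg_nonneg.2 (not_lt.1 hc))]

lemma contDiff_normSq : ContDiff ℝ ⊤ normSq := by
  unfold normSq
  fun_prop

lemma contDiffOn_metric (i j : Fin 4) : ContDiffOn ℝ ⊤ (fun x => I.metric x i j) dense := by
  have hs : ContDiffOn ℝ ⊤ normSq dense := contDiff_normSq.contDiffOn
  have hA0 : ∀ x ∈ dense, I.A (I.rad x) ≠ 0 := fun x hx => (I.A_pos (I.rad_gt hx)).ne'
  have hB0 : ∀ x ∈ dense, I.rad x ^ 2 - I.N ^ 2 ≠ 0 := fun x hx => (I.B_pos (I.rad_gt hx)).ne'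
  have hs0 : ∀ x ∈ dense, normSq x ≠ 0 := fun x hx => (normSq_pos hx).ne'
  have hr : ContDiffOn ℝ ⊤ I.rad dense := contDiffOn_const.add hs
  have hB : ContDiffOn ℝ ⊤ (fun x => I.B (I.rad x)) dense := by
    unfold B
    fun_prop
  have hA : ContDiffOn ℝ ⊤ (fun x => I.A (I.rad x)) dense := by
    unfold A
    refine ContDiffOn.div ?_ ?_ hB0 <;> fun_prop
  have h2 : ContDiffOn ℝ ⊤ (fun x => 2 / normSq x) dense := contDiffOn_const.div hs hs0
  have c0 : ∀ i, ContDiff ℝ ⊤ (fun x => w0 x i) := fun i => by unfold w0; fun_prop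
  have c1 : ∀ i, ContDiff ℝ ⊤ (fun x => w1 x i) := fun i => by
    fin_cases i <;> simp [w1] <;> fun_prop
  have c2 : ∀ i, ContDiff ℝ ⊤ (fun x => w2 x i) := fun i => by
    fin_cases i <;> simp [w2] <;> fun_prop
  have c3 : ∀ i, ContDiff ℝ ⊤ (fun x => w3 x i) := fun i => by
    fin_cases i <;> simp [w3] <;> fun_prop
  have d0 := fun i => (c0 i).contDiffOn (s := dense)
  have s1 : ∀ i, ContDiffOn ℝ ⊤ (fun x => σ1 x i) dense := fun i => h2.mul (c1 i).contDiffOn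
  have s2 : ∀ i, ContDiffOn ℝ ⊤ (fun x => σ2 x i) dense := fun i => h2.mul (c2 i).contDiffOn
  have s3 : ∀ i, ContDiffOn ℝ ⊤ (fun x => σ3 x i) dense := fun i => h2.mul (c3 i).contDiffOn
  unfold metric
  exact ((((contDiffOn_const.mul (d0 i)).mul (contDiffOn_const.mul (d0 j))).div hA hA0).add
    ((contDiffOn_const.mul hA).mul ((s3 i).mul (s3 j)))).add
    (hB.mul (((s1 i).mul (s1 j)).add ((s2 i).mul (s2 j))))

end Instanton

lemma contDiffOn_det {n : Type} [Fintype n] [DecidableEq n] {M : Pt → Matrix n n ℝ} {s : Set Pt}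
    (h : ∀ i j, ContDiffOn ℝ ⊤ (fun x => M x i j) s) : ContDiffOn ℝ ⊤ (fun x => (M x).det) s := by
  simp only [Matrix.det_apply']
  exact ContDiffOn.sum fun σ _ => contDiffOn_const.mul (contDiffOn_prod fun i _ => h _ _)

lemma contDiffOn_pd {f : Pt → ℝ} (hf : ContDiffOn ℝ ⊤ f dense) (i : Fin 4) :
    ContDiffOn ℝ ⊤ (pd i f) dense := by
  have := hf.fderiv_of_isOpen isOpen_dense (m := ⊤) le_top
  exact this.clm_apply contDiffOn_const

namespace Instanton

variable (I : Instanton)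

lemma contDiffOn_ginv (i j : Fin 4) : ContDiffOn ℝ ⊤ (fun x => ginv I.metric x i j) dense := by
  have hm := I.contDiffOn_metric
  have hd : ContDiffOn ℝ ⊤ (fun x => (Matrix.of (I.metric x)).det) dense :=
    contDiffOn_det fun i j => hm i j
  simp only [ginv, Matrix.inv_def, Ring.inverse_eq_inv', Matrix.smul_apply, smul_eq_mul]
  refine (hd.inv fun x hx => (I.det_metric_pos hx).ne').mul ?_
  simp only [Matrix.adjugate_apply]
  refine contDiffOn_det fun k l => ?_
  by_cases hk : k = j
  · subst hk
    simpa using contDiffOn_const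
  · simpa [Matrix.updateRow_ne hk] using hm k l

lemma contDiffOn_christoffel (k i j : Fin 4) :
    ContDiffOn ℝ ⊤ (fun x => christoffel I.metric x k i j) dense := by
  unfold christoffel
  refine contDiffOn_const.mul (ContDiffOn.sum fun l _ => (I.contDiffOn_ginv k l).mul ?_)
  exact ((contDiffOn_pd (I.contDiffOn_metric l j) i).add
    (contDiffOn_pd (I.contDiffOn_metric l i) j)).sub (contDiffOn_pd (I.contDiffOn_metric i j) l)

end Instanton

/-! ### Linearity -/

lemma pd_lin {f k : Pt → ℝ} {x : Pt} (c : ℝ) (hf : DifferentiableAt ℝ f x)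
    (hk : DifferentiableAt ℝ k x) (i : Fin 4) :
    pd i (fun y => c * f y + k y) x = c * pd i f x + pd i k x := by
  unfold pd
  rw [fderiv_fun_add (hf.const_mul c) hk, fderiv_const_mul hf]
  simp

lemma pullback_lin (Φ : Pt → Pt) (c : ℝ) (h k : Field) :
    pullback Φ (c • h + k) = c • pullback Φ h + pullback Φ k := by
  ext y i j
  simp only [pullback, Pi.add_apply, Pi.smul_apply, smul_eq_mul, Finset.mul_sum,
    ← Finset.sum_add_distrib]
  exact Finset.sum_congr rfl fun a _ => Finset.sum_congr rfl fun b _ => by ring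

namespace Instanton

variable (I : Instanton)

variable {I}

lemma IsC2.differentiableAt {h : Field} (hh : I.IsC2 h) {x : Pt} (hx : x ∈ dense) (a b : Fin 4) :
    DifferentiableAt ℝ (fun y => h y a b) x :=
  ((hh.1 a b).differentiableOn (by norm_num)).differentiableAt (isOpen_dense.mem_nhds hx)

lemma IsC2.contDiffOn_cov {h : Field} (hh : I.IsC2 h) (c a b : Fin 4) :
    ContDiffOn ℝ 1 (fun x => cov I.metric h x c a b) dense := by
  have h1 : ContDiffOn ℝ 1 (fun x => pd c (fun y => h y a b) x) dense :=
    ((hh.1 a b).fderiv_of_isOpen isOpen_dense (m := 1) (by norm_num)).clm_apply contDiffOn_const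
  have hC := fun k i j => (I.contDiffOn_christoffel k i j).of_le (m := 1) le_top
  have hf := fun a b => (hh.1 a b).of_le (m := 1) (by norm_num)
  unfold cov
  exact h1.sub (ContDiffOn.sum fun d _ => ((hC _ _ _).mul (hf _ _)).add ((hC _ _ _).mul (hf _ _)))

lemma IsC2.differentiableAt_cov {h : Field} (hh : I.IsC2 h) {x : Pt} (hx : x ∈ dense)
    (c a b : Fin 4) : DifferentiableAt ℝ (fun y => cov I.metric h y c a b) x :=
  ((hh.contDiffOn_cov c a b).differentiableOn (by norm_num)).differentiableAt
    (isOpen_dense.mem_nhds hx)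

lemma IsC2.lin {h k : Field} (hh : I.IsC2 h) (hk : I.IsC2 k) (c : ℝ) : I.IsC2 (c • h + k) := by
  refine ⟨fun i j => (contDiffOn_const.mul (hh.1 i j)).add (hk.1 i j), fun Φ hΦ => ?_⟩
  obtain ⟨p, hp, hp'⟩ := hh.2 Φ hΦ
  obtain ⟨q, hq, hq'⟩ := hk.2 Φ hΦ
  refine ⟨c • p + q, fun i j => (contDiff_const.mul (hp i j)).add (hq i j), fun y hy => ?_⟩
  rw [pullback_lin]
  simp [hp' y hy, hq' y hy]

lemma isC2_zero : I.IsC2 0 := by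
  refine ⟨fun i j => contDiffOn_const, fun Φ _ => ⟨0, fun i j => contDiff_const, fun y _ => ?_⟩⟩
  ext i j
  simp [pullback]

lemma cov_lin {h k : Field} (hh : I.IsC2 h) (hk : I.IsC2 k) (t : ℝ) {x : Pt} (hx : x ∈ dense)
    (c a b : Fin 4) : cov I.metric (t • h + k) x c a b =
      t * cov I.metric h x c a b + cov I.metric k x c a b := by
  have h1 := pd_lin t (hh.differentiableAt hx a b) (hk.differentiableAt hx a b) c
  simp only [cov, Pi.add_apply, Pi.smul_apply, smul_eq_mul, h1, Fin.sum_univ_four]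
  ring

lemma cov2_lin {h k : Field} (hh : I.IsC2 h) (hk : I.IsC2 k) (t : ℝ) {x : Pt} (hx : x ∈ dense)
    (d c a b : Fin 4) : cov2 I.metric (t • h + k) x d c a b =
      t * cov2 I.metric h x d c a b + cov2 I.metric k x d c a b := by
  have h0 : (fun y => cov I.metric (t • h + k) y c a b) =ᶠ[nhds x]
      fun y => t * cov I.metric h y c a b + cov I.metric k y c a b :=
    Filter.eventually_of_mem (isOpen_dense.mem_nhds hx) fun y hy => cov_lin hh hk t hy c a b
  have h1 := pd_lin t (hh.differentiableAt_cov hx c a b) (hk.differentiableAt_cov hx c a b) d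
  have h2 : pd d (fun y => cov I.metric (t • h + k) y c a b) x =
      t * pd d (fun y => cov I.metric h y c a b) x + pd d (fun y => cov I.metric k y c a b) x := by
    rw [← h1]
    unfold pd
    rw [h0.fderiv_eq]
  simp only [cov2, h2, cov_lin hh hk t hx, Fin.sum_univ_four]
  ring

lemma trace_lin (g h k : Field) (t : ℝ) (x : Pt) :
    trace g (t • h + k) x = t * trace g h x + trace g k x := by
  simp only [trace, Pi.add_apply, Pi.smul_apply, smul_eq_mul, Fin.sum_univ_four]
  ring

lemma divergence_lin {h k : Field} (hh : I.IsC2 h) (hk : I.IsC2 k) (t : ℝ) {x : Pt}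
    (hx : x ∈ dense) (b : Fin 4) : divergence I.metric (t • h + k) x b =
      t * divergence I.metric h x b + divergence I.metric k x b := by
  simp only [divergence, cov_lin hh hk t hx, Fin.sum_univ_four]
  ring

lemma raise_lin (g h k : Field) (t : ℝ) (x : Pt) (c d : Fin 4) :
    raise g (t • h + k) x c d = t * raise g h x c d + raise g k x c d := by
  simp only [raise, Pi.add_apply, Pi.smul_apply, smul_eq_mul, Finset.mul_sum,
    ← Finset.sum_add_distrib]
  exact Finset.sum_congr rfl fun a _ => Finset.sum_congr rfl fun b _ => by ring

lemma modLich_lin {h k : Field} (hh : I.IsC2 h) (hk : I.IsC2 k) (t : ℝ) {x : Pt}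
    (hx : x ∈ dense) : modLich I.metric (t • h + k) x =
      (t • modLich I.metric h + modLich I.metric k) x := by
  ext a b
  have h1 : ∑ c, ∑ d, ginv I.metric x c d * cov2 I.metric (t • h + k) x c d a b =
      t * ∑ c, ∑ d, ginv I.metric x c d * cov2 I.metric h x c d a b +
        ∑ c, ∑ d, ginv I.metric x c d * cov2 I.metric k x c d a b := by
    simp only [cov2_lin hh hk t hx, Finset.mul_sum, ← Finset.sum_add_distrib]
    exact Finset.sum_congr rfl fun a _ => Finset.sum_congr rfl fun b _ => by ring
  have h2 : ∑ c, ∑ d, riemann I.metric x a c b d * raise I.metric (t • h + k) x c d =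
      t * ∑ c, ∑ d, riemann I.metric x a c b d * raise I.metric h x c d +
        ∑ c, ∑ d, riemann I.metric x a c b d * raise I.metric k x c d := by
    simp only [raise_lin, Finset.mul_sum, ← Finset.sum_add_distrib]
    exact Finset.sum_congr rfl fun a _ => Finset.sum_congr rfl fun b _ => by ring
  simp only [modLich, Pi.add_apply, Pi.smul_apply, smul_eq_mul, h1, h2]
  ring

lemma IsTT.lin {h k : Field} (hh : I.IsC2 h) (hk : I.IsC2 k) (th : I.IsTT h) (tk : I.IsTT k)
    (t : ℝ) : I.IsTT (t • h + k) := by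
  intro x hx
  obtain ⟨a1, a2, a3⟩ := th x hx
  obtain ⟨b1, b2, b3⟩ := tk x hx
  refine ⟨fun i j => ?_, ?_, fun b => ?_⟩
  · simp [a1 i j, b1 i j]
  · rw [trace_lin, a2, b2]
    simp
  · rw [divergence_lin hh hk t hx, a3, b3]
    simp

lemma isTT_zero : I.IsTT 0 := by
  intro x _
  refine ⟨fun i j => rfl, by simp [trace], fun b => ?_⟩
  simp [divergence, cov, pd]

lemma modLich_zero {x : Pt} (hx : x ∈ dense) : modLich I.metric 0 x = 0 := by
  have h := modLich_lin (I := I) isC2_zero isC2_zero (-1) hx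
  simpa using h

lemma frameComp_lin (h k : Field) (t : ℝ) (x : Pt) :
    I.frameComp (t • h + k) x = t • I.frameComp h x + I.frameComp k x := by
  ext p
  simp only [frameComp, PiLp.add_apply, PiLp.smul_apply, Pi.add_apply, Pi.smul_apply, smul_eq_mul,
    Finset.mul_sum, ← Finset.sum_add_distrib]
  exact Finset.sum_congr rfl fun a _ => Finset.sum_congr rfl fun b _ => by ring

lemma frameComp_zero (x : Pt) : I.frameComp 0 x = 0 := by
  ext p
  simp [frameComp]

lemma frameComp_congr {h k : Field} {x : Pt} (e : h x = k x) :
    I.frameComp h x = I.frameComp k x := by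
  simp [frameComp, e]

lemma ae_volume_dense : ∀ᵐ x ∂(volume : Measure Pt), x ∈ dense :=
  compl_mem_ae_iff.2 (measure_singleton 0)

lemma ae_dense : ∀ᵐ x ∂I.vol, x ∈ dense :=
  (withDensity_absolutelyContinuous _ _).ae_le ae_volume_dense

lemma ae_volume_of_ae_vol {p : Pt → Prop} (h : ∀ᵐ x ∂I.vol, p x) :
    ∀ᵐ x ∂(volume.restrict dense), p x := by
  have h0 : ∀ᵐ x ∂(volume : Measure Pt), x ∈ dense := ae_volume_dense
  have hc : ContinuousOn (fun x => (Matrix.of (I.metric x)).det) dense :=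
    (contDiffOn_det fun i j => I.contDiffOn_metric i j).continuousOn
  have hm : AEMeasurable (fun x => ENNReal.ofReal √(Matrix.of (I.metric x)).det)
      (volume : Measure Pt) := by
    have := (hc.aemeasurable isOpen_dense.measurableSet (μ := volume)).sqrt.ennreal_ofReal
    rwa [Measure.restrict_eq_self_of_ae_mem h0] at this
  unfold vol at h
  rw [ae_withDensity_iff' hm] at h
  rw [ae_restrict_iff' isOpen_dense.measurableSet]
  filter_upwards [h] with x hx hd
  apply hx
  simpa using Real.sqrt_pos.2 (I.det_metric_pos hd)

lemma eq_zero_of_frameComp {h : Field} {x : Pt} (hx : x ∈ dense) (e : I.frameComp h x = 0) :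
    h x = 0 := by
  have h1 : Matrix.of (I.frame x) * Matrix.of (h x) * (Matrix.of (I.frame x)).transpose = 0 := by
    ext a b
    have := congrArg (fun v : Comp => v (a, b)) e
    simp only [frameComp, PiLp.zero_apply] at this
    rw [Matrix.zero_apply, ← this]
    simp only [Matrix.mul_apply, Matrix.of_apply, Matrix.transpose_apply, Finset.sum_mul]
    rw [Finset.sum_comm]
    exact Finset.sum_congr rfl fun a _ => Finset.sum_congr rfl fun b _ => by ring
  have h2 : IsUnit (Matrix.of (I.frame x)) := by
    rw [Matrix.isUnit_iff_isUnit_det]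
    have := congrArg Matrix.det (I.frame_orthonormal hx)
    rw [Matrix.det_mul, Matrix.det_mul, Matrix.det_transpose, Matrix.det_one, mul_assoc] at this
    exact IsUnit.of_mul_eq_one _ this
  have h3 : IsUnit (Matrix.of (I.frame x)).transpose := by
    rw [Matrix.isUnit_iff_isUnit_det] at h2 ⊢
    rwa [Matrix.det_transpose]
  rw [h3.mul_left_eq_zero, h2.mul_right_eq_zero] at h1
  exact h1

lemma eq_zero_of_ae {h : Field} (hh : I.IsC2 h) (e : ∀ᵐ x ∂I.vol, I.frameComp h x = 0) {x : Pt}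
    (hx : x ∈ dense) : h x = 0 := by
  have h1 : ∀ a b, Set.EqOn (fun y => h y a b) (fun _ => 0) dense := fun a b => by
    refine Measure.eqOn_open_of_ae_eq (μ := volume) ?_ isOpen_dense (hh.1 a b).continuousOn
      continuousOn_const
    have h2 := ae_volume_of_ae_vol e
    filter_upwards [h2, ae_restrict_mem isOpen_dense.measurableSet] with y hy hd
    simp [eq_zero_of_frameComp hd hy]
  ext a b
  exact h1 a b hx

lemma modLich_eq_zero {h : Field} (hz : ∀ x ∈ dense, h x = 0) {x : Pt} (hx : x ∈ dense) :
    modLich I.metric h x = 0 := by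
  have h1 : ∀ y ∈ dense, ∀ c a b, cov I.metric h y c a b = 0 := fun y hy c a b => by
    have e : (fun y => h y a b) =ᶠ[nhds y] fun _ => 0 :=
      Filter.eventually_of_mem (isOpen_dense.mem_nhds hy) fun z hz' => by simp [hz z hz']
    simp [cov, pd, e.fderiv_eq, hz y hy]
  have h2 : ∀ d c a b, cov2 I.metric h x d c a b = 0 := fun d c a b => by
    have e : (fun y => cov I.metric h y c a b) =ᶠ[nhds x] fun _ => 0 :=
      Filter.eventually_of_mem (isOpen_dense.mem_nhds hx) fun z hz' => h1 z hz' c a b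
    simp [cov2, pd, e.fderiv_eq, h1 x hx]
  ext a b
  simp [modLich, h2, raise, hz x hx]

variable (I)

/-! ### The Hilbert space and the operator -/

/-- The square-integrable transverse traceless tensor fields of class `C²`. -/
def smoothTT : Submodule ℝ I.L2 where
  carrier := {x | ∃ h : Field, I.IsC2 h ∧ I.IsTT h ∧ x =ᵐ[I.vol] I.frameComp h}
  add_mem' := by
    rintro x y ⟨h, ch, th, eh⟩ ⟨k, ck, tk, ek⟩
    refine ⟨(1 : ℝ) • h + k, ch.lin ck 1, th.lin ch ck tk 1, ?_⟩
    filter_upwards [Lp.coeFn_add x y, eh, ek] with z h1 h2 h3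
    rw [h1, Pi.add_apply, h2, h3, frameComp_lin, one_smul]
  zero_mem' := by
    refine ⟨0, isC2_zero, isTT_zero, ?_⟩
    filter_upwards [Lp.coeFn_zero Comp 2 I.vol] with z h1
    rw [h1, frameComp_zero, Pi.zero_apply]
  smul_mem' := by
    rintro c x ⟨h, ch, th, eh⟩
    refine ⟨c • h + 0, ch.lin isC2_zero c, th.lin ch isC2_zero isTT_zero c, ?_⟩
    filter_upwards [Lp.coeFn_smul c x, eh] with z h1 h2
    rw [h1, frameComp_lin, frameComp_zero, Pi.smul_apply, h2, add_zero]

/-- The Hilbert space `𝓗` of square-integrable transverse traceless tensor fields: the closure in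
`L²` of those of class `C²`. -/
def H : Submodule ℝ I.L2 := I.smoothTT.topologicalClosure

/-- The graph of the modified Lichnerowicz operator in `𝓗`: the pairs `(h, Δ̃_L h)` where `h` is
of class `C²`, and `h` and `Δ̃_L h` belong to `𝓗`. -/
def opGraph : Submodule ℝ (I.H × I.H) where
  carrier := {p | ∃ h : Field, I.IsC2 h ∧ I.IsTT h ∧ (p.1 : I.L2) =ᵐ[I.vol] I.frameComp h ∧
    (p.2 : I.L2) =ᵐ[I.vol] I.frameComp (modLich I.metric h)}
  add_mem' := by
    rintro ⟨x, x'⟩ ⟨y, y'⟩ ⟨h, ch, th, eh, eh'⟩ ⟨k, ck, tk, ek, ek'⟩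
    refine ⟨(1 : ℝ) • h + k, ch.lin ck 1, th.lin ch ck tk 1, ?_, ?_⟩
    · filter_upwards [Lp.coeFn_add (x : I.L2) y, eh, ek] with z h1 h2 h3
      simp only [Prod.mk_add_mk, Submodule.coe_add]
      rw [h1, Pi.add_apply, h2, h3, frameComp_lin, one_smul]
    · filter_upwards [Lp.coeFn_add (x' : I.L2) y', eh', ek', ae_dense] with z h1 h2 h3 hz
      simp only [Prod.mk_add_mk, Submodule.coe_add]
      rw [h1, Pi.add_apply, h2, h3, frameComp_congr (modLich_lin ch ck 1 hz), frameComp_lin,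
        one_smul]
  zero_mem' := by
    refine ⟨0, isC2_zero, isTT_zero, ?_, ?_⟩
    · filter_upwards [Lp.coeFn_zero Comp 2 I.vol] with z h1
      rw [frameComp_zero]
      exact h1
    · filter_upwards [Lp.coeFn_zero Comp 2 I.vol, ae_dense] with z h1 hz
      rw [frameComp_congr (k := 0) (modLich_zero hz), frameComp_zero]
      exact h1
  smul_mem' := by
    rintro c ⟨x, x'⟩ ⟨h, ch, th, eh, eh'⟩
    refine ⟨c • h + 0, ch.lin isC2_zero c, th.lin ch isC2_zero isTT_zero c, ?_, ?_⟩
    · filter_upwards [Lp.coeFn_smul c (x : I.L2), eh] with z h1 h2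
      simp only [Prod.smul_mk, Submodule.coe_smul]
      rw [h1, Pi.smul_apply, h2, frameComp_lin, frameComp_zero, add_zero]
    · filter_upwards [Lp.coeFn_smul c (x' : I.L2), eh', ae_dense] with z h1 h2 hz
      simp only [Prod.smul_mk, Submodule.coe_smul]
      rw [h1, Pi.smul_apply, h2, frameComp_congr (modLich_lin ch isC2_zero c hz), frameComp_lin,
        frameComp_congr (k := 0) (modLich_zero hz), frameComp_zero, add_zero]

/-- The graph is single-valued. -/
lemma opGraph_functional : ∀ p ∈ I.opGraph, p.1 = 0 → p.2 = 0 := by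
  rintro ⟨x, y⟩ ⟨h, ch, _, eh, eh'⟩ hx
  simp only at hx eh eh' ⊢
  subst hx
  have h1 : ∀ᵐ z ∂I.vol, I.frameComp h z = 0 := by
    filter_upwards [eh, Lp.coeFn_zero Comp 2 I.vol] with z h2 h3
    rw [← h2]
    exact h3
  apply Subtype.ext
  apply Lp.ext
  filter_upwards [eh', Lp.coeFn_zero Comp 2 I.vol, ae_dense] with z h2 h3 hz
  rw [h2, frameComp_congr (k := 0) (modLich_eq_zero (fun w hw => eq_zero_of_ae ch h1 hw) hz),
    frameComp_zero]
  exact h3.symm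

/-- The operator `Δ̃_L` in `𝓗`, with domain the `h ∈ 𝓗` of class `C²` such that `Δ̃_L h ∈ 𝓗`. -/
def op : I.H →ₗ.[ℝ] I.H := I.opGraph.toLinearPMap

/-- The graph of `Δ̃_L` is the one prescribed above. -/
lemma op_graph : I.op.graph = I.opGraph :=
  Submodule.toLinearPMap_graph_eq _ I.opGraph_functional

end Instanton

/-! ### Point spectrum and continuous spectrum -/

variable {E : Type*} [NormedAddCommGroup E] [NormedSpace ℝ E]

/-- `A - λ I`, with the domain of `A`. -/
def shift (A : E →ₗ.[ℝ] E) (l : ℝ) : E →ₗ.[ℝ] E :=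
  ⟨A.domain, A.toFun - l • A.domain.subtype⟩

/-- `λ` is in the point spectrum when `(A - λ I)⁻¹` does not exist. -/
def pointSpectrum (A : E →ₗ.[ℝ] E) : Set ℝ := {l | (shift A l).toFun.ker ≠ ⊥}

/-- `λ` is in the continuous spectrum when `(A - λ I)⁻¹` (defined on the range of `A - λ I`) exists
and is unbounded. -/
def continuousSpectrum (A : E →ₗ.[ℝ] E) : Set ℝ :=
  {l | l ∉ pointSpectrum A ∧
    ¬ ∃ k : ℝ, ∀ y : (shift A l).inverse.domain, ‖(shift A l).inverse y‖ ≤ k * ‖(y : E)‖}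

end AdSTaubNUT

end

/-! Write κ = 1/ℓ, `a` = √A and λ for the spectral parameter. At infinity the metric is asymptotic
to the hyperbolic metric of curvature -κ², with `a` ∼ κr and volume density comparable to r² dr. On
tangential components the equation Δ̃_L h = λh tends to (a∂_r)² w + 3κ a∂_r w + λw = 0. In the
variable log r its exponents are -3/2 ± iν with κ²ν² = λ - 9κ²/4, and λ > 9κ²/4 makes ν real.
Solutions then have size r^(-3/2), and the integral of r² w² diverges like log r. They just miss
being square-integrable: there are no eigentensors, but cutting such waves off gives approximate
ones. The proof has these two halves.

No eigentensors (`eq_zero_of_modLich_eq_smul`). In the orthonormal frame proportional to dr, σ₁, σ₂,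
σ₃, the connection and curvature depend on r alone (`IsFrame.frame_modLich`, `frameMat_modLich`),
and the tangential derivatives are those along the linear vector fields w_i. These fields preserve
the measure of the spheres and map homogeneous polynomials of degree k to such polynomials. The
moments of an eigentensor against the words of length k therefore satisfy a finite linear system of
ordinary differential equations in r (`exists_radialSystem`).

The divergence constraint, its radial derivative and the eigenvalue equation together show that the
components with an index 0 are smaller by a factor 1/r than the whole solution
(`RadialSystem.isBigO_radial`). The tangential ones solve the limiting equation up to a relative
error O(1/r). The energy r³(p² + μ²w²), where p = a∂_r w + (3/2)κw and μ² = λ - 9κ²/4, then stays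
between positive multiples of its initial value, while r³pw is bounded. If the energy were not zero,
square-integrability of w would make r³pw grow like log r (`eq_zero_of_oscillating`). So the moments
vanish near infinity, hence everywhere by uniqueness for the initial value problem
(`RadialSystem.eq_zero`). By Stone-Weierstrass the tensor is zero (`eq_zero_of_moments`).

Approximate eigentensors (`exists_profile`). The tensors f(r) B (σ₁² - σ₂²), with f supported in a
compact interval away from the nut or bolt, are transverse and traceless, and Δ̃_L acts on them
through an ordinary differential operator on f (`IsProfile.modLich_tens`). Take f to be r^(-3/2)
times a cosine or sine of ν log r, cut off to log r in [n, 2n]. For at least one of the two phases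
the squared norm is at least of order n. Each derivative of the cut-off gains 1/n and the
coefficients differ from their limits by O(1/r), so the squared norm of (Δ̃_L - λ)f is of order 1/n
at most. No constant can therefore bound the inverse. -/

noncomputable section

namespace AdSTaubNUT

open Matrix

/-! ### Moving frames -/

/-- Matrices of components. -/
abbrev M4 : Type := Matrix (Fin 4) (Fin 4) ℝ

/-- The entrywise partial derivative of a matrix-valued function. -/
def mpd (k : Fin 4) (M : Pt → M4) (x : Pt) : M4 := Matrix.of fun i j => pd k (fun y => M y i j) x

/-- Entrywise differentiability of a matrix-valued function. -/
def MDiff (M : Pt → M4) (x : Pt) : Prop := ∀ i j, DifferentiableAt ℝ (fun y => M y i j) x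

lemma pd_mul {f k : Pt → ℝ} {x : Pt} (hf : DifferentiableAt ℝ f x) (hk : DifferentiableAt ℝ k x)
    (i : Fin 4) : pd i (fun y => f y * k y) x = pd i f x * k x + f x * pd i k x := by
  unfold pd
  rw [fderiv_fun_mul hf hk]
  simp
  ring

lemma pd_sum {ι : Type*} (s : Finset ι) {f : ι → Pt → ℝ} {x : Pt}
    (hf : ∀ j, DifferentiableAt ℝ (f j) x) (i : Fin 4) :
    pd i (fun y => ∑ j ∈ s, f j y) x = ∑ j ∈ s, pd i (f j) x := by
  unfold pd
  rw [fderiv_fun_sum fun j _ => hf j]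
  simp

lemma pd_sub {f k : Pt → ℝ} {x : Pt} (hf : DifferentiableAt ℝ f x) (hk : DifferentiableAt ℝ k x)
    (i : Fin 4) : pd i (fun y => f y - k y) x = pd i f x - pd i k x := by
  unfold pd
  rw [fderiv_fun_sub hf hk]
  simp

lemma pd_congr {f k : Pt → ℝ} (h : ∀ y ∈ dense, f y = k y) {x : Pt} (hx : x ∈ dense) (i : Fin 4) :
    pd i f x = pd i k x := by
  have e : f =ᶠ[nhds x] k := Filter.eventually_of_mem (isOpen_dense.mem_nhds hx) h
  simp [pd, e.fderiv_eq]

lemma contDiffOn_pd' {n : WithTop ℕ∞} {m : WithTop ℕ∞} (h : m + 1 ≤ n) {f : Pt → ℝ}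
    (hf : ContDiffOn ℝ n f dense) (i : Fin 4) : ContDiffOn ℝ m (pd i f) dense :=
  (hf.fderiv_of_isOpen isOpen_dense h).clm_apply contDiffOn_const

lemma differentiableAt_of_contDiffOn {n : WithTop ℕ∞} (hn : n ≠ 0) {f : Pt → ℝ}
    (hf : ContDiffOn ℝ n f dense) {x : Pt} (hx : x ∈ dense) : DifferentiableAt ℝ f x :=
  (hf.differentiableOn hn).differentiableAt (isOpen_dense.mem_nhds hx)

/-- Symmetry of second derivatives is the integrability condition that turns the structure equation
`mpd_E` into the curvature identity `conj_riemannUp`. -/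
lemma pd_comm {f : Pt → ℝ} (hf : ContDiffOn ℝ 2 f dense) {x : Pt} (hx : x ∈ dense) (i j : Fin 4) :
    pd i (pd j f) x = pd j (pd i f) x := by
  have h1 : ContDiffAt ℝ 2 f x := hf.contDiffAt (isOpen_dense.mem_nhds hx)
  have h2 : IsSymmSndFDerivAt ℝ f x := h1.isSymmSndFDerivAt (by simp)
  have h3 : DifferentiableAt ℝ (fderiv ℝ f) x :=
    (h1.fderiv_right (m := 1) (by norm_num)).differentiableAt (by norm_num)
  have h4 : ∀ a b : Fin 4, pd a (pd b f) x =
      fderiv ℝ (fderiv ℝ f) x (Pi.single a 1) (Pi.single b 1) := fun a b => by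
    unfold pd
    rw [fderiv_clm_apply h3 (differentiableAt_const _)]
    simp
  rw [h4, h4]
  exact h2 _ _

lemma mpd_mul {M N : Pt → M4} {x : Pt} (hM : MDiff M x) (hN : MDiff N x) (k : Fin 4) :
    mpd k (fun y => M y * N y) x = mpd k M x * N x + M x * mpd k N x := by
  ext i j
  simp only [mpd, Matrix.of_apply, Matrix.mul_apply, Matrix.add_apply]
  have h := pd_sum Finset.univ (f := fun l y => M y i l * N y l j)
    (fun l => (hM i l).mul (hN l j)) k
  rw [h, ← Finset.sum_add_distrib]
  exact Finset.sum_congr rfl fun l _ => pd_mul (hM i l) (hN l j) k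

lemma mpd_sub {M N : Pt → M4} {x : Pt} (hM : MDiff M x) (hN : MDiff N x) (k : Fin 4) :
    mpd k (fun y => M y - N y) x = mpd k M x - mpd k N x := by
  ext i j
  exact pd_sub (hM i j) (hN i j) k

lemma mpd_transpose (M : Pt → M4) (x : Pt) (k : Fin 4) :
    mpd k (fun y => (M y)ᵀ) x = (mpd k M x)ᵀ := rfl

lemma mpd_congr {M N : Pt → M4} (h : ∀ y ∈ dense, M y = N y) {x : Pt} (hx : x ∈ dense)
    (i : Fin 4) : mpd i M x = mpd i N x := by
  ext a b
  exact pd_congr (fun y hy => by rw [h y hy]) hx i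

lemma mpd_const (M : M4) (x : Pt) (k : Fin 4) : mpd k (fun _ => M) x = 0 := by
  ext a b
  simp [mpd, pd]

lemma mpd_smul {f : Pt → ℝ} {N : Pt → M4} {x : Pt} (hf : DifferentiableAt ℝ f x) (hN : MDiff N x)
    (k : Fin 4) : mpd k (fun y => f y • N y) x = pd k f x • N x + f x • mpd k N x := by
  ext i j
  exact pd_mul hf (hN i j) k

lemma mpd_sum {ι : Type*} (s : Finset ι) {M : ι → Pt → M4} {x : Pt} (hM : ∀ j, MDiff (M j) x)
    (k : Fin 4) : mpd k (fun y => ∑ j ∈ s, M j y) x = ∑ j ∈ s, mpd k (M j) x := by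
  ext a b
  simp only [mpd, Matrix.of_apply, Matrix.sum_apply]
  exact pd_sum s (fun j => hM j a b) k

lemma MDiff.mul {M N : Pt → M4} {x : Pt} (hM : MDiff M x) (hN : MDiff N x) :
    MDiff (fun y => M y * N y) x := by
  intro i j
  simp only [Matrix.mul_apply]
  exact DifferentiableAt.fun_sum fun l _ => (hM i l).mul (hN l j)

lemma MDiff.sub {M N : Pt → M4} {x : Pt} (hM : MDiff M x) (hN : MDiff N x) :
    MDiff (fun y => M y - N y) x := fun i j => (hM i j).sub (hN i j)

lemma MDiff.transpose {M : Pt → M4} {x : Pt} (hM : MDiff M x) :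
    MDiff (fun y => (M y)ᵀ) x := fun i j => hM j i

lemma MDiff.smul {f : Pt → ℝ} {N : Pt → M4} {x : Pt} (hf : DifferentiableAt ℝ f x)
    (hN : MDiff N x) : MDiff (fun y => f y • N y) x := fun i j => hf.mul (hN i j)

/-- The matrices `(Γ_k)^d_a = Γ^d_{ka}`. -/
def christoffelMat (g : Field) (k : Fin 4) (x : Pt) : M4 :=
  Matrix.of fun d a => christoffel g x d k a

/-- The derivative of a function along a vector of the frame. -/
def dirD (E : Pt → M4) (a : Fin 4) (f : Pt → ℝ) (x : Pt) : ℝ := ∑ k, E x a k * pd k f x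

/-- The entrywise derivative of a matrix-valued function along a vector of the frame. -/
def mdirD (E : Pt → M4) (a : Fin 4) (M : Pt → M4) (x : Pt) : M4 := ∑ k, E x a k • mpd k M x

lemma mdirD_apply (E : Pt → M4) (a : Fin 4) (M : Pt → M4) (x : Pt) (i j : Fin 4) :
    mdirD E a M x i j = dirD E a (fun y => M y i j) x := by
  simp [mdirD, dirD, Matrix.sum_apply, mpd]

/-- An orthonormal frame on the dense chart (the rows of `E`), together with the matrices `W c` of
the Levi-Civita connection: `∇_{e_c} e_a = ∑ d, W c a d e_d`. -/
structure IsFrame (g : Field) (E : Pt → M4) (W : Fin 4 → Pt → M4) : Prop where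
  smooth_g : ∀ i j, ContDiffOn ℝ ⊤ (fun x => g x i j) dense
  smooth_E : ∀ i j, ContDiffOn ℝ ⊤ (fun x => E x i j) dense
  smooth_C : ∀ k i j, ContDiffOn ℝ ⊤ (fun x => christoffel g x k i j) dense
  smooth_W : ∀ c i j, ContDiffOn ℝ ⊤ (fun x => W c x i j) dense
  ortho : ∀ x ∈ dense, E x * Matrix.of (g x) * (E x)ᵀ = 1
  skew : ∀ x ∈ dense, ∀ c, (W c x)ᵀ = -W c x
  torsion : ∀ x ∈ dense, ∀ a b l, dirD E a (fun y => E y b l) x - dirD E b (fun y => E y a l) x =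
    ∑ d, (W a x b d - W b x a d) * E x d l

namespace IsFrame

variable {g : Field} {E : Pt → M4} {W : Fin 4 → Pt → M4} (F : IsFrame g E W)

include F

lemma coframe_left {x : Pt} (hx : x ∈ dense) : E x * (Matrix.of (g x) * (E x)ᵀ) = 1 := by
  rw [← Matrix.mul_assoc, F.ortho x hx]

lemma coframe_right {x : Pt} (hx : x ∈ dense) : Matrix.of (g x) * (E x)ᵀ * E x = 1 :=
  mul_eq_one_comm.1 (F.coframe_left hx)

/-- The frame is invertible with inverse `Matrix.of (g x) * (E x)ᵀ`, so identities between tensors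
may be checked on frame components. -/
lemma cancel {x : Pt} (hx : x ∈ dense) {M N : M4} (h : E x * M * (E x)ᵀ = E x * N * (E x)ᵀ) :
    M = N := by
  have h1 := F.coframe_right hx
  have h2 : (E x)ᵀ * (Matrix.of (g x) * (E x)ᵀ)ᵀ = 1 := by
    rw [← Matrix.transpose_mul, h1, Matrix.transpose_one]
  have h3 := congrArg (fun P => Matrix.of (g x) * (E x)ᵀ * P * (Matrix.of (g x) * (E x)ᵀ)ᵀ) h
  have h4 : ∀ P : M4, Matrix.of (g x) * (E x)ᵀ * (E x * P * (E x)ᵀ) *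
      (Matrix.of (g x) * (E x)ᵀ)ᵀ = P := fun P => by
    calc _ = (Matrix.of (g x) * (E x)ᵀ * E x) * P * ((E x)ᵀ * (Matrix.of (g x) * (E x)ᵀ)ᵀ) := by
          simp only [Matrix.mul_assoc]
      _ = P := by rw [h1, h2, Matrix.one_mul, Matrix.mul_one]
  simpa only [h4] using h3

lemma ginv_eq {x : Pt} (hx : x ∈ dense) (i j : Fin 4) :
    ginv g x i j = ∑ a, E x a i * E x a j := by
  have h : (Matrix.of (g x))⁻¹ = (E x)ᵀ * E x := by
    apply Matrix.inv_eq_right_inv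
    rw [← Matrix.mul_assoc, F.coframe_right hx]
  rw [ginv, h, Matrix.mul_apply]
  rfl

lemma symm {x : Pt} (hx : x ∈ dense) : (Matrix.of (g x))ᵀ = Matrix.of (g x) := by
  apply F.cancel hx
  rw [F.ortho x hx]
  have := congrArg Matrix.transpose (F.ortho x hx)
  simpa [Matrix.transpose_mul, Matrix.mul_assoc] using this

lemma mdiff_E {x : Pt} (hx : x ∈ dense) : MDiff E x := fun i j =>
  differentiableAt_of_contDiffOn (by simp) (F.smooth_E i j) hx

lemma mdiff_g {x : Pt} (hx : x ∈ dense) : MDiff (fun y => Matrix.of (g y)) x := fun i j =>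
  differentiableAt_of_contDiffOn (by simp) (F.smooth_g i j) hx

lemma mdiff_W {x : Pt} (hx : x ∈ dense) (c : Fin 4) : MDiff (W c) x := fun i j =>
  differentiableAt_of_contDiffOn (by simp) (F.smooth_W c i j) hx

omit F in
/-- The connection matrices with a coordinate index. -/
def coordW (g : Field) (E : Pt → M4) (W : Fin 4 → Pt → M4) (k : Fin 4) (x : Pt) : M4 :=
  ∑ c, (Matrix.of (g x) * (E x)ᵀ) k c • W c x

/-- `Matrix.of (g x) * (E x)ᵀ` is the dual coframe, so contracting the coordinate index of `coordW`
with the frame recovers `W`. -/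
lemma sum_coordW {x : Pt} (hx : x ∈ dense) (a : Fin 4) :
    ∑ k, E x a k • coordW g E W k x = W a x := by
  unfold coordW
  simp only [Finset.smul_sum, smul_smul]
  rw [Finset.sum_comm]
  simp only [← Finset.sum_smul, ← Matrix.mul_apply, F.coframe_left hx]
  simp [Matrix.one_apply]

lemma coordW_skew {x : Pt} (hx : x ∈ dense) (k : Fin 4) :
    (coordW g E W k x)ᵀ = -coordW g E W k x := by
  unfold coordW
  rw [Matrix.transpose_sum, ← Finset.sum_neg_distrib]
  exact Finset.sum_congr rfl fun c _ => by rw [Matrix.transpose_smul, F.skew x hx, smul_neg]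

lemma smooth_coordW (k i j : Fin 4) : ContDiffOn ℝ ⊤ (fun x => coordW g E W k x i j) dense := by
  simp only [coordW, Matrix.sum_apply, Matrix.smul_apply, smul_eq_mul, Matrix.mul_apply,
    Matrix.transpose_apply, Matrix.of_apply]
  exact ContDiffOn.sum fun c _ =>
    (ContDiffOn.sum fun l _ => (F.smooth_g k l).mul (F.smooth_E c l)).mul (F.smooth_W c i j)

omit F in
-- Metric compatibility as matrix algebra: `h0` is the derivative of e G eᵀ = 1. Inserting the
-- structure equation `h5` for the derivative of e leaves w + wᵀ, which vanishes by skewness.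
lemma compat_aux {e G dG dE w c : M4} (h0 : (dE * G + e * dG) * eᵀ + e * G * dEᵀ = 0)
    (h2 : e * G * eᵀ = 1) (h4 : wᵀ = -w) (h5 : e * cᵀ = w * e - dE) :
    e * dG * eᵀ = e * (cᵀ * G + G * c) * eᵀ := by
  have h1 : e * (cᵀ * G + G * c) * eᵀ = (e * cᵀ) * (G * eᵀ) + (e * G) * (e * cᵀ)ᵀ := by
    rw [Matrix.transpose_mul, Matrix.transpose_transpose]
    noncomm_ring
  have h6 : w * e * (G * eᵀ) = w := by
    rw [Matrix.mul_assoc, ← Matrix.mul_assoc e, h2, Matrix.mul_one]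
  have h7 : e * G * (eᵀ * wᵀ) = wᵀ := by rw [← Matrix.mul_assoc, h2, Matrix.one_mul]
  rw [h1, h5, Matrix.transpose_sub, Matrix.transpose_mul, Matrix.sub_mul, Matrix.mul_sub, h6, h7,
    h4]
  rw [Matrix.add_mul] at h0
  rw [← sub_eq_zero, ← h0, Matrix.mul_assoc dE]
  abel

/-- The derivative of the frame in terms of the Christoffel symbols. -/
lemma mpd_E {x : Pt} (hx : x ∈ dense) (k : Fin 4) :
    mpd k E x = coordW g E W k x * E x - E x * (christoffelMat g k x)ᵀ := by
  set θ := Matrix.of (g x) * (E x)ᵀ with hθ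
  have hl : E x * θ = 1 := F.coframe_left hx
  have hr : θ * E x = 1 := F.coframe_right hx
  -- Candidates for the Christoffel symbols, defined so that the asserted identity holds. They are
  -- identified with the Levi-Civita symbols by uniqueness: skewness of `W` makes them compatible
  -- with the metric, and the torsion identity makes them symmetric.
  let C : Fin 4 → M4 := fun k => (θ * (coordW g E W k x * E x - mpd k E x))ᵀ
  have hEC : ∀ k, E x * (C k)ᵀ = coordW g E W k x * E x - mpd k E x := fun k => by
    simp only [C, Matrix.transpose_transpose]
    rw [← Matrix.mul_assoc, hl, Matrix.one_mul]
  have hsymm := F.symm hx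
  -- metric compatibility
  have hcompat : ∀ k, mpd k (fun y => Matrix.of (g y)) x =
      (C k)ᵀ * Matrix.of (g x) + Matrix.of (g x) * C k := fun k => by
    apply F.cancel hx
    have h0 : mpd k (fun y => E y * Matrix.of (g y) * (E y)ᵀ) x = 0 := by
      rw [mpd_congr (fun y hy => F.ortho y hy) hx, mpd_const]
    rw [mpd_mul ((F.mdiff_E hx).mul (F.mdiff_g hx)) (F.mdiff_E hx).transpose,
      mpd_mul (F.mdiff_E hx) (F.mdiff_g hx), mpd_transpose] at h0
    have h2 : E x * Matrix.of (g x) * (E x)ᵀ = 1 := F.ortho x hx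
    have h4 := F.coordW_skew hx k
    have h5 := hEC k
    exact compat_aux h0 h2 h4 h5
  -- symmetry
  have hsym : ∀ k a d, C k d a = C a d k := by
    intro k a d
    let S : M4 := Matrix.of fun k a => C k d a
    -- In the frame, the antisymmetric part of the lower indices of `C` is the torsion.
    have hS : ∀ p q, (E x * S * (E x)ᵀ) p q =
        (W p x * E x) q d - dirD E p (fun y => E y q d) x := fun p q => by
      have h1 : (E x * S * (E x)ᵀ) p q = ∑ k, E x p k * (E x * (C k)ᵀ) q d := by
        rw [Matrix.mul_assoc]
        simp only [Matrix.mul_apply, Matrix.transpose_apply, S, Matrix.of_apply]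
        exact Finset.sum_congr rfl fun k _ => by
          congr 1
          exact Finset.sum_congr rfl fun k _ => mul_comm _ _
      rw [h1]
      simp only [hEC, Matrix.sub_apply, mul_sub, Finset.sum_sub_distrib]
      congr 1
      rw [← F.sum_coordW hx p, Matrix.sum_mul, Matrix.sum_apply]
      simp
    have : S = Sᵀ := by
      apply F.cancel hx
      ext p q
      have h2 : (E x * Sᵀ * (E x)ᵀ) p q = (E x * S * (E x)ᵀ) q p := by
        have h3 : (E x * S * (E x)ᵀ)ᵀ = E x * Sᵀ * (E x)ᵀ := by
          rw [Matrix.transpose_mul, Matrix.transpose_mul, Matrix.transpose_transpose,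
            Matrix.mul_assoc]
        rw [← h3]
        rfl
      rw [h2, hS, hS]
      have h3 := F.torsion x hx p q d
      simp only [sub_mul, Finset.sum_sub_distrib] at h3
      simp only [Matrix.mul_apply]
      linarith
    exact congrFun (congrFun this k) a
  have key : ∀ k, christoffelMat g k x = C k := by
    intro k
    ext d a
    have hg : ∀ i j, g x i j = g x j i := fun i j => congrFun (congrFun hsymm j) i
    have hc : ∀ k i j, pd k (fun y => g y i j) x =
        ∑ e, C k e i * g x e j + ∑ e, g x i e * C k e j := fun k i j => by
      have := congrFun (congrFun (hcompat k) i) j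
      simpa [mpd, Matrix.mul_apply] using this
    -- Koszul's formula: of the six terms given by compatibility, four cancel in pairs by symmetry
    -- of the lower indices and the other two are equal.
    have h1 : ∀ l, pd k (fun y => g y l a) x + pd a (fun y => g y l k) x -
        pd l (fun y => g y k a) x = 2 * ∑ e, g x l e * C k e a := by
      intro l
      rw [hc, hc, hc, Finset.mul_sum]
      simp only [← Finset.sum_add_distrib, ← Finset.sum_sub_distrib]
      refine Finset.sum_congr rfl fun e _ => ?_
      rw [hsym l k e, hsym l a e, hsym a k e, hg k e]
      ring
    have h2 : ∀ e, ∑ l, ginv g x d l * g x l e = if d = e then 1 else 0 := fun e => by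
      have : (E x)ᵀ * E x * Matrix.of (g x) = 1 := by
        rw [mul_eq_one_comm, ← Matrix.mul_assoc, F.coframe_right hx]
      have := congrFun (congrFun this d) e
      rw [Matrix.one_apply] at this
      rw [← this, Matrix.mul_apply]
      exact Finset.sum_congr rfl fun l _ => by rw [F.ginv_eq hx]; rfl
    simp only [christoffelMat, christoffel, Matrix.of_apply]
    simp only [h1]
    calc _ = ∑ l, ∑ e, ginv g x d l * g x l e * C k e a := by
          rw [Finset.mul_sum]
          refine Finset.sum_congr rfl fun l _ => ?_
          rw [Finset.mul_sum, Finset.mul_sum, Finset.mul_sum]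
          exact Finset.sum_congr rfl fun e _ => by ring
      _ = C k d a := by
          rw [Finset.sum_comm]
          simp only [← Finset.sum_mul, h2]
          simp
  rw [key, hEC]
  abel

end IsFrame

end AdSTaubNUT

end

/-! ### Covariant derivatives, curvature, trace and divergence in a moving frame -/

noncomputable section

namespace AdSTaubNUT

open Matrix

/-- The frame components of a tensor field. -/
def frameMat (E : Pt → M4) (h : Field) (x : Pt) : M4 := E x * Matrix.of (h x) * (E x)ᵀ

/-- The covariant derivative, along a vector of the frame, of the field with frame components `H`. -/
def covF (E : Pt → M4) (W : Fin 4 → Pt → M4) (c : Fin 4) (H : Pt → M4) (x : Pt) : M4 :=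
  mdirD E c H x - W c x * H x - H x * (W c x)ᵀ

/-- The curvature in the frame: `R(e_p, e_q)`. -/
def curvF (E : Pt → M4) (W : Fin 4 → Pt → M4) (p q : Fin 4) (x : Pt) : M4 :=
  mdirD E p (W q) x - mdirD E q (W p) x - ∑ r, (W p x q r - W q x p r) • W r x +
    W q x * W p x - W p x * W q x

namespace IsFrame

variable {g : Field} {E : Pt → M4} {W : Fin 4 → Pt → M4} (F : IsFrame g E W)

include F

lemma mdiff_coordW {x : Pt} (hx : x ∈ dense) (k : Fin 4) : MDiff (coordW g E W k) x := fun i j =>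
  differentiableAt_of_contDiffOn (by simp) (F.smooth_coordW k i j) hx

lemma mdiff_christoffel {x : Pt} (hx : x ∈ dense) (k : Fin 4) : MDiff (christoffelMat g k) x :=
  fun i j => differentiableAt_of_contDiffOn (by simp) (F.smooth_C i k j) hx

/-- The product rule for E N Eᵀ with the derivative of E taken from `mpd_E`: the Christoffel terms
are traded for the connection matrices. -/
lemma conj_cov {x : Pt} (hx : x ∈ dense) {N : Pt → M4} (hN : MDiff N x) (k : Fin 4) :
    E x * (mpd k N x - (christoffelMat g k x)ᵀ * N x - N x * christoffelMat g k x) * (E x)ᵀ =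
      mpd k (fun y => E y * N y * (E y)ᵀ) x - coordW g E W k x * (E x * N x * (E x)ᵀ) -
        E x * N x * (E x)ᵀ * (coordW g E W k x)ᵀ := by
  rw [mpd_mul ((F.mdiff_E hx).mul hN) (F.mdiff_E hx).transpose, mpd_mul (F.mdiff_E hx) hN,
    mpd_transpose, F.mpd_E hx, Matrix.transpose_sub, Matrix.transpose_mul, Matrix.transpose_mul,
    Matrix.transpose_transpose]
  noncomm_ring

omit F in
lemma cov_mat (g h : Field) (x : Pt) (k : Fin 4) : (Matrix.of (cov g h x k) : M4) =
    mpd k (fun y => Matrix.of (h y)) x - (christoffelMat g k x)ᵀ * Matrix.of (h x) -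
      Matrix.of (h x) * christoffelMat g k x := by
  ext a b
  simp only [cov, mpd, christoffelMat, Matrix.of_apply, Matrix.sub_apply, Matrix.mul_apply,
    Matrix.transpose_apply, Finset.sum_add_distrib]
  rw [sub_sub]
  congr 2
  exact Finset.sum_congr rfl fun d _ => mul_comm _ _

lemma conj_cov' {h : Field} {x : Pt} (hx : x ∈ dense) (hh : MDiff (fun y => Matrix.of (h y)) x)
    (k : Fin 4) : E x * Matrix.of (cov g h x k) * (E x)ᵀ =
      mpd k (frameMat E h) x - coordW g E W k x * frameMat E h x -
        frameMat E h x * (coordW g E W k x)ᵀ := by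
  rw [cov_mat]
  exact F.conj_cov hx hh k

lemma frame_cov {h : Field} {x : Pt} (hx : x ∈ dense) (hh : MDiff (fun y => Matrix.of (h y)) x)
    (c : Fin 4) : ∑ k, E x c k • (E x * Matrix.of (cov g h x k) * (E x)ᵀ) =
      covF E W c (frameMat E h) x := by
  simp only [F.conj_cov' hx hh, smul_sub, Finset.sum_sub_distrib, covF, mdirD]
  rw [← F.sum_coordW hx c, Matrix.sum_mul, Matrix.transpose_sum, Matrix.mul_sum]
  simp only [Matrix.smul_mul, Matrix.transpose_smul, Matrix.mul_smul]

/-- The second covariant derivative on (e_p, e_q) is ∇_{e_p} ∇_{e_q} minus the derivative along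
∇_{e_p} e_q. The correction appears on differentiating the leg e_q with which the first derivative
has been contracted. -/
lemma frame_cov2 {h : Field} {x : Pt} (hx : x ∈ dense)
    (hh : ∀ y ∈ dense, MDiff (fun y => Matrix.of (h y)) y)
    (hc : ∀ k, MDiff (fun y => Matrix.of (cov g h y k)) x) (p q : Fin 4) :
    ∑ d, ∑ c, (E x p d * E x q c) • (E x * Matrix.of (cov2 g h x d c) * (E x)ᵀ) =
      covF E W p (covF E W q (frameMat E h)) x -
        ∑ r, W p x q r • covF E W r (frameMat E h) x := by
  set T : Fin 4 → Pt → M4 := fun k y => E y * Matrix.of (cov g h y k) * (E y)ᵀ with hT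
  have mT : ∀ k, MDiff (T k) x := fun k =>
    ((F.mdiff_E hx).mul (hc k)).mul (F.mdiff_E hx).transpose
  set S : Fin 4 → Pt → M4 := fun q y => covF E W q (frameMat E h) y with hS
  have hST : ∀ q, ∀ y ∈ dense, S q y = ∑ k, E y q k • T k y := fun q y hy =>
    (F.frame_cov hy (hh y hy) q).symm
  have h2 : ∀ d c, (Matrix.of (cov2 g h x d c) : M4) =
      mpd d (fun y => Matrix.of (cov g h y c)) x -
        (christoffelMat g d x)ᵀ * Matrix.of (cov g h x c) -
      Matrix.of (cov g h x c) * christoffelMat g d x -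
      ∑ e, christoffelMat g d x e c • Matrix.of (cov g h x e) := fun d c => by
    ext a b
    simp only [cov2, mpd, christoffelMat, Matrix.of_apply, Matrix.sub_apply, Matrix.mul_apply,
      Matrix.transpose_apply, Finset.sum_add_distrib, Matrix.sum_apply, Matrix.smul_apply,
      smul_eq_mul]
    have : ∑ e, cov g h x c a e * christoffel g x e d b =
      ∑ e, christoffel g x e d b * cov g h x c a e :=
      Finset.sum_congr rfl fun d _ => mul_comm _ _
    rw [this]
    ring
  have h3 : ∀ d c, E x * Matrix.of (cov2 g h x d c) * (E x)ᵀ =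
      mpd d (T c) x - coordW g E W d x * T c x - T c x * (coordW g E W d x)ᵀ -
        ∑ e, christoffelMat g d x e c • T e x := fun d c => by
    rw [h2, Matrix.mul_sub, Matrix.sub_mul, F.conj_cov hx (hc c) d, Matrix.mul_sum, Matrix.sum_mul]
    simp only [Matrix.mul_smul, Matrix.smul_mul, hT]
  have h4 : ∀ d, ∑ c, E x q c • (E x * Matrix.of (cov2 g h x d c) * (E x)ᵀ) =
      mpd d (S q) x - coordW g E W d x * S q x - S q x * (coordW g E W d x)ᵀ -
        ∑ r, coordW g E W d x q r • S r x := fun d => by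
    have h5 : mpd d (S q) x = ∑ c, (mpd d E x q c • T c x + E x q c • mpd d (T c) x) := by
      rw [mpd_congr (hST q) hx, mpd_sum _ (fun k => MDiff.smul (F.mdiff_E hx q k) (mT k))]
      exact Finset.sum_congr rfl fun c _ => mpd_smul (F.mdiff_E hx q c) (mT c) d
    -- The derivative of the leg e_q. Its Christoffel part cancels the Christoffel correction that
    -- `cov2` makes for the index of the first derivative, and the `coordW` part remains.
    have h6 : ∑ c, mpd d E x q c • T c x = ∑ r, coordW g E W d x q r • S r x -
        ∑ c, E x q c • ∑ e, christoffelMat g d x e c • T e x := by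
      rw [F.mpd_E hx]
      simp only [Matrix.sub_apply, sub_smul, Finset.sum_sub_distrib, Matrix.mul_apply,
        Finset.sum_smul, Finset.smul_sum, hST _ x hx, smul_smul, Matrix.transpose_apply]
      congr 1
      · rw [Finset.sum_comm]
      · rw [Finset.sum_comm]
    simp only [h3, smul_sub, Finset.sum_sub_distrib]
    rw [h5, Finset.sum_add_distrib, h6, hST q x hx, Matrix.mul_sum, Matrix.sum_mul]
    simp only [Matrix.mul_smul, Matrix.smul_mul]
    abel
  have h7 : ∀ d, ∑ c, (E x p d * E x q c) • (E x * Matrix.of (cov2 g h x d c) * (E x)ᵀ) =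
      E x p d • ∑ c, E x q c • (E x * Matrix.of (cov2 g h x d c) * (E x)ᵀ) := fun d => by
    simp only [Finset.smul_sum, smul_smul]
  simp only [h7, h4, smul_sub, Finset.sum_sub_distrib]
  have h8 : ∑ d, E x p d • ∑ r, coordW g E W d x q r • S r x = ∑ r, W p x q r • S r x := by
    simp only [Finset.smul_sum, smul_smul]
    rw [Finset.sum_comm]
    refine Finset.sum_congr rfl fun r _ => ?_
    rw [← Finset.sum_smul, ← F.sum_coordW hx p]
    simp [Matrix.sum_apply]
  rw [h8]
  change _ = covF E W p (S q) x - ∑ r, W p x q r • S r x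
  congr 1
  unfold covF mdirD
  rw [← F.sum_coordW hx p, Matrix.sum_mul, Matrix.transpose_sum, Matrix.mul_sum]
  simp only [Matrix.smul_mul, Matrix.transpose_smul, Matrix.mul_smul]

omit F in
/-- The curvature of the connection matrices with coordinate indices. -/
def coordCurv (g : Field) (E : Pt → M4) (W : Fin 4 → Pt → M4) (c d : Fin 4) (x : Pt) : M4 :=
  mpd c (coordW g E W d) x - mpd d (coordW g E W c) x +
    coordW g E W d x * coordW g E W c x - coordW g E W c x * coordW g E W d x

/-- Differentiate `mpd_E` once more and antisymmetrise. The second derivatives of E cancel by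
`pd_comm`, and what is left equates the curvature of the Christoffel symbols with that of the
connection matrices. -/
lemma conj_riemannUp {x : Pt} (hx : x ∈ dense) (c d : Fin 4) :
    E x * (Matrix.of fun a b => riemannUp g x a b c d)ᵀ = coordCurv g E W c d x * E x := by
  have h1 : (Matrix.of fun a b => riemannUp g x a b c d : M4) =
      mpd c (christoffelMat g d) x - mpd d (christoffelMat g c) x +
        (christoffelMat g c x * christoffelMat g d x -
          christoffelMat g d x * christoffelMat g c x) := by
    ext a b
    simp [riemannUp, mpd, christoffelMat, Matrix.mul_apply, Finset.sum_sub_distrib]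
  have h2 : ∀ c d, mpd c (mpd d E) x =
      mpd c (coordW g E W d) x * E x + coordW g E W d x * mpd c E x -
        (mpd c E x * (christoffelMat g d x)ᵀ + E x * (mpd c (christoffelMat g d) x)ᵀ) :=
    fun c d => by
    rw [mpd_congr (fun y hy => F.mpd_E hy d) hx,
      mpd_sub ((F.mdiff_coordW hx d).mul (F.mdiff_E hx))
        ((F.mdiff_E hx).mul (F.mdiff_christoffel hx d).transpose),
      mpd_mul (F.mdiff_coordW hx d) (F.mdiff_E hx),
      mpd_mul (F.mdiff_E hx) (F.mdiff_christoffel hx d).transpose, mpd_transpose]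
  have h3 : mpd c (mpd d E) x = mpd d (mpd c E) x := by
    ext i j
    exact pd_comm ((F.smooth_E i j).of_le le_top) hx c d
  rw [h2, h2, F.mpd_E hx, F.mpd_E hx, ← sub_eq_zero] at h3
  rw [h1, coordCurv, ← sub_eq_zero, ← neg_eq_zero, ← h3]
  simp only [Matrix.transpose_add, Matrix.transpose_sub, Matrix.transpose_mul]
  noncomm_ring

lemma conj_riemann {x : Pt} (hx : x ∈ dense) (A B c d : Fin 4) :
    ∑ a, ∑ b, E x A a * E x B b * riemann g x a b c d = coordCurv g E W c d x B A := by
  have h1 : (Matrix.of fun a b => riemann g x a b c d : M4) =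
      Matrix.of (g x) * Matrix.of fun a b => riemannUp g x a b c d := by
    ext a b
    simp [riemann, Matrix.mul_apply]
  have h2 : E x * (Matrix.of fun a b => riemann g x a b c d) * (E x)ᵀ =
      (coordCurv g E W c d x)ᵀ := by
    have h3 := congrArg Matrix.transpose (F.conj_riemannUp hx c d)
    rw [Matrix.transpose_mul, Matrix.transpose_transpose, Matrix.transpose_mul] at h3
    rw [h1, ← Matrix.mul_assoc, Matrix.mul_assoc, h3, ← Matrix.mul_assoc, F.ortho x hx,
      Matrix.one_mul]
  have h4 := congrFun (congrFun h2 A) B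
  rw [Matrix.transpose_apply] at h4
  rw [← h4]
  simp only [Matrix.mul_apply, Matrix.of_apply, Matrix.transpose_apply, Finset.sum_mul]
  rw [Finset.sum_comm]
  exact Finset.sum_congr rfl fun b _ => Finset.sum_congr rfl fun a _ => by ring

/-- Derivatives of W along the frame also hit the legs of `coordW`. Their antisymmetric part is the
bracket [e_p, e_q], which the torsion identity expresses through W; this is the third term of
`curvF`. -/
lemma frame_curv {x : Pt} (hx : x ∈ dense) (p q : Fin 4) :
    ∑ c, ∑ d, (E x p c * E x q d) • coordCurv g E W c d x = curvF E W p q x := by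
  have hWU : ∀ q, ∀ y ∈ dense, W q y = ∑ k, E y q k • coordW g E W k y := fun q y hy =>
    (F.sum_coordW hy q).symm
  have mU := F.mdiff_coordW hx
  have h5 : ∀ c q, mpd c (W q) x = ∑ d, mpd c E x q d • coordW g E W d x +
      ∑ d, E x q d • mpd c (coordW g E W d) x := fun c q => by
    rw [mpd_congr (hWU q) hx, mpd_sum _ (fun k => MDiff.smul (F.mdiff_E hx q k) (mU k)),
      ← Finset.sum_add_distrib]
    exact Finset.sum_congr rfl fun d _ => mpd_smul (F.mdiff_E hx q d) (mU d) c
  have h6 : ∀ p q, mdirD E p (W q) x = ∑ d, dirD E p (fun y => E y q d) x • coordW g E W d x +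
      ∑ c, ∑ d, (E x p c * E x q d) • mpd c (coordW g E W d) x := fun p q => by
    simp only [mdirD, h5, smul_add, Finset.sum_add_distrib, Finset.smul_sum, smul_smul]
    congr 1
    rw [Finset.sum_comm]
    simp only [dirD, Finset.sum_smul, mpd, Matrix.of_apply]
  have h7 : ∑ d, dirD E p (fun y => E y q d) x • coordW g E W d x -
      ∑ d, dirD E q (fun y => E y p d) x • coordW g E W d x =
      ∑ r, (W p x q r - W q x p r) • W r x := by
    rw [← Finset.sum_sub_distrib]
    simp only [← sub_smul, F.torsion x hx, Finset.sum_smul]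
    rw [Finset.sum_comm]
    refine Finset.sum_congr rfl fun r _ => ?_
    rw [hWU r x hx, Finset.smul_sum]
    simp only [smul_smul]
  have h8 : ∀ p q, W q x * W p x =
      ∑ c, ∑ d, (E x p c * E x q d) • (coordW g E W d x * coordW g E W c x) := fun p q => by
    rw [hWU q x hx, hWU p x hx, Matrix.sum_mul, Finset.sum_comm]
    simp only [Matrix.mul_sum, Matrix.smul_mul, Matrix.mul_smul, smul_smul]
  have h9 : ∀ (M : Fin 4 → Fin 4 → M4), ∑ c, ∑ d, (E x q c * E x p d) • M c d =
      ∑ c, ∑ d, (E x p c * E x q d) • M d c := fun M => by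
    rw [Finset.sum_comm]
    simp only [mul_comm]
  rw [curvF, ← h7, h6 p q, h6 q p, h8 p q, h8 q p, h9 fun c d => mpd c (coordW g E W d) x,
    h9 fun c d => coordW g E W d x * coordW g E W c x]
  simp only [coordCurv, smul_add, smul_sub, Finset.sum_add_distrib, Finset.sum_sub_distrib]
  abel

lemma conj_raise {h : Field} {x : Pt} (hx : x ∈ dense) (c d : Fin 4) :
    raise g h x c d = ∑ C, ∑ D, E x C c * E x D d * frameMat E h x C D := by
  have h1 : (Matrix.of (raise g h x) : M4) = (E x)ᵀ * E x * Matrix.of (h x) * ((E x)ᵀ * E x)ᵀ := by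
    have h2 : (E x)ᵀ * E x = Matrix.of (ginv g x) := by
      ext i j
      rw [Matrix.of_apply, F.ginv_eq hx, Matrix.mul_apply]
      rfl
    rw [h2]
    ext i j
    simp only [raise, Matrix.mul_apply, Matrix.of_apply, Matrix.transpose_apply, Finset.sum_mul]
    rw [Finset.sum_comm]
    exact Finset.sum_congr rfl fun a _ => Finset.sum_congr rfl fun b _ => by ring
  have h3 : (Matrix.of (raise g h x) : M4) = (E x)ᵀ * frameMat E h x * E x := by
    rw [h1, frameMat, Matrix.transpose_mul, Matrix.transpose_transpose]
    noncomm_ring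
  have h4 := congrFun (congrFun h3 c) d
  rw [Matrix.of_apply] at h4
  rw [h4]
  simp only [Matrix.mul_apply, Matrix.transpose_apply, Finset.sum_mul]
  rw [Finset.sum_comm]
  exact Finset.sum_congr rfl fun a _ => Finset.sum_congr rfl fun b _ => by ring

/-- The indices C, P of `curvF` come in reversed order, since the connection matrices are transposed
relative to R^a_b, as in `conj_riemannUp`. -/
lemma frame_riemann {h : Field} {x : Pt} (hx : x ∈ dense) (P Q : Fin 4) :
    ∑ a, ∑ b, E x P a * E x Q b * ∑ c, ∑ d, riemann g x a c b d * raise g h x c d =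
      ∑ C, ∑ D, curvF E W Q D x C P * frameMat E h x C D := by
  have h1 : ∀ C D, curvF E W Q D x C P =
      ∑ b, ∑ d, E x Q b * E x D d * ∑ a, ∑ c, E x P a * E x C c * riemann g x a c b d :=
    fun C D => by
    rw [← F.frame_curv hx Q D]
    simp only [Matrix.sum_apply, Matrix.smul_apply, smul_eq_mul, F.conj_riemann hx]
  have h2 : ∀ f : Fin 4 → Fin 4 → Fin 4 → Fin 4 → ℝ,
      ∑ c, ∑ d, ∑ C, ∑ D, f c d C D = ∑ C, ∑ D, ∑ c, ∑ d, f c d C D := fun f => by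
    have := Finset.sum_comm (s := (Finset.univ : Finset (Fin 4 × Fin 4)))
      (t := (Finset.univ : Finset (Fin 4 × Fin 4))) (f := fun p q => f p.1 p.2 q.1 q.2)
    simpa only [Fintype.sum_prod_type] using this
  simp only [F.conj_raise hx, Finset.mul_sum]
  conv_lhs => enter [2, a, 2, b]; rw [h2]
  rw [h2]
  refine Finset.sum_congr rfl fun C _ => Finset.sum_congr rfl fun D _ => ?_
  rw [h1, Finset.sum_mul, Finset.sum_comm]
  refine Finset.sum_congr rfl fun b _ => ?_
  simp only [Finset.sum_mul, Finset.mul_sum]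
  calc _ = ∑ a, ∑ d, ∑ c, E x P a * E x Q b * (riemann g x a c b d *
        (E x C c * E x D d * frameMat E h x C D)) :=
        Finset.sum_congr rfl fun a _ => Finset.sum_comm
    _ = _ := by
        rw [Finset.sum_comm]
        exact Finset.sum_congr rfl fun d _ => Finset.sum_congr rfl fun a _ =>
          Finset.sum_congr rfl fun c _ => by ring

/-- The modified Lichnerowicz operator in the frame. -/
lemma frame_modLich {h : Field} {x : Pt} (hx : x ∈ dense)
    (hh : ∀ y ∈ dense, MDiff (fun y => Matrix.of (h y)) y)
    (hc : ∀ k, MDiff (fun y => Matrix.of (cov g h y k)) x) (P Q : Fin 4) :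
    frameMat E (modLich g h) x P Q =
      -(∑ p, (covF E W p (covF E W p (frameMat E h)) x -
        ∑ r, W p x p r • covF E W r (frameMat E h) x)) P Q -
      2 * ∑ C, ∑ D, curvF E W Q D x C P * frameMat E h x C D := by
  have h1 : (∑ p, (covF E W p (covF E W p (frameMat E h)) x -
        ∑ r, W p x p r • covF E W r (frameMat E h) x)) P Q =
      ∑ a, ∑ b, E x P a * E x Q b * ∑ c, ∑ d, ginv g x c d * cov2 g h x c d a b := by
    have h2 : (Matrix.of fun a b => ∑ c, ∑ d, ginv g x c d * cov2 g h x c d a b : M4) =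
        ∑ p, ∑ c, ∑ d, (E x p c * E x p d) • Matrix.of (cov2 g h x c d) := by
      ext a b
      simp only [Matrix.of_apply, Matrix.sum_apply, Matrix.smul_apply, smul_eq_mul,
        F.ginv_eq hx, Finset.sum_mul]
      conv_rhs => rw [Finset.sum_comm]
      refine Finset.sum_congr rfl fun c _ => ?_
      rw [Finset.sum_comm]
    have h3 : (∑ p, (covF E W p (covF E W p (frameMat E h)) x -
        ∑ r, W p x p r • covF E W r (frameMat E h) x)) =
        E x * (Matrix.of fun a b => ∑ c, ∑ d, ginv g x c d * cov2 g h x c d a b) * (E x)ᵀ := by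
      rw [h2]
      simp only [← F.frame_cov2 hx hh hc, Matrix.mul_sum, Matrix.sum_mul, Matrix.mul_smul,
        Matrix.smul_mul]
    rw [h3]
    simp only [Matrix.mul_apply, Matrix.transpose_apply, Finset.sum_mul]
    rw [Finset.sum_comm]
    refine Finset.sum_congr rfl fun a _ => Finset.sum_congr rfl fun b _ => ?_
    rw [Matrix.of_apply]
    ring
  rw [h1, ← F.frame_riemann hx]
  simp only [frameMat, Matrix.mul_apply, Matrix.transpose_apply, Finset.sum_mul]
  rw [Finset.sum_comm, Finset.mul_sum, ← Finset.sum_neg_distrib, ← Finset.sum_sub_distrib]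
  refine Finset.sum_congr rfl fun a _ => ?_
  rw [Finset.mul_sum, ← Finset.sum_neg_distrib, ← Finset.sum_sub_distrib]
  refine Finset.sum_congr rfl fun b _ => ?_
  rw [Matrix.of_apply, modLich]
  ring

/-- The trace in the frame. -/
lemma frame_trace {h : Field} {x : Pt} (hx : x ∈ dense) :
    trace g h x = ∑ a, frameMat E h x a a := by
  simp only [trace, F.ginv_eq hx, frameMat, Matrix.mul_apply, Matrix.transpose_apply,
    Finset.sum_mul, Matrix.of_apply]
  rw [Finset.sum_comm]
  conv_lhs => enter [2, i]; rw [Finset.sum_comm]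
  rw [Finset.sum_comm]
  refine Finset.sum_congr rfl fun a _ => Finset.sum_congr rfl fun b _ =>
    Finset.sum_congr rfl fun c _ => by ring

/-- The divergence in the frame. -/
lemma frame_divergence {h : Field} {x : Pt} (hx : x ∈ dense)
    (hh : MDiff (fun y => Matrix.of (h y)) x) (Q : Fin 4) :
    ∑ b, E x Q b * divergence g h x b = ∑ p, covF E W p (frameMat E h) x p Q := by
  have h1 : ∀ p, covF E W p (frameMat E h) x p Q =
      ∑ c, ∑ a, ∑ b, E x p c * E x p a * E x Q b * cov g h x c a b := fun p => by
    rw [← F.frame_cov hx hh]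
    simp only [Matrix.sum_apply, Matrix.smul_apply, smul_eq_mul, Matrix.mul_apply,
      Matrix.transpose_apply, Finset.sum_mul, Matrix.of_apply, Finset.mul_sum]
    refine Finset.sum_congr rfl fun c _ => ?_
    rw [Finset.sum_comm]
    exact Finset.sum_congr rfl fun a _ => Finset.sum_congr rfl fun b _ => by ring
  simp only [h1, divergence, F.ginv_eq hx, Finset.sum_mul, Finset.mul_sum]
  have h2 : ∀ f : Fin 4 → Fin 4 → Fin 4 → Fin 4 → ℝ,
      ∑ c, ∑ d, ∑ C, ∑ D, f c d C D = ∑ D, ∑ C, ∑ d, ∑ c, f c d C D := fun f => by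
    have := Finset.sum_comm (s := (Finset.univ : Finset (Fin 4 × Fin 4)))
      (t := (Finset.univ : Finset (Fin 4 × Fin 4))) (f := fun p q => f p.1 p.2 q.1 q.2)
    simp only [Fintype.sum_prod_type] at this
    rw [this, Finset.sum_comm]
    exact Finset.sum_congr rfl fun a _ => Finset.sum_congr rfl fun b _ => Finset.sum_comm
  rw [h2]
  exact Finset.sum_congr rfl fun a _ => Finset.sum_congr rfl fun b _ =>
    Finset.sum_congr rfl fun a _ => Finset.sum_congr rfl fun b _ => by ring

end IsFrame

end AdSTaubNUT

end

noncomputable section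

namespace AdSTaubNUT

open Matrix

namespace Instanton

variable (I : Instanton)

/-! ### The radial functions of the orthonormal frame -/

/-- `√A`. -/
def sA (r : ℝ) : ℝ := √(I.A r)

/-- `1 / √B`. -/
def β (r : ℝ) : ℝ := 1 / √(I.B r)

/-- `1 / (2N√A)`. -/
def γ (r : ℝ) : ℝ := 1 / (2 * I.N * √(I.A r))

/-- The logarithmic derivative of `√B` along the unit radial vector. -/
def κ1 (r : ℝ) : ℝ := I.sA r * r / I.B r

/-- The logarithmic derivative of `√A` along the unit radial vector. -/
def κ3 (r : ℝ) : ℝ := deriv I.sA r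

/-- The connection coefficient on the squashed sphere along the base. -/
def Γ1 (r : ℝ) : ℝ := -(I.N * I.sA r / I.B r)

/-- The connection coefficient on the squashed sphere along the fibre. -/
def Γ3 (r : ℝ) : ℝ := I.N * I.sA r / I.B r - I.γ r

/-- The matrices of the Levi-Civita connection in the orthonormal frame. -/
def conn : Fin 4 → ℝ → M4 := fun c r =>
  ![0,
    !![0, I.κ1 r, 0, 0; -I.κ1 r, 0, 0, 0; 0, 0, 0, I.Γ1 r; 0, 0, -I.Γ1 r, 0],
    !![0, 0, I.κ1 r, 0; 0, 0, 0, -I.Γ1 r; -I.κ1 r, 0, 0, 0; 0, I.Γ1 r, 0, 0],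
    !![0, 0, 0, I.κ3 r; 0, 0, I.Γ3 r, 0; 0, -I.Γ3 r, 0, 0; -I.κ3 r, 0, 0, 0]] c

/-- The inverse lengths of the vectors dual to `σ₁, σ₂, σ₃`. -/
def invb : Fin 4 → ℝ → ℝ := fun c r => ![0, I.β r, I.β r, I.γ r] c

/-- The frame is `e_a = frad a • w_a`. -/
def frad : Fin 4 → ℝ → ℝ := fun c r =>
  ![I.sA r / (2 * (r - I.rPlus)), I.β r / 2, I.β r / 2, I.γ r / 2] c

lemma sA_pos {r : ℝ} (hr : I.rPlus < r) : 0 < I.sA r := Real.sqrt_pos.2 (I.A_pos hr)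

lemma β_pos {r : ℝ} (hr : I.rPlus < r) : 0 < I.β r :=
  div_pos one_pos (Real.sqrt_pos.2 (I.B_pos hr))

lemma γ_pos {r : ℝ} (hr : I.rPlus < r) : 0 < I.γ r :=
  div_pos one_pos (mul_pos (mul_pos two_pos I.N_pos) (I.sA_pos hr))

lemma contDiff_B : ContDiff ℝ ⊤ I.B := by
  unfold B
  fun_prop

lemma contDiffOn_A : ContDiffOn ℝ ⊤ I.A (Set.Ioi I.rPlus) := by
  unfold A
  refine ContDiffOn.div (by fun_prop) (by fun_prop) fun r hr => (I.B_pos hr).ne'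

lemma contDiffOn_sA : ContDiffOn ℝ ⊤ I.sA (Set.Ioi I.rPlus) :=
  I.contDiffOn_A.sqrt fun _ hr => (I.A_pos hr).ne'

lemma contDiffOn_β : ContDiffOn ℝ ⊤ I.β (Set.Ioi I.rPlus) :=
  contDiffOn_const.div (I.contDiff_B.contDiffOn.sqrt fun _ hr => (I.B_pos hr).ne')
    fun _ hr => (Real.sqrt_pos.2 (I.B_pos hr)).ne'

lemma contDiffOn_γ : ContDiffOn ℝ ⊤ I.γ (Set.Ioi I.rPlus) :=
  contDiffOn_const.div (contDiffOn_const.mul I.contDiffOn_sA)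
    fun _ hr => (mul_pos (mul_pos two_pos I.N_pos) (I.sA_pos hr)).ne'

lemma contDiffOn_κ1 : ContDiffOn ℝ ⊤ I.κ1 (Set.Ioi I.rPlus) :=
  (I.contDiffOn_sA.mul contDiffOn_id).div I.contDiff_B.contDiffOn fun _ hr => (I.B_pos hr).ne'

lemma contDiffOn_κ3 : ContDiffOn ℝ ⊤ I.κ3 (Set.Ioi I.rPlus) :=
  I.contDiffOn_sA.deriv_of_isOpen isOpen_Ioi (m := ⊤) le_top

lemma contDiffOn_Γ1 : ContDiffOn ℝ ⊤ I.Γ1 (Set.Ioi I.rPlus) :=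
  ((contDiffOn_const.mul I.contDiffOn_sA).div I.contDiff_B.contDiffOn
    fun _ hr => (I.B_pos hr).ne').neg

lemma contDiffOn_Γ3 : ContDiffOn ℝ ⊤ I.Γ3 (Set.Ioi I.rPlus) :=
  ((contDiffOn_const.mul I.contDiffOn_sA).div I.contDiff_B.contDiffOn
    fun _ hr => (I.B_pos hr).ne').sub I.contDiffOn_γ

lemma contDiffOn_conn (c i j : Fin 4) :
    ContDiffOn ℝ ⊤ (fun r => I.conn c r i j) (Set.Ioi I.rPlus) := by
  have h1 := I.contDiffOn_κ1
  have h2 := I.contDiffOn_κ3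
  have h3 := I.contDiffOn_Γ1
  have h4 := I.contDiffOn_Γ3
  have h0 : ContDiffOn ℝ ⊤ (fun _ : ℝ => (0 : ℝ)) (Set.Ioi I.rPlus) := contDiffOn_const
  fin_cases c <;> fin_cases i <;> fin_cases j <;> first
    | exact h0 | exact h1 | exact h2 | exact h3 | exact h4
    | exact h1.neg | exact h2.neg | exact h3.neg | exact h4.neg

lemma contDiffOn_invb (c : Fin 4) : ContDiffOn ℝ ⊤ (I.invb c) (Set.Ioi I.rPlus) := by
  have h0 : ContDiffOn ℝ ⊤ (fun _ : ℝ => (0 : ℝ)) (Set.Ioi I.rPlus) := contDiffOn_const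
  fin_cases c
  · exact h0
  · exact I.contDiffOn_β
  · exact I.contDiffOn_β
  · exact I.contDiffOn_γ

lemma contDiffOn_frad (c : Fin 4) : ContDiffOn ℝ ⊤ (I.frad c) (Set.Ioi I.rPlus) := by
  have h1 : ContDiffOn ℝ ⊤ (fun r => I.sA r / (2 * (r - I.rPlus))) (Set.Ioi I.rPlus) :=
    I.contDiffOn_sA.div (by fun_prop) fun r hr => by
      have : 0 < r - I.rPlus := sub_pos.2 hr
      positivity
  have h2 : ContDiffOn ℝ ⊤ (fun r => I.β r / 2) (Set.Ioi I.rPlus) :=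
    I.contDiffOn_β.div_const 2
  have h3 : ContDiffOn ℝ ⊤ (fun r => I.γ r / 2) (Set.Ioi I.rPlus) :=
    I.contDiffOn_γ.div_const 2
  fin_cases c
  · exact h1
  · exact h2
  · exact h2
  · exact h3

lemma differentiableAt_radial {f : ℝ → ℝ} (hf : ContDiffOn ℝ ⊤ f (Set.Ioi I.rPlus)) {r : ℝ}
    (hr : I.rPlus < r) : DifferentiableAt ℝ f r :=
  (hf.differentiableOn (by simp)).differentiableAt (isOpen_Ioi.mem_nhds hr)

lemma contDiff_rad : ContDiff ℝ ⊤ I.rad := contDiff_const.add contDiff_normSq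

lemma contDiffOn_comp_rad {n : WithTop ℕ∞} {f : ℝ → ℝ} (hf : ContDiffOn ℝ n f (Set.Ioi I.rPlus)) :
    ContDiffOn ℝ n (fun x => f (I.rad x)) dense :=
  hf.comp (I.contDiff_rad.contDiffOn.of_le le_top) fun _ hx => I.rad_gt hx

lemma hasFDerivAt_pd {f : Pt → ℝ} {f' : Pt →L[ℝ] ℝ} {x : Pt} (h : HasFDerivAt f f' x)
    (k : Fin 4) : pd k f x = f' (Pi.single k 1) := by
  rw [pd, h.fderiv]

lemma pd_normSq (x : Pt) (k : Fin 4) : pd k normSq x = 2 * x k := by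
  have h : HasFDerivAt normSq 
      (∑ i, (2 * x i) • ContinuousLinearMap.proj (R := ℝ) (φ := fun _ : Fin 4 => ℝ) i) x := by
    unfold normSq
    refine HasFDerivAt.fun_sum fun i _ => ?_
    have h1 : HasFDerivAt (fun y : Pt => y i)
        (ContinuousLinearMap.proj (R := ℝ) (φ := fun _ : Fin 4 => ℝ) i) x :=
      (ContinuousLinearMap.proj (R := ℝ) (φ := fun _ : Fin 4 => ℝ) i).hasFDerivAt
    simpa using h1.pow 2
  rw [hasFDerivAt_pd h]
  simp [Pi.single_apply]

lemma pd_radial {f : ℝ → ℝ} {x : Pt} (hf : DifferentiableAt ℝ f (I.rad x)) (k : Fin 4) :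
    pd k (fun y => f (I.rad y)) x = deriv f (I.rad x) * (2 * x k) := by
  have h1 : HasFDerivAt I.rad (fderiv ℝ normSq x) x := by
    have : DifferentiableAt ℝ normSq x := contDiff_normSq.differentiable (by simp) x
    exact this.hasFDerivAt.const_add _
  have h2 := hf.hasDerivAt.comp_hasFDerivAt x h1
  have h3 := hasFDerivAt_pd h2 k
  rw [Function.comp_def] at h3
  rw [h3, ← pd_normSq]
  simp [pd]

lemma wMat_add_smul (x y : Pt) (c : ℝ) : wMat (x + c • y) = wMat x + c • wMat y := by
  ext i j
  fin_cases i <;> fin_cases j <;> simp [wMat, w0, w1, w2, w3] <;> ring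

lemma contDiff_wMat (a l : Fin 4) : ContDiff ℝ ⊤ (fun x => wMat x a l) := by
  fin_cases a <;> fin_cases l <;> simp [wMat, w0, w1, w2, w3] <;> fun_prop

/-- The linear map `x ↦ wMat x a l`. -/
def wLin (a l : Fin 4) : Pt →ₗ[ℝ] ℝ where
  toFun x := wMat x a l
  map_add' x y := by simpa using congrFun (congrFun (wMat_add_smul x y 1) a) l
  map_smul' c x := by
    have h0 : wMat 0 = 0 := by
      ext i j
      fin_cases i <;> fin_cases j <;> simp [wMat, w0, w1, w2, w3]
    simpa [h0] using congrFun (congrFun (wMat_add_smul 0 x c) a) l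

lemma pd_wMat (x : Pt) (k a l : Fin 4) :
    pd k (fun y => wMat y a l) x = wMat (Pi.single k 1) a l := by
  have h := (wLin a l).toContinuousLinearMap.hasFDerivAt (x := x)
  exact hasFDerivAt_pd h k

lemma sum_wMat_pd (x : Pt) (v : Pt) (a l : Fin 4) :
    ∑ k, v k * pd k (fun y => wMat y a l) x = wMat v a l := by
  have h := LinearMap.pi_apply_eq_sum_univ (wLin a l) v
  change wMat v a l = _ at h
  rw [h]
  refine Finset.sum_congr rfl fun k _ => ?_
  rw [pd_wMat, smul_eq_mul]
  congr 2
  ext j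
  simp [Pi.single_apply, eq_comm]

lemma sum_wMat_mul (x : Pt) (a : Fin 4) : ∑ k, wMat x a k * x k = if a = 0 then normSq x else 0 := by
  fin_cases a <;> simp [wMat, w0, w1, w2, w3, normSq, Fin.sum_univ_four] <;> ring

/-- The orthonormal frame as a matrix. -/
def fr (x : Pt) : M4 := Matrix.of (I.frame x)

/-- The connection matrices as functions on the dense chart. -/
def connX (c : Fin 4) (x : Pt) : M4 := I.conn c (I.rad x)

lemma fr_apply {x : Pt} (a l : Fin 4) : I.fr x a l = I.frad a (I.rad x) * wMat x a l := by
  have h : I.rad x - I.rPlus = normSq x := by simp [rad]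
  fin_cases a <;> simp [fr, frame, frad, wMat, h, sA, β, γ] <;> ring

lemma smooth_fr (i j : Fin 4) : ContDiffOn ℝ ⊤ (fun x => I.fr x i j) dense := by
  simp only [fr_apply]
  exact (I.contDiffOn_comp_rad (I.contDiffOn_frad i)).mul (contDiff_wMat i j).contDiffOn

lemma dirD_radial {f : ℝ → ℝ} {x : Pt} (hx : x ∈ dense) (hf : DifferentiableAt ℝ f (I.rad x))
    (a : Fin 4) : dirD I.fr a (fun y => f (I.rad y)) x =
      if a = 0 then I.sA (I.rad x) * deriv f (I.rad x) else 0 := by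
  have h1 : dirD I.fr a (fun y => f (I.rad y)) x =
      2 * I.frad a (I.rad x) * deriv f (I.rad x) * ∑ k, wMat x a k * x k := by
    simp only [dirD, I.pd_radial hf, fr_apply, Finset.mul_sum]
    exact Finset.sum_congr rfl fun k _ => by ring
  rw [h1, sum_wMat_mul]
  split_ifs with ha
  · have h : I.rad x - I.rPlus = normSq x := by simp [rad]
    have := normSq_pos hx
    subst ha
    simp only [frad, h, Matrix.cons_val_zero]
    field_simp
  · simp

/-- `wMat` is linear in the point, so its derivative along a vector v is its value at v. All
brackets of the frame thus reduce to radial derivatives and to the compositions in `wMat_comp`. -/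
lemma dirD_fr {x : Pt} (hx : x ∈ dense) (a b l : Fin 4) :
    dirD I.fr a (fun y => I.fr y b l) x =
      (if a = 0 then I.sA (I.rad x) * deriv (I.frad b) (I.rad x) else 0) * wMat x b l +
        I.frad a (I.rad x) * I.frad b (I.rad x) * wMat (wMat x a) b l := by
  have hf := I.differentiableAt_radial (I.contDiffOn_frad b) (I.rad_gt hx)
  have h1 : DifferentiableAt ℝ (fun y => I.frad b (I.rad y)) x :=
    differentiableAt_of_contDiffOn (by simp) (I.contDiffOn_comp_rad (I.contDiffOn_frad b)) hx
  have h2 : DifferentiableAt ℝ (fun y => wMat y b l) x :=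
    (contDiff_wMat b l).differentiable (by simp) x
  rw [← I.dirD_radial hx hf, ← sum_wMat_pd x (wMat x a) b l]
  simp only [dirD, fr_apply, pd_mul h1 h2, Finset.sum_mul, Finset.mul_sum]
  rw [← Finset.sum_add_distrib]
  exact Finset.sum_congr rfl fun k _ => by ring

lemma deriv_β {r : ℝ} (hr : I.rPlus < r) : I.sA r * deriv I.β r = -(I.κ1 r * I.β r) := by
  have hB := I.B_pos hr
  have h1 : HasDerivAt I.B (2 * r) r := by
    unfold B
    simpa using (hasDerivAt_pow 2 r).sub_const (I.N ^ 2)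
  have h2 := ((hasDerivAt_const r (1 : ℝ)).div (h1.sqrt hB.ne') (Real.sqrt_pos.2 hB).ne').deriv
  have h3 : deriv I.β r = _ := h2
  rw [h3, κ1, β]
  have hs : √(I.B r) ^ 2 = I.B r := Real.sq_sqrt hB.le
  have hs0 : √(I.B r) ≠ 0 := (Real.sqrt_pos.2 hB).ne'
  generalize √(I.B r) = s at *
  rw [← hs]
  field_simp
  ring

lemma deriv_γ {r : ℝ} (hr : I.rPlus < r) : I.sA r * deriv I.γ r = -(I.κ3 r * I.γ r) := by
  have hA := I.sA_pos hr
  have hN := I.N_pos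
  have h1 := (I.differentiableAt_radial I.contDiffOn_sA hr).hasDerivAt
  have h2 := ((hasDerivAt_const r (1 : ℝ)).div (h1.const_mul (2 * I.N)) (by positivity)).deriv
  have h3 : deriv I.γ r = _ := h2
  rw [h3, κ3, γ]
  change _ = -(deriv I.sA r * (1 / (2 * I.N * I.sA r)))
  field_simp
  ring

/-- The quaternion relations between the three complex structures x ↦ w_i(x). They encode the
structure equations of SU(2). -/
lemma wMat_comp (x : Pt) (l : Fin 4) :
    wMat (wMat x 1) 2 l = -wMat x 3 l ∧ wMat (wMat x 2) 1 l = wMat x 3 l ∧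
    wMat (wMat x 2) 3 l = -wMat x 1 l ∧ wMat (wMat x 3) 2 l = wMat x 1 l ∧
    wMat (wMat x 3) 1 l = -wMat x 2 l ∧ wMat (wMat x 1) 3 l = wMat x 2 l := by
  fin_cases l <;> simp [wMat, w1, w2, w3]

lemma torsion_fr {x : Pt} (hx : x ∈ dense) (a b l : Fin 4) :
    dirD I.fr a (fun y => I.fr y b l) x - dirD I.fr b (fun y => I.fr y a l) x =
      ∑ d, (I.connX a x b d - I.connX b x a d) * I.fr x d l := by
  have hr := I.rad_gt hx
  have e1 : I.sA (I.rad x) * deriv (I.frad 1) (I.rad x) =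
      -(I.κ1 (I.rad x) * (I.β (I.rad x) / 2)) := by
    have : I.frad 1 = fun r => I.β r / 2 := rfl
    rw [this, deriv_div_const]
    linear_combination (1 / 2) * I.deriv_β hr
  have e2 : I.sA (I.rad x) * deriv (I.frad 2) (I.rad x) =
      -(I.κ1 (I.rad x) * (I.β (I.rad x) / 2)) := e1
  have e3 : I.sA (I.rad x) * deriv (I.frad 3) (I.rad x) =
      -(I.κ3 (I.rad x) * (I.γ (I.rad x) / 2)) := by
    have : I.frad 3 = fun r => I.γ r / 2 := rfl
    rw [this, deriv_div_const]
    linear_combination (1 / 2) * I.deriv_γ hr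
  -- Both sides are 1 / B. This identity matches the e_3 component of [e_1, e_2]; the other brackets
  -- agree without it.
  have e4 : 2 * (I.N * I.sA (I.rad x) / I.B (I.rad x)) * I.γ (I.rad x) = I.β (I.rad x) ^ 2 := by
    have hB := I.B_pos hr
    have hA := I.sA_pos hr
    have hN := I.N_pos
    have hs : √(I.B (I.rad x)) ^ 2 = I.B (I.rad x) := Real.sq_sqrt hB.le
    have hs0 := (Real.sqrt_pos.2 hB).ne'
    simp only [β, γ, div_pow, hs]
    change 2 * (I.N * I.sA (I.rad x) / I.B (I.rad x)) * (1 / (2 * I.N * I.sA (I.rad x))) = _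
    field_simp
  have z1 : ∀ a, wMat (wMat x 0) a l = wMat x a l := fun a => rfl
  have z2 : ∀ a, wMat (wMat x a) 0 l = wMat x a l := fun a => rfl
  obtain ⟨w12, w21, w23, w32, w31, w13⟩ := wMat_comp x l
  have f0 : ∀ r, I.frad 1 r = I.β r / 2 ∧ I.frad 2 r = I.β r / 2 ∧ I.frad 3 r = I.γ r / 2 :=
    fun r => ⟨rfl, rfl, rfl⟩
  have key : ∀ a b : Fin 4, a < b →
      dirD I.fr a (fun y => I.fr y b l) x - dirD I.fr b (fun y => I.fr y a l) x =
      ∑ d, (I.connX a x b d - I.connX b x a d) * I.fr x d l := by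
    intro a b hab
    rw [I.dirD_fr hx, I.dirD_fr hx]
    simp only [fr_apply, Fin.sum_univ_four, connX]
    obtain ⟨f1, f2, f3⟩ := f0 (I.rad x)
    generalize I.rad x = r at *
    fin_cases a <;> fin_cases b <;> first
      | exact absurd hab (by decide)
      | (simp [conn, z1, z2, w12, w21, w23, w32, w31, w13, e1, e2, e3, f1, f2, f3, Γ1, Γ3]
         first
          | ring1
          | linear_combination (wMat x 3 l / 2) * e4)
  rcases lt_trichotomy a b with h | h | h
  · exact key a b h
  · subst h
    simp
  · have h1 := key b a h
    rw [← neg_sub, h1, ← Finset.sum_neg_distrib]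
    exact Finset.sum_congr rfl fun d _ => by ring

lemma isFrame : IsFrame I.metric I.fr I.connX where
  smooth_g := I.contDiffOn_metric
  smooth_E := I.smooth_fr
  smooth_C := I.contDiffOn_christoffel
  smooth_W := fun c i j => I.contDiffOn_comp_rad (I.contDiffOn_conn c i j)
  ortho := fun x hx => I.frame_orthonormal hx
  skew := fun x _ c => by
    ext i j
    fin_cases c <;> fin_cases i <;> fin_cases j <;> simp [connX, conn]
  torsion := fun x hx a b l => I.torsion_fr hx a b l

end Instanton

end AdSTaubNUT

end

/-! ### The operator and the divergence in terms of radial and left-invariant derivatives -/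

noncomputable section

namespace AdSTaubNUT

open Matrix

/-- The derivative along `w_i / 2`; for `i = 1, 2, 3` these are the vector fields dual to the
left-invariant one-forms. -/
def xD (i : Fin 4) (f : Pt → ℝ) (x : Pt) : ℝ := ∑ k, Instanton.wMat x i k / 2 * pd k f x

/-- The entrywise derivative along `w_i / 2`. -/
def mxD (i : Fin 4) (M : Pt → M4) (x : Pt) : M4 := ∑ k, (Instanton.wMat x i k / 2) • mpd k M x

lemma mxD_apply (i : Fin 4) (M : Pt → M4) (x : Pt) (a b : Fin 4) :
    mxD i M x a b = xD i (fun y => M y a b) x := by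
  simp [mxD, xD, Matrix.sum_apply, mpd]

namespace Instanton

variable (I : Instanton)

/-- The trace of the second fundamental form of the level sets of the radial function. -/
def κtr (r : ℝ) : ℝ := 2 * I.κ1 r + I.κ3 r

/-- The radial derivative of the connection matrices. -/
def connD (c : Fin 4) (r : ℝ) : M4 :=
  Matrix.of fun i j => I.sA r * deriv (fun t => I.conn c t i j) r

/-- The curvature in the orthonormal frame. -/
def curv (p q : Fin 4) (r : ℝ) : M4 :=
  (if p = 0 then I.connD q r else 0) - (if q = 0 then I.connD p r else 0) -
    ∑ c, (I.conn p r q c - I.conn q r p c) • I.conn c r +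
    I.conn q r * I.conn p r - I.conn p r * I.conn q r

/-- The action of the connection matrices on symmetric tensors. -/
def act (c : Fin 4) (r : ℝ) (M : M4) : M4 := I.conn c r * M - M * I.conn c r

/-- The action of the curvature on symmetric tensors. -/
def curvAct (r : ℝ) (M : M4) : M4 := Matrix.of fun P Q => ∑ C, ∑ D, I.curv Q D r C P * M C D

variable {I}

lemma mdirD_connX {x : Pt} (hx : x ∈ dense) (a c : Fin 4) :
    mdirD I.fr a (I.connX c) x = if a = 0 then I.connD c (I.rad x) else 0 := by
  ext i j
  rw [mdirD_apply]
  have h := I.dirD_radial hx (I.differentiableAt_radial (I.contDiffOn_conn c i j) (I.rad_gt hx)) a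
  simp only [connX]
  rw [h]
  split_ifs <;> simp [connD]

lemma curvF_eq {x : Pt} (hx : x ∈ dense) (p q : Fin 4) :
    curvF I.fr I.connX p q x = I.curv p q (I.rad x) := by
  simp only [curvF, mdirD_connX hx, curv]
  rfl

lemma conn_skew (c : Fin 4) (r : ℝ) : (I.conn c r)ᵀ = -I.conn c r := by
  ext i j
  fin_cases c <;> fin_cases i <;> fin_cases j <;> simp [conn]

lemma covF_eq (c : Fin 4) (H : Pt → M4) (x : Pt) :
    covF I.fr I.connX c H x = mdirD I.fr c H x - I.act c (I.rad x) (H x) := by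
  simp only [covF, act, connX, conn_skew]
  noncomm_ring

lemma act_sub (c : Fin 4) (r : ℝ) (M N : M4) : I.act c r (M - N) = I.act c r M - I.act c r N := by
  simp only [act]
  noncomm_ring

lemma act_zero (r : ℝ) (M : M4) : I.act 0 r M = 0 := by
  have : I.conn 0 r = 0 := rfl
  simp [act, this]

lemma mdirD_mul {M N : Pt → M4} {x : Pt} (hM : MDiff M x) (hN : MDiff N x) (c : Fin 4) :
    mdirD I.fr c (fun y => M y * N y) x = mdirD I.fr c M x * N x + M x * mdirD I.fr c N x := by
  simp only [mdirD, mpd_mul hM hN, smul_add, Finset.sum_add_distrib, Matrix.sum_mul,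
    Matrix.mul_sum, Matrix.smul_mul, Matrix.mul_smul]

lemma mdirD_sub {M N : Pt → M4} {x : Pt} (hM : MDiff M x) (hN : MDiff N x) (c : Fin 4) :
    mdirD I.fr c (fun y => M y - N y) x = mdirD I.fr c M x - mdirD I.fr c N x := by
  simp only [mdirD, mpd_sub hM hN, smul_sub, Finset.sum_sub_distrib]

/-- The connection matrix with index c is constant along e_c: for c ≠ 0 it is radial and e_c is
tangential, and for c = 0 it is zero. -/
lemma mdirD_act {H : Pt → M4} {x : Pt} (hx : x ∈ dense) (hH : MDiff H x) (c : Fin 4) :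
    mdirD I.fr c (fun y => I.act c (I.rad y) (H y)) x = I.act c (I.rad x) (mdirD I.fr c H x) := by
  have hW : MDiff (I.connX c) x := I.isFrame.mdiff_W hx c
  have h0 : mdirD I.fr c (I.connX c) x = 0 := by
    rw [mdirD_connX hx]
    split_ifs with h
    · subst h
      ext i j
      have : ∀ t, I.conn 0 t i j = 0 := fun t => rfl
      simp [connD, this]
    · rfl
  have h1 := mdirD_sub (I := I) (hW.mul hH) (hH.mul hW) c
  rw [mdirD_mul hW hH, mdirD_mul hH hW, h0] at h1
  simp only [Matrix.zero_mul, Matrix.mul_zero, zero_add, add_zero] at h1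
  exact h1

lemma covF_covF {H : Pt → M4} {x : Pt} (hx : x ∈ dense) (hH : MDiff H x) (c : Fin 4)
    (hD : MDiff (mdirD I.fr c H) x) :
    covF I.fr I.connX c (covF I.fr I.connX c H) x =
      mdirD I.fr c (mdirD I.fr c H) x - (2 : ℝ) • I.act c (I.rad x) (mdirD I.fr c H x) +
        I.act c (I.rad x) (I.act c (I.rad x) (H x)) := by
  have hW : MDiff (I.connX c) x := I.isFrame.mdiff_W hx c
  have hA : MDiff (fun y => I.act c (I.rad y) (H y)) x := (hW.mul hH).sub (hH.mul hW)
  have h1 : covF I.fr I.connX c H = fun y => mdirD I.fr c H y - I.act c (I.rad y) (H y) :=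
    funext fun y => covF_eq c H y
  rw [covF_eq, h1, mdirD_sub hD hA, mdirD_act hx hH, act_sub]
  module

lemma mdirD_eq_mxD {H : Pt → M4} {x : Pt} {c : Fin 4} (hc : c ≠ 0) :
    mdirD I.fr c H x = I.invb c (I.rad x) • mxD c H x := by
  have h : I.frad c (I.rad x) = I.invb c (I.rad x) / 2 := by
    fin_cases c
    · exact absurd rfl hc
    all_goals rfl
  simp only [mdirD, mxD, fr_apply, Finset.smul_sum, smul_smul, h]
  exact Finset.sum_congr rfl fun k _ => by congr 1; ring

/-- Frame components with second derivatives. -/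
structure MC2 (H : Pt → M4) : Prop where
  cd : ∀ i j, ContDiffOn ℝ 2 (fun x => H x i j) dense

lemma MC2.mdiff {H : Pt → M4} (hH : MC2 H) {x : Pt} (hx : x ∈ dense) : MDiff H x := fun i j =>
  differentiableAt_of_contDiffOn (by simp) (hH.cd i j) hx

lemma MC2.contDiffOn_mdirD {H : Pt → M4} (hH : MC2 H) (c i j : Fin 4) :
    ContDiffOn ℝ 1 (fun x => mdirD I.fr c H x i j) dense := by
  simp only [mdirD_apply, dirD]
  exact ContDiffOn.sum fun k _ => ((I.smooth_fr c k).of_le le_top).mul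
    (contDiffOn_pd' (n := 2) (m := 1) (by norm_num) (hH.cd i j) k)

lemma MC2.contDiffOn_mxD {H : Pt → M4} (hH : MC2 H) (c i j : Fin 4) :
    ContDiffOn ℝ 1 (fun x => mxD c H x i j) dense := by
  simp only [mxD_apply, xD]
  exact ContDiffOn.sum fun k _ => (((contDiff_wMat c k).contDiffOn.of_le le_top).div_const 2).mul
    (contDiffOn_pd' (n := 2) (m := 1) (by norm_num) (hH.cd i j) k)

lemma MC2.mdiff_mdirD {H : Pt → M4} (hH : MC2 H) (c : Fin 4) {x : Pt} (hx : x ∈ dense) :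
    MDiff (mdirD I.fr c H) x := fun i j =>
  differentiableAt_of_contDiffOn (by simp) (hH.contDiffOn_mdirD c i j) hx

lemma MC2.mdiff_mxD {H : Pt → M4} (hH : MC2 H) (c : Fin 4) {x : Pt} (hx : x ∈ dense) :
    MDiff (mxD c H) x := fun i j =>
  differentiableAt_of_contDiffOn (by simp) (hH.contDiffOn_mxD c i j) hx

lemma mdirD_mdirD {H : Pt → M4} (hH : MC2 H) {x : Pt} (hx : x ∈ dense) {c : Fin 4} (hc : c ≠ 0) :
    mdirD I.fr c (mdirD I.fr c H) x = I.invb c (I.rad x) ^ 2 • mxD c (mxD c H) x := by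
  have h1 : mdirD I.fr c H = fun y => I.invb c (I.rad y) • mxD c H y :=
    funext fun y => mdirD_eq_mxD hc
  have h2 : DifferentiableAt ℝ (fun y => I.invb c (I.rad y)) x :=
    differentiableAt_of_contDiffOn (by simp) (I.contDiffOn_comp_rad (I.contDiffOn_invb c)) hx
  have h3 := I.dirD_radial hx (I.differentiableAt_radial (I.contDiffOn_invb c) (I.rad_gt hx)) c
  rw [if_neg hc] at h3
  have h4 : mdirD I.fr c (fun y => I.invb c (I.rad y) • mxD c H y) x =
      dirD I.fr c (fun y => I.invb c (I.rad y)) x • mxD c H x +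
        I.invb c (I.rad x) • mdirD I.fr c (mxD c H) x := by
    simp only [mdirD, dirD, mpd_smul h2 (hH.mdiff_mxD c hx), smul_add, Finset.sum_add_distrib,
      Finset.sum_smul, Finset.smul_sum, smul_smul]
    congr 1
    exact Finset.sum_congr rfl fun k _ => by rw [mul_comm]
  rw [h1, h4, h3, mdirD_eq_mxD hc, smul_smul, pow_two, zero_smul, zero_add]

/-- The frame components of the modified Lichnerowicz operator. -/
lemma frameMat_modLich {h : Field} (hh : I.IsC2 h) (hH : MC2 (frameMat I.fr h)) {x : Pt}
    (hx : x ∈ dense) :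
    frameMat I.fr (modLich I.metric h) x =
      -mdirD I.fr 0 (mdirD I.fr 0 (frameMat I.fr h)) x -
        I.κtr (I.rad x) • mdirD I.fr 0 (frameMat I.fr h) x -
        ∑ c, (I.invb c (I.rad x) ^ 2 • mxD c (mxD c (frameMat I.fr h)) x -
          (2 * I.invb c (I.rad x)) • I.act c (I.rad x) (mxD c (frameMat I.fr h) x) +
          I.act c (I.rad x) (I.act c (I.rad x) (frameMat I.fr h x))) -
        (2 : ℝ) • I.curvAct (I.rad x) (frameMat I.fr h x) := by
  set H := frameMat I.fr h with hHdef
  have hd : ∀ y ∈ dense, MDiff (fun y => Matrix.of (h y)) y := fun y hy i j =>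
    hh.differentiableAt hy i j
  have hc : ∀ k, MDiff (fun y => Matrix.of (cov I.metric h y k)) x := fun k i j =>
    hh.differentiableAt_cov hx k i j
  have e1 : ∀ c, covF I.fr I.connX c (covF I.fr I.connX c H) x =
      (if c = 0 then mdirD I.fr 0 (mdirD I.fr 0 H) x else 0) +
      (I.invb c (I.rad x) ^ 2 • mxD c (mxD c H) x -
          (2 * I.invb c (I.rad x)) • I.act c (I.rad x) (mxD c H x) +
          I.act c (I.rad x) (I.act c (I.rad x) (H x))) := by
    intro c
    rw [covF_covF hx (hH.mdiff hx) c (hH.mdiff_mdirD c hx)]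
    by_cases hc : c = 0
    · subst hc
      have : I.invb 0 (I.rad x) = 0 := rfl
      simp [act_zero, this]
    · rw [mdirD_mdirD hH hx hc, mdirD_eq_mxD hc, if_neg hc, zero_add]
      have : ∀ (t : ℝ) (M : M4), I.act c (I.rad x) (t • M) = t • I.act c (I.rad x) M :=
        fun t M => by simp [act, smul_sub]
      rw [this, smul_smul]
  -- The sum of ∇_{e_p} e_p is -`κtr` e_0, the mean curvature vector of the level sets of r.
  have e2 : ∑ p, ∑ r, I.connX p x p r • covF I.fr I.connX r H x =
      -(I.κtr (I.rad x) • mdirD I.fr 0 H x) := by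
    have h0 : covF I.fr I.connX 0 H x = mdirD I.fr 0 H x := by
      rw [covF_eq, act_zero, sub_zero]
    rw [← h0]
    simp [Fin.sum_univ_four, connX, conn, κtr]
    module
  ext P Q
  rw [I.isFrame.frame_modLich hx hd hc]
  simp only [← hHdef, Finset.sum_sub_distrib, e1, e2, curvF_eq hx]
  rw [Finset.sum_add_distrib]
  simp only [Finset.sum_ite_eq', Finset.mem_univ, if_true, Matrix.sub_apply, Matrix.neg_apply,
    Matrix.add_apply, Matrix.smul_apply, curvAct, Matrix.of_apply, smul_eq_mul]
  simp only [Finset.sum_sub_distrib, Finset.sum_add_distrib, Matrix.add_apply, Matrix.sub_apply]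
  ring

/-- The frame components of the divergence. -/
lemma frame_divergence_eq {h : Field} (hh : I.IsC2 h) {x : Pt} (hx : x ∈ dense) (Q : Fin 4) :
    ∑ b, I.fr x Q b * divergence I.metric h x b =
      mdirD I.fr 0 (frameMat I.fr h) x 0 Q +
        ∑ c, (I.invb c (I.rad x) * mxD c (frameMat I.fr h) x c Q -
          I.act c (I.rad x) (frameMat I.fr h x) c Q) := by
  rw [I.isFrame.frame_divergence hx fun i j => hh.differentiableAt hx i j]
  have e1 : ∀ c, covF I.fr I.connX c (frameMat I.fr h) x c Q =
      (if c = 0 then mdirD I.fr 0 (frameMat I.fr h) x 0 Q else 0) +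
      (I.invb c (I.rad x) * mxD c (frameMat I.fr h) x c Q -
          I.act c (I.rad x) (frameMat I.fr h x) c Q) := fun c => by
    rw [covF_eq]
    by_cases hc : c = 0
    · subst hc
      have : I.invb 0 (I.rad x) = 0 := rfl
      simp [act_zero, this]
    · rw [mdirD_eq_mxD hc, if_neg hc, zero_add, Matrix.sub_apply, Matrix.smul_apply, smul_eq_mul]
  simp only [e1]
  rw [Finset.sum_add_distrib]
  simp

lemma IsC2.mc2 {h : Field} (hh : I.IsC2 h) : MC2 (frameMat I.fr h) where
  cd := fun i j => by
    simp only [frameMat, Matrix.mul_apply, Matrix.of_apply, Matrix.transpose_apply]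
    exact ContDiffOn.sum fun b _ => (ContDiffOn.sum fun a _ =>
      ((I.smooth_fr i a).of_le le_top).mul (hh.1 a b)).mul ((I.smooth_fr j b).of_le le_top)

lemma frameComp_apply (h : Field) (x : Pt) (a b : Fin 4) :
    I.frameComp h x (a, b) = frameMat I.fr h x a b := by
  simp only [frameComp, frameMat, Matrix.mul_apply, Matrix.transpose_apply, fr, Matrix.of_apply,
    Finset.sum_mul]
  rw [Finset.sum_comm]
  exact Finset.sum_congr rfl fun a _ => Finset.sum_congr rfl fun b _ => by ring

end Instanton

end AdSTaubNUT

end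

noncomputable section

namespace AdSTaubNUT

open Matrix

/-! ### Spherical coordinates -/

/-- Euclidean four-space. -/
abbrev E4 : Type := EuclideanSpace ℝ (Fin 4)

/-- The unit three-sphere. -/
abbrev S3 : Type := Metric.sphere (0 : E4) 1

/-- The surface measure of the three-sphere. -/
def sph : Measure S3 := (volume : Measure E4).toSphere

instance : IsFiniteMeasure sph := inferInstanceAs (IsFiniteMeasure (volume : Measure E4).toSphere)

instance : sph.IsOpenPosMeasure :=
  inferInstanceAs ((volume : Measure E4).toSphere.IsOpenPosMeasure)

/-- The point of the three-sphere `|x|² = s` in the direction `q`. -/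
def ray (s : ℝ) (q : S3) : Pt := fun i => √s * q.1 i

lemma sum_sq_sphere (q : S3) : ∑ i, q.1 i ^ 2 = 1 := by
  have h : ‖(q.1 : E4)‖ = 1 := by simp
  have h2 := EuclideanSpace.norm_sq_eq q.1
  rw [h] at h2
  simpa using h2.symm

lemma normSq_ray {s : ℝ} (hs : 0 ≤ s) (q : S3) : normSq (ray s q) = s := by
  simp only [normSq, ray, mul_pow, Real.sq_sqrt hs, ← Finset.mul_sum, sum_sq_sphere, mul_one]

lemma ray_mem {s : ℝ} (hs : 0 < s) (q : S3) : ray s q ∈ dense := by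
  intro h
  have h1 := normSq_ray hs.le q
  rw [Set.mem_singleton_iff.1 h] at h1
  simp [normSq] at h1
  exact hs.ne h1

lemma continuous_ray : Continuous fun p : ℝ × S3 => ray p.1 p.2 := by
  unfold ray
  refine continuous_pi fun i => ?_
  have : Continuous fun p : ℝ × S3 => (p.2.1 : E4) i := by fun_prop
  exact (Real.continuous_sqrt.comp continuous_fst).mul this

/-- Polar coordinates with s = |x|² in place of |x|, because s = r - r_+. The density t³ dt becomes
(s/2) ds under s = t². -/
lemma lintegral_polar {F : Pt → ENNReal} (hF : Measurable F) :
    ∫⁻ x, F x = ∫⁻ s in Set.Ioi (0 : ℝ), ENNReal.ofReal (s / 2) * ∫⁻ q, F (ray s q) ∂sph := by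
  have hp : MeasurePreserving (WithLp.ofLp : E4 → Pt) := PiLp.volume_preserving_ofLp _
  have hG : Measurable fun x : E4 => F (WithLp.ofLp x) := hF.comp hp.measurable
  rw [← hp.lintegral_comp hF]
  have h1 : ∫⁻ x : E4, F (WithLp.ofLp x) =
      ∫⁻ x : ({(0)}ᶜ : Set E4), F (WithLp.ofLp x.1) ∂((volume : Measure E4).comap (↑)) := by
    rw [lintegral_subtype_comap (measurableSet_singleton _).compl fun x : E4 => F (WithLp.ofLp x),
      restrict_compl_singleton]
  have h2 := (volume : Measure E4).measurePreserving_homeomorphUnitSphereProd.symm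
    (homeomorphUnitSphereProd E4).toMeasurableEquiv
  have h2' := h2.lintegral_comp (hG.comp measurable_subtype_coe)
  refine h1.trans (h2'.symm.trans ?_)
  have hd : Module.finrank ℝ E4 - 1 = 3 := by simp
  rw [hd]
  have h3 : Measurable fun p : S3 × Set.Ioi (0 : ℝ) => F (fun i => p.2.1 * p.1.1 i) := by
    refine hF.comp ?_
    refine measurable_pi_lambda _ fun i => ?_
    fun_prop
  have h4 : ∫⁻ p : S3 × Set.Ioi (0 : ℝ), F (fun i => p.2.1 * p.1.1 i)
      ∂((volume : Measure E4).toSphere.prod (Measure.volumeIoiPow 3)) =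
      ∫⁻ t : Set.Ioi (0 : ℝ), ∫⁻ q, F (fun i => t.1 * q.1 i) ∂sph ∂(Measure.volumeIoiPow 3) :=
    lintegral_prod_symm' _ h3
  have h5 : Measurable fun t : Set.Ioi (0 : ℝ) => ∫⁻ q, F (fun i => t.1 * q.1 i) ∂sph :=
    h3.lintegral_prod_left'
  calc _ = ∫⁻ p : S3 × Set.Ioi (0 : ℝ), F (fun i => p.2.1 * p.1.1 i)
      ∂((volume : Measure E4).toSphere.prod (Measure.volumeIoiPow 3)) := rfl
    _ = ∫⁻ t in Set.Ioi (0 : ℝ), ENNReal.ofReal (t ^ 3) *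
        ∫⁻ q, F (fun i => t * q.1 i) ∂sph := by
      rw [h4, Measure.volumeIoiPow, lintegral_withDensity_eq_lintegral_mul _ (by fun_prop) h5]
      exact lintegral_subtype_comap measurableSet_Ioi
        fun t : ℝ => ENNReal.ofReal (t ^ 3) * ∫⁻ q, F (fun i => t * q.1 i) ∂sph
    _ = _ := by
      have h6 : (fun t : ℝ => t ^ 2) '' Set.Ioi 0 = Set.Ioi 0 := by
        ext s
        constructor
        · rintro ⟨t, ht, rfl⟩
          exact pow_pos (Set.mem_Ioi.1 ht) 2
        · intro hs
          exact ⟨√s, Real.sqrt_pos.2 hs, Real.sq_sqrt (le_of_lt hs)⟩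
      have h7 := lintegral_image_eq_lintegral_abs_deriv_mul (s := Set.Ioi (0 : ℝ))
        (f := fun t : ℝ => t ^ 2) (f' := fun t => 2 * t) measurableSet_Ioi
        (fun t _ => by simpa using (hasDerivAt_pow 2 t).hasDerivWithinAt)
        (fun a ha b hb h => by
          exact (pow_left_inj₀ (le_of_lt ha) (le_of_lt hb) two_ne_zero).1 h)
        (fun s => ENNReal.ofReal (s / 2) * ∫⁻ q, F (ray s q) ∂sph)
      rw [h6] at h7
      rw [h7]
      refine setLIntegral_congr_fun measurableSet_Ioi fun t ht => ?_
      have ht' : (0 : ℝ) < t := ht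
      have h8 : ∀ q : S3, ray (t ^ 2) q = fun i => t * q.1 i := fun q => by
        funext i
        simp only [ray, Real.sqrt_sq ht'.le]
      simp only [h8]
      rw [← mul_assoc, ← ENNReal.ofReal_mul (abs_nonneg _), abs_of_pos (by positivity)]
      congr 2
      ring

namespace Instanton

variable (I : Instanton)

/-- The factors A of the radial and of the fibre direction cancel. With the density s/2 of
`lintegral_polar` this gives the volume element 16 N B dr on the unit sphere bundle of directions.
-/
lemma sqrt_det_metric {x : Pt} (hx : x ∈ dense) :
    √(Matrix.of (I.metric x)).det = 32 * I.N * I.B (I.rad x) / normSq x := by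
  have hs := normSq_pos hx
  have hA := I.A_pos (I.rad_gt hx)
  have hB := I.B_pos (I.rad_gt hx)
  have hN := I.N_pos
  have h1 : (wMat x).det * (wMat x).det = normSq x ^ 4 := by
    have := congrArg Matrix.det (wMat_mul x)
    rw [Matrix.det_mul, Matrix.det_transpose, Matrix.det_smul, Matrix.det_one] at this
    simpa using this
  have h2 : (Matrix.of (I.metric x)).det = (32 * I.N * I.B (I.rad x) / normSq x) ^ 2 := by
    rw [metric_eq, Matrix.det_mul, Matrix.det_mul, Matrix.det_transpose, Matrix.det_diagonal,
      Fin.prod_univ_four]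
    have : ∀ c, (wMat x).det * c * (wMat x).det = c * normSq x ^ 4 := fun c => by
      rw [← h1]
      ring
    rw [this]
    simp [coef]
    field_simp
    ring
  rw [h2, Real.sqrt_sq (by positivity)]

lemma aemeasurable_density :
    AEMeasurable (fun x => ENNReal.ofReal √(Matrix.of (I.metric x)).det) (volume : Measure Pt) := by
  have hc : ContinuousOn (fun x => (Matrix.of (I.metric x)).det) dense :=
    (contDiffOn_det fun i j => I.contDiffOn_metric i j).continuousOn
  have := (hc.aemeasurable isOpen_dense.measurableSet (μ := volume)).sqrt.ennreal_ofReal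
  rwa [Measure.restrict_eq_self_of_ae_mem ae_volume_dense] at this

lemma rad_ray {s : ℝ} (hs : 0 ≤ s) (q : S3) : I.rad (ray s q) = I.rPlus + s := by
  rw [rad, normSq_ray hs]

/-- Integration with respect to the Riemannian volume. -/
lemma lintegral_vol {f : Pt → ℝ} (hf : ContinuousOn f dense) :
    ∫⁻ x, ENNReal.ofReal (f x) ∂I.vol =
      ∫⁻ r in Set.Ioi I.rPlus, ENNReal.ofReal (16 * I.N * I.B r) *
        ∫⁻ q, ENNReal.ofReal (f (ray (r - I.rPlus) q)) ∂sph := by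
  classical
  have hfm : Measurable (dense.indicator f) :=
    by
    rw [← Set.piecewise_eq_indicator]
    exact hf.measurable_piecewise continuousOn_const isOpen_dense.measurableSet
  have hdm : Measurable (dense.indicator fun x => 32 * I.N * I.B (I.rad x) / normSq x) := by
    rw [← Set.piecewise_eq_indicator]
    refine ContinuousOn.measurable_piecewise (ContinuousOn.div ?_ ?_ ?_) continuousOn_const
      isOpen_dense.measurableSet
    · exact (continuous_const.mul (I.contDiff_B.continuous.comp
        I.contDiff_rad.continuous)).continuousOn
    · exact contDiff_normSq.continuous.continuousOn
    · exact fun x hx => (normSq_pos hx).ne'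
  have hfae : AEMeasurable (fun x => ENNReal.ofReal (f x)) (volume : Measure Pt) := by
    refine ⟨_, hfm.ennreal_ofReal, ?_⟩
    filter_upwards [ae_volume_dense] with x hx
    rw [Set.indicator_of_mem hx]
  rw [vol, lintegral_withDensity_eq_lintegral_mul₀ I.aemeasurable_density hfae]
  have h1 : ∫⁻ x, ((fun x => ENNReal.ofReal √(Matrix.of (I.metric x)).det) *
      fun x => ENNReal.ofReal (f x)) x =
      ∫⁻ x, ENNReal.ofReal (dense.indicator (fun x => 32 * I.N * I.B (I.rad x) / normSq x) x) *
        ENNReal.ofReal (dense.indicator f x) := by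
    refine lintegral_congr_ae ?_
    filter_upwards [ae_volume_dense] with x hx
    rw [Set.indicator_of_mem hx, Set.indicator_of_mem hx, Pi.mul_apply, I.sqrt_det_metric hx]
  rw [h1]
  refine (lintegral_polar (hdm.ennreal_ofReal.mul hfm.ennreal_ofReal)).trans ?_
  have h2 : (fun s : ℝ => I.rPlus + s) '' Set.Ioi 0 = Set.Ioi I.rPlus := by
    simp
  have h3 := lintegral_image_eq_lintegral_abs_deriv_mul (s := Set.Ioi (0 : ℝ))
    (f := fun s : ℝ => I.rPlus + s) (f' := fun _ => 1) measurableSet_Ioi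
    (fun t _ => ((hasDerivAt_id t).const_add _).hasDerivWithinAt)
    (fun a _ b _ h => by simpa using h)
    (fun r => ENNReal.ofReal (16 * I.N * I.B r) *
        ∫⁻ q, ENNReal.ofReal (f (ray (r - I.rPlus) q)) ∂sph)
  rw [h2] at h3
  rw [h3]
  refine setLIntegral_congr_fun measurableSet_Ioi fun s hs => ?_
  have hs' : (0 : ℝ) < s := hs
  have hN := I.N_pos
  have hB := I.B_pos (r := I.rPlus + s) (by linarith)
  have h4 : ∀ q, dense.indicator (fun x => 32 * I.N * I.B (I.rad x) / normSq x) (ray s q) =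
      32 * I.N * I.B (I.rPlus + s) / s := fun q => by
    rw [Set.indicator_of_mem (ray_mem hs' q), I.rad_ray hs'.le, normSq_ray hs'.le]
  have h5 : ∀ q, dense.indicator f (ray s q) = f (ray s q) := fun q =>
    Set.indicator_of_mem (ray_mem hs' q) _
  simp only [Pi.mul_apply, h4, h5, abs_one, ENNReal.ofReal_one, one_mul, add_sub_cancel_left]
  rw [lintegral_const_mul' _ _ ENNReal.ofReal_ne_top, ← mul_assoc,
    ← ENNReal.ofReal_mul (by positivity)]
  congr 2
  field_simp
  ring

end Instanton

end AdSTaubNUT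

end

noncomputable section

namespace AdSTaubNUT

open Matrix
open scoped Pointwise

/-! ### Rotations and moments -/

/-- The action of a linear isometry on the sphere. -/
def rotS (L : E4 ≃ₗᵢ[ℝ] E4) (q : S3) : S3 := ⟨L q.1, by simp⟩

/-- The measure of a set in the sphere is a multiple of the volume of the cone over it; an isometry
maps cones to cones and preserves volume. -/
lemma measurePreserving_rotS (L : E4 ≃ₗᵢ[ℝ] E4) : MeasurePreserving (rotS L) sph sph := by
  have hc : Continuous (rotS L) :=
    Continuous.subtype_mk (L.continuous.comp continuous_subtype_val) _
  refine ⟨hc.measurable, ?_⟩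
  ext s hs
  rw [Measure.map_apply hc.measurable hs, sph, Measure.toSphere_apply' _ hs,
    Measure.toSphere_apply' _ (hc.measurable hs)]
  congr 1
  have h1 : (Set.Ioo (0 : ℝ) 1 • (Subtype.val '' (rotS L ⁻¹' s)) : Set E4) =
      L.toHomeomorph.toMeasurableEquiv ⁻¹' (Set.Ioo (0 : ℝ) 1 • (Subtype.val '' s)) := by
    ext x
    simp only [Set.mem_smul, Set.mem_image, Set.mem_preimage]
    constructor
    · rintro ⟨t, ht, _, ⟨q, hq, rfl⟩, rfl⟩
      exact ⟨t, ht, L q.1, ⟨_, hq, rfl⟩, (L.map_smul t q.1).symm⟩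
    · rintro ⟨t, ht, _, ⟨q, hq, rfl⟩, hx⟩
      have h2 : rotS L (rotS L.symm q) = q := by
        apply Subtype.ext
        simp [rotS]
      refine ⟨t, ht, L.symm q.1, ⟨rotS L.symm q, by rwa [h2], rfl⟩, ?_⟩
      have h3 : t • q.1 = L x := hx
      rw [← L.symm.map_smul, h3, L.symm_apply_apply]
  rw [h1]
  have hm : MeasurePreserving L.toHomeomorph.toMeasurableEquiv := L.measurePreserving
  exact hm.measure_preimage_equiv _

lemma fderiv_eq_sum_pd (f : Pt → ℝ) (x v : Pt) : fderiv ℝ f x v = ∑ k, v k * pd k f x := by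
  have h := LinearMap.pi_apply_eq_sum_univ (fderiv ℝ f x).toLinearMap v
  change fderiv ℝ f x v = ∑ k, v k • fderiv ℝ f x _ at h
  rw [h]
  refine Finset.sum_congr rfl fun k _ => ?_
  rw [pd, smul_eq_mul]
  congr 2
  ext j
  simp [Pi.single_apply, eq_comm]

/-- The derivative with respect to `|x|²` along rays. -/
def radD (f : Pt → ℝ) (x : Pt) : ℝ := ∑ k, x k / (2 * normSq x) * pd k f x

lemma hasDerivAt_ray {f : Pt → ℝ} (hf : ContDiffOn ℝ 1 f dense) {s : ℝ} (hs : 0 < s) (q : S3) :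
    HasDerivAt (fun t => f (ray t q)) (radD f (ray s q)) s := by
  have h1 : HasDerivAt (fun t => ray t q) (fun i => 1 / (2 * √s) * q.1 i) s := by
    refine hasDerivAt_pi.2 fun i => ?_
    exact (Real.hasDerivAt_sqrt hs.ne').mul_const _
  have h2 := (differentiableAt_of_contDiffOn (by simp) hf (ray_mem hs q)).hasFDerivAt
  have h3 := h2.comp_hasDerivAt s h1
  rw [fderiv_eq_sum_pd] at h3
  have h4 : radD f (ray s q) = ∑ k, 1 / (2 * √s) * q.1 k * pd k f (ray s q) := by
    rw [radD, normSq_ray hs.le]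
    refine Finset.sum_congr rfl fun k _ => ?_
    have h5 : √s ^ 2 = s := Real.sq_sqrt hs.le
    have h6 : √s ≠ 0 := (Real.sqrt_pos.2 hs).ne'
    congr 1
    simp only [ray]
    nth_rw 2 [← h5]
    field_simp
  rw [h4]
  exact h3

lemma continuousOn_pd {f : Pt → ℝ} (hf : ContDiffOn ℝ 1 f dense) (i : Fin 4) :
    ContinuousOn (pd i f) dense :=
  (contDiffOn_pd' (n := 1) (m := 0) (by norm_num) hf i).continuousOn

lemma continuousOn_radD {f : Pt → ℝ} (hf : ContDiffOn ℝ 1 f dense) :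
    ContinuousOn (radD f) dense := by
  unfold radD
  refine continuousOn_finsetSum _ fun k _ => ContinuousOn.mul (ContinuousOn.div ?_ ?_ ?_)
    (continuousOn_pd hf k)
  · exact (continuous_apply k).continuousOn
  · exact (continuous_const.mul Instanton.contDiff_normSq.continuous).continuousOn
  · exact fun x hx => (mul_pos two_pos (normSq_pos hx)).ne'

lemma continuousOn_xD {f : Pt → ℝ} (hf : ContDiffOn ℝ 1 f dense) (i : Fin 4) :
    ContinuousOn (xD i f) dense := by
  unfold xD
  exact continuousOn_finsetSum _ fun k _ => ContinuousOn.mul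
    ((Instanton.contDiff_wMat i k).continuous.div_const 2).continuousOn (continuousOn_pd hf k)

/-- The moment of `f` against `P` over the sphere `|x|² = s`. -/
def mom (f P : Pt → ℝ) (s : ℝ) : ℝ := ∫ q, f (ray s q) * P (ray 1 q) ∂sph

lemma continuousOn_comp_ray {f : Pt → ℝ} (hf : ContinuousOn f dense) :
    ContinuousOn (fun p : ℝ × S3 => f (ray p.1 p.2)) (Set.Ioi 0 ×ˢ Set.univ) :=
  hf.comp continuous_ray.continuousOn fun p hp => ray_mem hp.1 p.2

lemma continuous_ray_right (s : ℝ) : Continuous fun q : S3 => ray s q :=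
  continuous_ray.comp (Continuous.prodMk continuous_const continuous_id)

lemma continuous_comp_ray {f : Pt → ℝ} (hf : ContinuousOn f dense) {s : ℝ} (hs : 0 < s) :
    Continuous fun q : S3 => f (ray s q) :=
  hf.comp_continuous (continuous_ray_right s) fun q => ray_mem hs q

lemma integrable_sph {f : S3 → ℝ} (hf : Continuous f) : Integrable f sph := by
  have := hf.continuousOn.integrableOn_compact (μ := sph) isCompact_univ
  rwa [integrableOn_univ] at this

lemma integrable_mom {f P : Pt → ℝ} (hf : ContinuousOn f dense) (hP : Continuous P) {s : ℝ}
    (hs : 0 < s) : Integrable (fun q => f (ray s q) * P (ray 1 q)) sph :=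
  integrable_sph ((continuous_comp_ray hf hs).mul (hP.comp (continuous_ray_right 1)))

lemma mom_add {f g P : Pt → ℝ} (hf : ContinuousOn f dense) (hg : ContinuousOn g dense)
    (hP : Continuous P) {s : ℝ} (hs : 0 < s) :
    mom (fun x => f x + g x) P s = mom f P s + mom g P s := by
  unfold mom
  rw [← integral_add (integrable_mom hf hP hs) (integrable_mom hg hP hs)]
  simp only [add_mul]

lemma mom_sum {ι : Type*} (t : Finset ι) {f : ι → Pt → ℝ} {P : Pt → ℝ}
    (hf : ∀ i, ContinuousOn (f i) dense) (hP : Continuous P) {s : ℝ} (hs : 0 < s) :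
    mom (fun x => ∑ i ∈ t, f i x) P s = ∑ i ∈ t, mom (f i) P s := by
  unfold mom
  rw [← integral_finsetSum _ fun i _ => integrable_mom (hf i) hP hs]
  simp only [Finset.sum_mul]

lemma mom_sum_right {ι : Type*} (t : Finset ι) {f : Pt → ℝ} {P : ι → Pt → ℝ} (c : ι → ℝ)
    (hf : ContinuousOn f dense) (hP : ∀ i, Continuous (P i)) {s : ℝ} (hs : 0 < s) :
    mom f (fun x => ∑ i ∈ t, c i * P i x) s = ∑ i ∈ t, c i * mom f (P i) s := by
  unfold mom
  simp only [← integral_const_mul]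
  rw [← integral_finsetSum _ fun i _ => (integrable_mom hf (hP i) hs).const_mul (c i)]
  congr 1
  ext q
  rw [Finset.mul_sum]
  exact Finset.sum_congr rfl fun i _ => by ring

lemma mom_congr {f g P : Pt → ℝ} {s : ℝ} (h : ∀ q, f (ray s q) = g (ray s q)) :
    mom f P s = mom g P s := by
  unfold mom
  simp only [h]

lemma mom_const_mul (c : ℝ) (f P : Pt → ℝ) (s : ℝ) :
    mom (fun x => c * f x) P s = c * mom f P s := by
  unfold mom
  rw [← integral_const_mul]
  simp only [mul_assoc]

lemma hasDerivAt_mom {f P : Pt → ℝ} (hf : ContDiffOn ℝ 1 f dense) (hP : Continuous P) {s : ℝ}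
    (hs : 0 < s) : HasDerivAt (mom f P) (mom (radD f) P s) s := by
  -- The interval [s/2, 3s/2] keeps away from the origin, so compactness provides a constant that
  -- dominates the derivative of the integrand.
  have hc : ContinuousOn (fun p : ℝ × S3 => radD f (ray p.1 p.2) * P (ray 1 p.2))
      (Set.Icc (s / 2) (3 * s / 2) ×ˢ Set.univ) := by
    refine ContinuousOn.mul ((continuousOn_comp_ray (continuousOn_radD hf)).mono ?_) ?_
    · rintro ⟨t, q⟩ ⟨ht, _⟩
      exact ⟨lt_of_lt_of_le (by positivity) ht.1, trivial⟩
    · exact (hP.comp ((continuous_ray_right 1).comp continuous_snd)).continuousOn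
  obtain ⟨C, hC⟩ := (isCompact_Icc.prod isCompact_univ).exists_bound_of_continuousOn hc
  refine (hasDerivAt_integral_of_dominated_loc_of_deriv_le (μ := sph) (bound := fun _ => C)
    (F := fun t q => f (ray t q) * P (ray 1 q))
    (F' := fun t q => radD f (ray t q) * P (ray 1 q))
    (Icc_mem_nhds (a := s / 2) (b := 3 * s / 2) (by linarith) (by linarith)) ?_
    (integrable_mom hf.continuousOn hP hs)
    (integrable_mom (continuousOn_radD hf) hP hs).aestronglyMeasurable ?_
    (integrable_const C) ?_).2
  · filter_upwards [lt_mem_nhds hs] with t ht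
    exact (integrable_mom hf.continuousOn hP ht).aestronglyMeasurable
  · exact Filter.Eventually.of_forall fun q t ht => hC (t, q) ⟨ht, trivial⟩
  · refine Filter.Eventually.of_forall fun q t ht => ?_
    exact (hasDerivAt_ray hf (lt_of_lt_of_le (by positivity) ht.1) q).mul_const _

/-- The rotation of angle `t` in the direction of `w_i`. -/
def flow (i : Fin 4) (t : ℝ) (x : Pt) : Pt := fun k => Real.cos t * x k +
  Real.sin t * Instanton.wMat x i k

lemma normSq_flow {i : Fin 4} (hi : i ≠ 0) (t : ℝ) (x : Pt) : normSq (flow i t x) = normSq x := by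
  have h := Real.sin_sq_add_cos_sq t
  have h1 : normSq (flow i t x) = (Real.sin t ^ 2 + Real.cos t ^ 2) * normSq x := by
    fin_cases i
    · exact absurd rfl hi
    all_goals
      simp [normSq, flow, Instanton.wMat, w1, w2, w3, Fin.sum_univ_four,
        -Real.sin_sq_add_cos_sq]
      ring
  rw [h1, h, one_mul]

lemma exists_isometry_flow {i : Fin 4} (hi : i ≠ 0) (t : ℝ) :
    ∃ L : E4 ≃ₗᵢ[ℝ] E4, ∀ x : E4, (L x : Pt) = flow i t x := by
  let T : E4 →ₗ[ℝ] E4 :=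
    { toFun := fun x => WithLp.toLp 2 (flow i t x)
      map_add' := fun x y => by
        ext k
        have := (Instanton.wLin i k).map_add x y
        change Instanton.wMat ((x : Pt) + y) i k = Instanton.wMat x i k + Instanton.wMat y i k
          at this
        simp [flow, this]
        ring
      map_smul' := fun c x => by
        ext k
        have := (Instanton.wLin i k).map_smul c x
        change Instanton.wMat (c • (x : Pt)) i k = c * Instanton.wMat x i k at this
        simp [flow, this]
        ring }
  have hT : ∀ x, ‖T x‖ = ‖x‖ := fun x => by
    have h := normSq_flow hi t x
    rw [EuclideanSpace.norm_eq, EuclideanSpace.norm_eq]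
    congr 1
    simpa [normSq, T] using h
  let L0 : E4 →ₗᵢ[ℝ] E4 := ⟨T, hT⟩
  exact ⟨L0.toLinearIsometryEquiv rfl, fun x => rfl⟩

lemma hasDerivAt_flow {i : Fin 4} (hi : i ≠ 0) (t : ℝ) (x : Pt) :
    HasDerivAt (fun t => flow i t x) (fun k => Instanton.wMat (flow i t x) i k) t := by
  refine hasDerivAt_pi.2 fun k => ?_
  have h := ((Real.hasDerivAt_cos t).mul_const (x k)).add
    ((Real.hasDerivAt_sin t).mul_const (Instanton.wMat x i k))
  refine h.congr_deriv ?_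
  fin_cases i
  · exact absurd rfl hi
  all_goals
    fin_cases k <;> simp [flow, Instanton.wMat, w1, w2, w3] <;> ring

/-- The flow of w_i consists of isometries of the sphere, so the integral of g along the flow is
constant in time. Its derivative at time zero is twice the integral in question, as `xD`
differentiates along w_i / 2. -/
lemma integral_xD_eq_zero {g : Pt → ℝ} (hg : ContDiffOn ℝ 1 g dense) {i : Fin 4} (hi : i ≠ 0) :
    ∫ q, xD i g (ray 1 q) ∂sph = 0 := by
  choose L hL using exists_isometry_flow hi
  have hrot : ∀ t q, ray 1 (rotS (L t) q) = flow i t (ray 1 q) := fun t q => by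
    have h1 : ∀ q : S3, ray 1 q = (q.1 : Pt) := fun q => by
      funext k
      simp [ray]
    rw [h1, h1]
    exact hL t q.1
  have hmem : ∀ t (q : S3), flow i t (ray 1 q) ∈ dense := fun t q => by
    rw [← hrot]
    exact ray_mem one_pos _
  have hcx := continuous_comp_ray (continuousOn_xD hg i) one_pos
  obtain ⟨C, hC⟩ := isCompact_univ.exists_bound_of_continuousOn hcx.continuousOn
  have hcg := continuous_comp_ray hg.continuousOn one_pos
  have hcr : ∀ t, Continuous (rotS (L t)) := fun t =>
    Continuous.subtype_mk ((L t).continuous.comp continuous_subtype_val) _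
  have hint : ∀ t, Continuous fun q => g (flow i t (ray 1 q)) := fun t => by
    simp only [← hrot]
    exact hcg.comp (hcr t)
  have hint' : ∀ t, Continuous fun q => 2 * xD i g (flow i t (ray 1 q)) := fun t => by
    simp only [← hrot]
    exact continuous_const.mul (hcx.comp (hcr t))
  have hd := (hasDerivAt_integral_of_dominated_loc_of_deriv_le (μ := sph)
    (bound := fun _ => 2 * C) (F := fun t q => g (flow i t (ray 1 q)))
    (F' := fun t q => 2 * xD i g (flow i t (ray 1 q))) (x₀ := 0)
    Filter.univ_mem (Filter.Eventually.of_forall fun t =>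
      (integrable_sph (hint t)).aestronglyMeasurable) (integrable_sph (hint 0))
    (integrable_sph (hint' 0)).aestronglyMeasurable
    (Filter.Eventually.of_forall fun q t _ => by
      rw [← hrot, norm_mul, Real.norm_two]
      exact mul_le_mul_of_nonneg_left (hC _ trivial) zero_le_two)
    (integrable_const _)
    (Filter.Eventually.of_forall fun q t _ => by
      have h1 := (differentiableAt_of_contDiffOn (by simp) hg (hmem t q)).hasFDerivAt
      have h2 := h1.comp_hasDerivAt t (hasDerivAt_flow hi t (ray 1 q))
      refine h2.congr_deriv ?_
      rw [fderiv_eq_sum_pd, xD, Finset.mul_sum]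
      exact Finset.sum_congr rfl fun k _ => by ring)).2
  have hconst : (fun t => ∫ q, g (flow i t (ray 1 q)) ∂sph) = fun _ => ∫ q, g (ray 1 q) ∂sph := by
    funext t
    simp only [← hrot]
    have hm := measurePreserving_rotS (L t)
    have h1 := integral_map (μ := sph) hm.measurable.aemeasurable
      (f := fun q => g (ray 1 q)) hcg.aestronglyMeasurable
    rw [hm.map_eq] at h1
    exact h1.symm
  rw [hconst] at hd
  have h0 := hd.unique (hasDerivAt_const _ _)
  have h00 : ∀ q, flow i 0 (ray 1 q) = ray 1 q := fun q => by
    funext k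
    simp [flow]
  simp only [h00, integral_const_mul] at h0
  linarith

/-- Integration by parts on spheres. -/
lemma mom_xD {f P : Pt → ℝ} (hf : ContDiffOn ℝ 1 f dense) (hP : ContDiff ℝ 1 P) {i : Fin 4}
    (hi : i ≠ 0) {s : ℝ} (hs : 0 < s) : mom (xD i f) P s = -mom f (xD i P) s := by
  have hss : 0 < √s := Real.sqrt_pos.2 hs
  have hmap : Set.MapsTo (fun x : Pt => √s • x) dense dense := fun x hx h => by
    exact hx ((smul_eq_zero.1 h).resolve_left hss.ne')
  -- A dilation carries f to the unit sphere, where P is evaluated. It commutes with `xD` because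
  -- w_i is linear.
  have hg1 : ContDiffOn ℝ 1 (fun x : Pt => f (√s • x)) dense :=
    hf.comp (contDiff_const_smul _).contDiffOn hmap
  have h := integral_xD_eq_zero (hg1.mul hP.contDiffOn) hi
  have hray : ∀ q : S3, ray s q = √s • ray 1 q := fun q => by
    funext k
    simp [ray]
  have h1 : ∀ q, xD i (fun x => f (√s • x) * P x) (ray 1 q) =
      xD i f (ray s q) * P (ray 1 q) + f (ray s q) * xD i P (ray 1 q) := fun q => by
    have d1 := differentiableAt_of_contDiffOn (by simp) hg1 (ray_mem one_pos q)
    have d2 : DifferentiableAt ℝ P (ray 1 q) := hP.differentiable (by simp) _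
    have d3 : DifferentiableAt ℝ f (√s • ray 1 q) :=
      differentiableAt_of_contDiffOn (by simp) hf (hmap (ray_mem one_pos q))
    have h2 : ∀ k, pd k (fun x : Pt => f (√s • x)) (ray 1 q) = √s * pd k f (ray s q) := fun k => by
      have h3 := d3.hasFDerivAt.comp (ray 1 q)
        ((hasFDerivAt_id (𝕜 := ℝ) (ray 1 q)).const_smul (√s))
      have h4 := Instanton.hasFDerivAt_pd h3 k
      rw [hray]
      refine h4.trans ?_
      simp [pd]
    have h5 : ∀ k, Instanton.wMat (ray s q) i k = √s * Instanton.wMat (ray 1 q) i k := fun k => by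
      rw [hray]
      exact (Instanton.wLin i k).map_smul (√s) (ray 1 q)
    unfold xD
    simp only [pd_mul d1 d2, h2, h5, Finset.sum_mul, Finset.mul_sum]
    rw [← Finset.sum_add_distrib, ← hray]
    exact Finset.sum_congr rfl fun k _ => by ring
  have h6 : ContinuousOn (fun x => xD i P x) dense := continuousOn_xD hP.contDiffOn i
  have h7 : Integrable (fun q => f (ray s q) * xD i P (ray 1 q)) sph :=
    integrable_sph ((continuous_comp_ray hf.continuousOn hs).mul (continuous_comp_ray h6 one_pos))
  simp only [h1] at h
  rw [integral_add (integrable_mom (continuousOn_xD hf i) hP.continuous hs) h7] at h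
  unfold mom
  linarith

end AdSTaubNUT

end

/-! ### Moments against monomials determine a function on the sphere -/

noncomputable section

namespace AdSTaubNUT

open Matrix

/-- Monomials, given as words in the coordinates. -/
def word {k : ℕ} (α : Fin k → Fin 4) (x : Pt) : ℝ := ∏ m, x (α m)

lemma contDiff_word {k : ℕ} (α : Fin k → Fin 4) : ContDiff ℝ ⊤ (word α) := by
  unfold word
  exact contDiff_prod fun m _ => contDiff_apply ℝ ℝ (α m)

lemma abs_word_le {k : ℕ} (α : Fin k → Fin 4) (q : S3) : |word α (ray 1 q)| ≤ 1 := by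
  rw [word, Finset.abs_prod]
  refine Finset.prod_le_one (fun m _ => abs_nonneg _) fun m _ => ?_
  have h := sum_sq_sphere q
  have h1 : q.1 (α m) ^ 2 ≤ 1 := by
    refine le_trans ?_ h.le
    exact Finset.single_le_sum (f := fun i => q.1 i ^ 2) (fun i _ => sq_nonneg _)
      (Finset.mem_univ _)
  simpa [ray] using (sq_le_one_iff_abs_le_one _).1 h1

lemma pd_word {k : ℕ} (α : Fin k → Fin 4) (x v : Pt) :
    ∑ l, v l * pd l (word α) x = ∑ m, v (α m) * ∏ n ∈ Finset.univ.erase m, x (α n) := by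
  have h : HasFDerivAt (word α) (∑ m, (∏ n ∈ Finset.univ.erase m, x (α n)) •
      ContinuousLinearMap.proj (R := ℝ) (φ := fun _ : Fin 4 => ℝ) (α m)) x := by
    unfold word
    exact HasFDerivAt.finsetProd fun m _ =>
      (ContinuousLinearMap.proj (R := ℝ) (φ := fun _ : Fin 4 => ℝ) (α m)).hasFDerivAt
  rw [← fderiv_eq_sum_pd, h.fderiv]
  simp [mul_comm]

/-- A derivation along a linear vector field replaces one letter at a time by a combination of
letters. So words of a fixed length span a finite-dimensional invariant space, and the equations for
the moments of that length close. -/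
lemma exists_xD_word (k : ℕ) (i : Fin 4) :
    ∃ L : (Fin k → Fin 4) → (Fin k → Fin 4) → ℝ,
      ∀ α x, xD i (word α) x = ∑ β, L α β * word β x := by
  classical
  refine ⟨fun α β => ∑ m, ∑ j, if β = Function.update α m j then
    Instanton.wMat (Pi.single j 1) i (α m) / 2 else 0, fun α x => ?_⟩
  have h1 : ∀ m j, word (Function.update α m j) x =
      x j * ∏ n ∈ Finset.univ.erase m, x (α n) := fun m j => by
    rw [word, ← Finset.mul_prod_erase _ _ (Finset.mem_univ m), Function.update_self]
    congr 1
    refine Finset.prod_congr rfl fun n hn => ?_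
    rw [Function.update_of_ne (Finset.ne_of_mem_erase hn)]
  have h2 : ∀ l, Instanton.wMat x i l = ∑ j, x j * Instanton.wMat (Pi.single j 1) i l := fun l => by
    rw [← Instanton.sum_wMat_pd x x i l]
    exact Finset.sum_congr rfl fun j _ => by rw [Instanton.pd_wMat]
  have h3 : xD i (word α) x =
      ∑ m, Instanton.wMat x i (α m) / 2 * ∏ n ∈ Finset.univ.erase m, x (α n) :=
    pd_word α x fun l => Instanton.wMat x i l / 2
  simp only [Finset.sum_mul, ite_mul, zero_mul]
  rw [h3, Finset.sum_comm]
  refine Finset.sum_congr rfl fun m _ => ?_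
  rw [Finset.sum_comm]
  simp only [Finset.sum_ite_eq', Finset.mem_univ, if_true, h1]
  rw [h2, Finset.sum_div, Finset.sum_mul]
  exact Finset.sum_congr rfl fun j _ => by ring

/-- The coordinate functions on the sphere. -/
def coordS (i : Fin 4) : C(S3, ℝ) :=
  ⟨fun q => ray 1 q i, (continuous_apply i).comp (continuous_ray_right 1)⟩

/-- Stone-Weierstrass: products of coordinates are words, and the algebra they span separates
points, so it is dense in the continuous functions. Hence f is orthogonal to every continuous
function, in particular to itself. -/
lemma eq_zero_of_moments {f : S3 → ℝ} (hf : Continuous f)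
    (h : ∀ (k : ℕ) (α : Fin k → Fin 4), ∫ q, f q * word α (ray 1 q) ∂sph = 0) (q : S3) :
    f q = 0 := by
  let φ : C(S3, ℝ) →L[ℝ] ℝ := LinearMap.mkContinuous
    { toFun := fun g => ∫ q, f q * g q ∂sph
      map_add' := fun g k => by
        simp only [ContinuousMap.add_apply, mul_add]
        exact integral_add (integrable_sph (hf.mul g.continuous))
          (integrable_sph (hf.mul k.continuous))
      map_smul' := fun c g => by
        simp only [ContinuousMap.smul_apply, smul_eq_mul, RingHom.id_apply, ← integral_const_mul]
        congr 1
        ext q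
        ring } (∫ q, |f q| ∂sph) (fun g => by
      simp only [LinearMap.coe_mk, AddHom.coe_mk]
      refine (norm_integral_le_integral_norm _).trans ?_
      rw [← integral_mul_const]
      refine integral_mono (integrable_sph (hf.mul g.continuous).norm)
        ((integrable_sph hf.abs).mul_const _) fun q => ?_
      rw [norm_mul]
      exact mul_le_mul_of_nonneg_left (g.norm_coe_le_norm q) (abs_nonneg _))
  have hφ : ∀ g, φ g = ∫ q, f q * g q ∂sph := fun g => rfl
  let S : Subalgebra ℝ C(S3, ℝ) := Algebra.adjoin ℝ (Set.range coordS)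
  have hsep : S.SeparatesPoints := by
    intro a b hab
    have : ∃ i, a.1 i ≠ b.1 i := by
      by_contra hc
      push Not at hc
      exact hab (Subtype.ext (by ext i; exact hc i))
    obtain ⟨i, hi⟩ := this
    refine ⟨coordS i, ⟨coordS i, Algebra.subset_adjoin ⟨i, rfl⟩, rfl⟩, ?_⟩
    simpa [coordS, ray] using hi
  have htop := ContinuousMap.subalgebra_topologicalClosure_eq_top_of_separatesPoints S hsep
  have hS : ∀ g ∈ S, φ g = 0 := by
    intro g hg
    have hg' : g ∈ Submodule.span ℝ (Submonoid.closure (Set.range coordS) : Set C(S3, ℝ)) := by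
      rw [← Algebra.adjoin_eq_span]
      exact hg
    clear hg
    induction hg' using Submodule.span_induction with
    | mem x hx =>
      obtain ⟨l, hl, rfl⟩ := Submonoid.exists_list_of_mem_closure hx
      have h1 : ∀ l : List C(S3, ℝ), (∀ y ∈ l, y ∈ Set.range coordS) →
          ∃ (k : ℕ) (α : Fin k → Fin 4), ∀ q, l.prod q = word α (ray 1 q) := by
        intro l
        induction l with
        | nil => exact fun _ => ⟨0, Fin.elim0, fun q => by simp [word]⟩
        | cons y l ih =>
          intro hy
          obtain ⟨k, α, hα⟩ := ih fun z hz => hy z (List.mem_cons_of_mem _ hz)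
          obtain ⟨i, rfl⟩ := hy y List.mem_cons_self
          refine ⟨k + 1, Fin.cons i α, fun q => ?_⟩
          rw [List.prod_cons, ContinuousMap.mul_apply, hα, word, word, Fin.prod_univ_succ]
          simp [coordS]
      obtain ⟨k, α, hα⟩ := h1 l hl
      rw [hφ]
      simp only [hα]
      exact h k α
    | zero => exact map_zero φ
    | add x y _ _ hx hy => rw [map_add, hx, hy, add_zero]
    | smul a x _ hx => rw [map_smul, hx, smul_zero]
  have hall : ∀ g, φ g = 0 := by
    intro g
    have hg : g ∈ S.topologicalClosure := by
      rw [htop]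
      trivial
    have hcl : IsClosed {g | φ g = 0} := isClosed_eq φ.continuous continuous_const
    exact closure_minimal (fun g hg => hS g hg) hcl hg
  have h2 : ∫ q, f q * f q ∂sph = 0 := hall ⟨f, hf⟩
  rw [integral_eq_zero_iff_of_nonneg (fun q => mul_self_nonneg (f q))
    (integrable_sph (hf.mul hf))] at h2
  have h3 := (hf.mul hf).ae_eq_iff_eq sph continuous_zero |>.1 h2
  exact mul_self_eq_zero.1 (congrFun h3 q)

/-- Cauchy-Schwarz together with the bound 1 for words on the unit sphere; it passes
square-integrability from the tensor to its moments. The inequality is read off from the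
non-negative quadratic polynomial in c at its minimum. -/
lemma sq_mom_le {f : Pt → ℝ} (hf : ContinuousOn f dense) {k : ℕ} (α : Fin k → Fin 4) {s : ℝ}
    (hs : 0 < s) : mom f (word α) s ^ 2 ≤ sph.real Set.univ * ∫ q, f (ray s q) ^ 2 ∂sph := by
  have hc := continuous_comp_ray hf hs
  have hw : Continuous fun q => word α (ray 1 q) :=
    (contDiff_word α).continuous.comp (continuous_ray_right 1)
  set M := mom f (word α) s
  set V := sph.real Set.univ
  have h1 : ∫ q, (f (ray s q) * word α (ray 1 q)) ^ 2 ∂sph ≤ ∫ q, f (ray s q) ^ 2 ∂sph := by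
    refine integral_mono (integrable_sph ((hc.mul hw).pow 2)) (integrable_sph (hc.pow 2))
      fun q => ?_
    simp only [mul_pow]
    have := (sq_le_one_iff_abs_le_one _).2 (abs_word_le α q)
    nlinarith [sq_nonneg (f (ray s q))]
  have h2 : ∀ c : ℝ, 0 ≤ ∫ q, (f (ray s q) * word α (ray 1 q)) ^ 2 ∂sph - 2 * c * M + c ^ 2 * V :=
    fun c => by
    have h3 : ∫ q, (f (ray s q) * word α (ray 1 q) - c) ^ 2 ∂sph =
        ∫ q, (f (ray s q) * word α (ray 1 q)) ^ 2 ∂sph - 2 * c * M + c ^ 2 * V := by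
      have h4 : ∀ q, (f (ray s q) * word α (ray 1 q) - c) ^ 2 =
          (f (ray s q) * word α (ray 1 q)) ^ 2 - 2 * c * (f (ray s q) * word α (ray 1 q)) +
            c ^ 2 := fun q => by ring
      simp only [h4]
      rw [integral_add, integral_sub, integral_const_mul, integral_const, smul_eq_mul, mul_comm V]
      · rfl
      · exact integrable_sph ((hc.mul hw).pow 2)
      · exact (integrable_sph (hc.mul hw)).const_mul _
      · exact (integrable_sph ((hc.mul hw).pow 2)).sub ((integrable_sph (hc.mul hw)).const_mul _)
      · exact integrable_const _
    rw [← h3]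
    exact integral_nonneg fun q => sq_nonneg _
  have hV : 0 ≤ V := measureReal_nonneg
  rcases hV.eq_or_lt with h0 | h0
  · have h5 : M = 0 := by
      have : (sph : Measure S3) = 0 := by
        have h6 : sph.real Set.univ = 0 := h0.symm
        rw [measureReal_eq_zero_iff] at h6
        exact Measure.measure_univ_eq_zero.1 h6
      simp [M, mom, this]
    rw [h5, ← h0]
    simp
  · have h6 := h2 (M / V)
    have h7 : 2 * (M / V) * M - (M / V) ^ 2 * V = M ^ 2 / V := by
      field_simp
      ring
    have h8 : M ^ 2 / V ≤ ∫ q, f (ray s q) ^ 2 ∂sph := by linarith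
    rw [div_le_iff₀ h0] at h8
    linarith

end AdSTaubNUT

end

noncomputable section

namespace AdSTaubNUT

/-! ### Square-integrable solutions of asymptotically oscillating systems -/

/-- If `|E'| ≤ C E / r²` with `E ≥ 0`, then `E` is comparable to any of its values. -/
lemma energy_comparable {E E' : ℝ → ℝ} {C R0 : ℝ} (hR : 0 < R0)
    (hd : ∀ r, R0 ≤ r → HasDerivAt E (E' r) r) (hb : ∀ r, R0 ≤ r → |E' r| ≤ C / r ^ 2 * E r)
    (h0 : ∀ r, R0 ≤ r → 0 ≤ E r) (hC : 0 ≤ C) {r : ℝ} (hr : R0 ≤ r) :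
    E R0 * Real.exp (-(C / R0)) ≤ E r ∧ E r ≤ E R0 * Real.exp (C / R0) := by
  -- Integrating factors: exp(c/r) has logarithmic derivative -c/r². With c = -C the product with E
  -- is increasing and with c = C it is decreasing.
  have hinv : ∀ x, R0 ≤ x → ∀ c : ℝ, HasDerivAt (fun t => Real.exp (c / t))
      (Real.exp (c / x) * (-(c / x ^ 2))) x := fun x hx c => by
    have hx0 : x ≠ 0 := (lt_of_lt_of_le hR hx).ne'
    have h1 : HasDerivAt (fun t => c / t) (-(c / x ^ 2)) x := by
      have := (hasDerivAt_inv hx0).const_mul c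
      simpa [div_eq_mul_inv] using this
    exact h1.exp
  have hprod : ∀ x, R0 ≤ x → ∀ c : ℝ, HasDerivAt (fun t => E t * Real.exp (c / t))
      (Real.exp (c / x) * (E' x - c / x ^ 2 * E x)) x := fun x hx c => by
    refine ((hd x hx).mul (hinv x hx c)).congr_deriv ?_
    ring
  have hr0 : 0 < r := lt_of_lt_of_le hR hr
  have hcont : ∀ c, ContinuousOn (fun t => E t * Real.exp (c / t)) (Set.Ici R0) := fun c x hx =>
    (hprod x hx c).continuousAt.continuousWithinAt
  constructor
  · have hm : MonotoneOn (fun t => E t * Real.exp (-C / t)) (Set.Ici R0) := by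
      refine monotoneOn_of_deriv_nonneg (convex_Ici R0) (hcont _) ?_ ?_
      · intro x hx
        rw [interior_Ici] at hx
        exact (hprod x hx.le _).differentiableAt.differentiableWithinAt
      · intro x hx
        rw [interior_Ici] at hx
        rw [(hprod x hx.le _).deriv]
        have h1 := hb x hx.le
        have h2 := neg_abs_le (E' x)
        refine mul_nonneg (Real.exp_pos _).le ?_
        rw [neg_div]
        linarith
    have h1 := hm Set.self_mem_Ici hr hr
    simp only at h1
    have h2 : Real.exp (-C / r) ≤ 1 := by
      rw [Real.exp_le_one_iff, neg_div]
      exact neg_nonpos.2 (by positivity)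
    have h3 := h0 r hr
    simp only [neg_div] at h1 h2
    nlinarith
  · have hm : AntitoneOn (fun t => E t * Real.exp (C / t)) (Set.Ici R0) := by
      refine antitoneOn_of_deriv_nonpos (convex_Ici R0) (hcont _) ?_ ?_
      · intro x hx
        rw [interior_Ici] at hx
        exact (hprod x hx.le _).differentiableAt.differentiableWithinAt
      · intro x hx
        rw [interior_Ici] at hx
        rw [(hprod x hx.le _).deriv]
        have h1 := hb x hx.le
        have h2 := le_abs_self (E' x)
        refine mul_nonpos_of_nonneg_of_nonpos (Real.exp_pos _).le ?_
        linarith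
    have h1 := hm Set.self_mem_Ici hr hr
    simp only at h1
    have h2 : 1 ≤ Real.exp (C / r) := Real.one_le_exp (by positivity)
    have h3 := h0 r hr
    nlinarith

/-- The virial argument: a bounded function whose derivative is bounded below by a multiple of
`1 / r` up to integrable terms does not exist. -/
lemma virial_contradiction {F F' g : ℝ → ℝ} {c C K R0 : ℝ} (hR : 0 < R0) (hc : 0 < c)
    (hd : ∀ r, R0 ≤ r → HasDerivAt F (F' r) r)
    (hF' : ∀ r, R0 ≤ r → c / r - K * g r - C / r ^ 2 ≤ F' r)
    (hb : ∃ M, ∀ r, R0 ≤ r → |F r| ≤ M) (hK : 0 ≤ K) (hC : 0 ≤ C)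
    (hg : ∀ r, R0 ≤ r → 0 ≤ g r) (hgc : ∀ r, R0 ≤ r → ContinuousAt g r)
    (hgi : IntegrableOn g (Set.Ioi R0)) : False := by
  obtain ⟨M, hM⟩ := hb
  set Φ : ℝ → ℝ := fun r => ∫ t in R0..r, g t with hΦ
  have hii : ∀ r, R0 ≤ r → IntervalIntegrable g volume R0 r := fun r hr => by
    rw [intervalIntegrable_iff_integrableOn_Ioc_of_le hr]
    exact hgi.mono_set Set.Ioc_subset_Ioi_self
  have hΦd : ∀ r, R0 < r → HasDerivAt Φ (g r) r := fun r hr => by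
    refine intervalIntegral.integral_hasDerivAt_right (hii r hr.le) ?_ (hgc r hr.le)
    refine ContinuousOn.stronglyMeasurableAtFilter (s := Set.Ioi R0) isOpen_Ioi
      (fun x hx => (hgc x (le_of_lt hx)).continuousWithinAt) r hr
  have hΦb : ∀ r, R0 ≤ r → Φ r ≤ ∫ t in Set.Ioi R0, g t := fun r hr => by
    rw [hΦ]
    simp only
    rw [intervalIntegral.integral_of_le hr]
    refine setIntegral_mono_set hgi ?_ (Filter.Eventually.of_forall Set.Ioc_subset_Ioi_self)
    exact (ae_restrict_iff' measurableSet_Ioi).2 (Filter.Eventually.of_forall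
      fun x hx => hg x (le_of_lt hx))
  -- F minus an antiderivative of the lower bound for F'. It is increasing, while F, Φ and C/r are
  -- bounded above, so c log r would be bounded.
  set G : ℝ → ℝ := fun r => F r - c * Real.log r + K * Φ r - C * r⁻¹ with hG
  have hGd : ∀ r, R0 < r → HasDerivAt G (F' r - c * r⁻¹ + K * g r - C * (-(r ^ 2)⁻¹)) r :=
    fun r hr => by
    have hr0 : r ≠ 0 := (hR.trans hr).ne'
    exact (((hd r hr.le).sub ((Real.hasDerivAt_log hr0).const_mul c)).add
      ((hΦd r hr).const_mul K)).sub ((hasDerivAt_inv hr0).const_mul C)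
  have hmono : MonotoneOn G (Set.Ioi R0) := by
    refine monotoneOn_of_deriv_nonneg (convex_Ioi R0)
      (fun x hx => (hGd x hx).continuousAt.continuousWithinAt) ?_ ?_
    · intro x hx
      rw [interior_Ioi] at hx
      exact (hGd x hx).differentiableAt.differentiableWithinAt
    · intro x hx
      rw [interior_Ioi] at hx
      rw [(hGd x hx).deriv]
      have := hF' x (le_of_lt hx)
      rw [div_eq_mul_inv, div_eq_mul_inv] at this
      linarith
  have hR1 : R0 < R0 + 1 := by linarith
  have hlim : ∀ r, R0 + 1 ≤ r → c * Real.log r ≤ M + K * (∫ t in Set.Ioi R0, g t) - G (R0 + 1) :=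
    fun r hr => by
    have h1 := hmono (Set.mem_Ioi.2 hR1) (Set.mem_Ioi.2 (hR1.trans_le hr)) hr
    have h2 : G r = F r - c * Real.log r + K * Φ r - C * r⁻¹ := rfl
    have h3 := (abs_le.1 (hM r (by linarith))).2
    have h4 := mul_le_mul_of_nonneg_left (hΦb r (by linarith)) hK
    have h5 : 0 ≤ C * r⁻¹ := mul_nonneg hC (inv_nonneg.2 (by linarith))
    linarith
  have htend := (Real.tendsto_log_atTop.const_mul_atTop hc).eventually_gt_atTop
    (M + K * (∫ t in Set.Ioi R0, g t) - G (R0 + 1))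
  obtain ⟨r, h1, h2⟩ := (htend.and (Filter.eventually_ge_atTop (R0 + 1))).exists
  exact absurd (hlim r h2) (not_le.2 h1)

/-- A square-integrable solution of a system that is asymptotic to the oscillating system
`(a ∂_r)² w + 3 κ a ∂_r w + λ w = 0`, where `a ∼ κ r`, vanishes. -/
lemma eq_zero_of_oscillating {J : Type*} [Fintype J] {w w1 w2 : J → ℝ → ℝ} {a : ℝ → ℝ}
    {κ lam C R0 : ℝ} (hκ : 0 < κ) (hlam : 9 / 4 * κ ^ 2 < lam) (hR : 0 < R0) (hC : 0 ≤ C)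
    (ha0 : ∀ r, R0 ≤ r → κ / 2 * r ≤ a r) (ha2 : ∀ r, R0 ≤ r → a r ≤ 2 * κ * r)
    (ha1 : ∀ r, R0 ≤ r → |a r - κ * r| ≤ C)
    (dw : ∀ j r, R0 ≤ r → HasDerivAt (w j) (w1 j r / a r) r)
    (dw1 : ∀ j r, R0 ≤ r → HasDerivAt (w1 j) (w2 j r / a r) r)
    (he : ∀ j r, R0 ≤ r → |w2 j r + 3 * κ * w1 j r + lam * w j r| ≤
      C / r * ∑ i, (|w i r| + |w1 i r|))
    (hL : ∀ j, IntegrableOn (fun r => r ^ 2 * w j r ^ 2) (Set.Ioi R0)) :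
    ∀ j, w j R0 = 0 ∧ w1 j R0 = 0 := by
  set μ := √(lam - 9 / 4 * κ ^ 2) with hμ
  have hμ0 : 0 < μ := Real.sqrt_pos.2 (by linarith)
  have hμ2 : μ ^ 2 = lam - 9 / 4 * κ ^ 2 := Real.sq_sqrt (by linarith)
  -- Completing the square: a∂_r w = p - (3/2)κw and a∂_r p = -(3/2)κp - μ²w + e, where e is the
  -- error term. Up to e, the pair (p, μw) rotates with frequency μ and decays at rate (3/2)κ, and S
  -- is its squared amplitude.
  let p : J → ℝ → ℝ := fun j r => w1 j r + 3 / 2 * κ * w j r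
  let e : J → ℝ → ℝ := fun j r => w2 j r + 3 * κ * w1 j r + lam * w j r
  let S : ℝ → ℝ := fun r => ∑ j, (p j r ^ 2 + μ ^ 2 * w j r ^ 2)
  have hS0 : ∀ r, 0 ≤ S r := fun r => Finset.sum_nonneg fun j _ => by positivity
  set n : ℝ := (Fintype.card J : ℝ) with hn
  have hn0 : 0 ≤ n := Nat.cast_nonneg _
  -- This B bounds |w| + |w1| by B √S, from |w| ≤ √S / μ and |w1| ≤ |p| + (3/2)κ|w|.
  set B : ℝ := 1 + (1 + 3 / 2 * κ) / μ with hB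
  have hB0 : 0 ≤ B := by positivity
  have hterm : ∀ j r, p j r ^ 2 + μ ^ 2 * w j r ^ 2 ≤ S r := fun j r =>
    Finset.single_le_sum (f := fun j => p j r ^ 2 + μ ^ 2 * w j r ^ 2)
      (fun j _ => by positivity) (Finset.mem_univ j)
  have hpS : ∀ j r, |p j r| ≤ √(S r) := fun j r => by
    apply Real.abs_le_sqrt
    nlinarith [hterm j r, sq_nonneg (μ * w j r)]
  have hwS : ∀ j r, |w j r| ≤ √(S r) / μ := fun j r => by
    rw [le_div_iff₀ hμ0, ← abs_of_pos hμ0, ← abs_mul]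
    apply Real.abs_le_sqrt
    nlinarith [hterm j r, sq_nonneg (p j r)]
  have hNS : ∀ r, ∑ i, (|w i r| + |w1 i r|) ≤ n * (B * √(S r)) := fun r => by
    rw [hn, ← nsmul_eq_mul, ← Finset.card_univ]
    refine Finset.sum_le_card_nsmul _ _ _ fun i _ => ?_
    have h1 : |w1 i r| ≤ |p i r| + 3 / 2 * κ * |w i r| := by
      have : w1 i r = p i r - 3 / 2 * κ * w i r := by simp [p]
      rw [this]
      refine (abs_sub _ _).trans ?_
      rw [abs_mul, abs_of_pos (show (0 : ℝ) < 3 / 2 * κ by positivity)]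
    have h2 := hpS i r
    have h3 := hwS i r
    have h4 : B * √(S r) = √(S r) + (1 + 3 / 2 * κ) * (√(S r) / μ) := by
      rw [hB]
      ring
    rw [h4]
    nlinarith [mul_le_mul_of_nonneg_left h3 (show (0 : ℝ) ≤ 3 / 2 * κ by positivity)]
  have heS : ∀ j r, R0 ≤ r → |e j r| ≤ C * n * B / r * √(S r) := fun j r hr => by
    have hr0 := lt_of_lt_of_le hR hr
    refine (he j r hr).trans ?_
    have := mul_le_mul_of_nonneg_left (hNS r) (show 0 ≤ C / r by positivity)
    refine this.trans (le_of_eq ?_)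
    ring
  have hpe : ∀ r, R0 ≤ r → |∑ j, p j r * e j r| ≤ n * (C * n * B) / r * S r := fun r hr => by
    have hr0 := lt_of_lt_of_le hR hr
    have h1 : |∑ j, p j r * e j r| ≤ ∑ _j : J, √(S r) * (C * n * B / r * √(S r)) := by
      refine (Finset.abs_sum_le_sum_abs _ _).trans (Finset.sum_le_sum fun j _ => ?_)
      rw [abs_mul]
      exact mul_le_mul (hpS j r) (heS j r hr) (abs_nonneg _) (Real.sqrt_nonneg _)
    refine h1.trans (le_of_eq ?_)
    rw [Finset.sum_const, Finset.card_univ, nsmul_eq_mul, ← hn]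
    have : √(S r) * √(S r) = S r := Real.mul_self_sqrt (hS0 r)
    linear_combination (n * (C * n * B) / r) * this
  have hwe : ∀ r, R0 ≤ r → |∑ j, w j r * e j r| ≤ n * (C * n * B) / μ / r * S r := fun r hr => by
    have hr0 := lt_of_lt_of_le hR hr
    have h1 : |∑ j, w j r * e j r| ≤ ∑ _j : J, √(S r) / μ * (C * n * B / r * √(S r)) := by
      refine (Finset.abs_sum_le_sum_abs _ _).trans (Finset.sum_le_sum fun j _ => ?_)
      rw [abs_mul]
      exact mul_le_mul (hwS j r) (heS j r hr) (abs_nonneg _) (by positivity)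
    refine h1.trans (le_of_eq ?_)
    rw [Finset.sum_const, Finset.card_univ, nsmul_eq_mul, ← hn]
    have : √(S r) * √(S r) = S r := Real.mul_self_sqrt (hS0 r)
    linear_combination (n * (C * n * B) / μ / r) * this
  have hpw : ∀ r, |∑ j, p j r * w j r| ≤ n / μ * S r := fun r => by
    have h1 : |∑ j, p j r * w j r| ≤ ∑ _j : J, √(S r) * (√(S r) / μ) := by
      refine (Finset.abs_sum_le_sum_abs _ _).trans (Finset.sum_le_sum fun j _ => ?_)
      rw [abs_mul]
      exact mul_le_mul (hpS j r) (hwS j r) (abs_nonneg _) (Real.sqrt_nonneg _)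
    refine h1.trans (le_of_eq ?_)
    rw [Finset.sum_const, Finset.card_univ, nsmul_eq_mul, ← hn]
    have : √(S r) * √(S r) = S r := Real.mul_self_sqrt (hS0 r)
    linear_combination (n / μ) * this
  have dp : ∀ j r, R0 ≤ r → HasDerivAt (p j)
      ((-(3 / 2) * κ * p j r - μ ^ 2 * w j r + e j r) / a r) r := fun j r hr => by
    refine ((dw1 j r hr).add ((dw j r hr).const_mul (3 / 2 * κ))).congr_deriv ?_
    simp only [p, e, hμ2]
    ring
  have dw' : ∀ j r, R0 ≤ r → HasDerivAt (w j) ((p j r - 3 / 2 * κ * w j r) / a r) r :=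
    fun j r hr => by
    refine (dw j r hr).congr_deriv ?_
    simp [p]
  -- Since a∂_r S = -3κS + O(S/r) and a = κr + O(1), S decays like r⁻³, and the weight r³ leaves E'
  -- = O(E/r²).
  let E : ℝ → ℝ := fun r => r ^ 3 * S r
  let E' : ℝ → ℝ := fun r => (3 * r ^ 2 - 3 * κ * r ^ 3 / a r) * S r +
    2 * r ^ 3 / a r * ∑ j, p j r * e j r
  have hEd : ∀ r, R0 ≤ r → HasDerivAt E (E' r) r := fun r hr => by
    have h1 : HasDerivAt S (∑ j, (2 * p j r * ((-(3 / 2) * κ * p j r - μ ^ 2 * w j r + e j r) / a r) +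
        μ ^ 2 * (2 * w j r * ((p j r - 3 / 2 * κ * w j r) / a r)))) r := by
      refine HasDerivAt.fun_sum fun j _ => ?_
      refine (((dp j r hr).fun_pow 2).fun_add
        (((dw' j r hr).fun_pow 2).const_mul (μ ^ 2))).congr_deriv ?_
      push_cast
      ring
    have h4 : ∑ j, (2 * p j r * ((-(3 / 2) * κ * p j r - μ ^ 2 * w j r + e j r) / a r) +
        μ ^ 2 * (2 * w j r * ((p j r - 3 / 2 * κ * w j r) / a r))) =
        -(3 * κ / a r) * S r + 2 / a r * ∑ j, p j r * e j r := by
      simp only [S, Finset.mul_sum, ← Finset.sum_add_distrib]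
      exact Finset.sum_congr rfl fun j _ => by ring
    rw [h4] at h1
    have h5 := (hasDerivAt_pow 3 r).mul h1
    refine h5.congr_deriv ?_
    simp only [E']
    push_cast
    ring
  have hra : ∀ r, R0 ≤ r → |3 * r ^ 2 - 3 * κ * r ^ 3 / a r| ≤ 6 * C / κ * r := fun r hr => by
    have hr0 := lt_of_lt_of_le hR hr
    have h1 := ha0 r hr
    have ha : 0 < a r := lt_of_lt_of_le (by positivity) h1
    have h2 : 3 * r ^ 2 - 3 * κ * r ^ 3 / a r = 3 * r ^ 2 * (a r - κ * r) / a r := by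
      field_simp
    rw [h2, abs_div, abs_mul, abs_of_pos ha, abs_of_pos (show (0 : ℝ) < 3 * r ^ 2 by positivity),
      div_le_iff₀ ha]
    calc 3 * r ^ 2 * |a r - κ * r| ≤ 3 * r ^ 2 * C := by gcongr; exact ha1 r hr
      _ = 6 * C / κ * r * (κ / 2 * r) := by
        field_simp
        ring
      _ ≤ 6 * C / κ * r * a r := by gcongr
  have hr3a : ∀ r, R0 ≤ r → r ^ 3 / a r ≤ 2 / κ * r ^ 2 := fun r hr => by
    have hr0 := lt_of_lt_of_le hR hr
    have h1 := ha0 r hr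
    have ha : 0 < a r := lt_of_lt_of_le (by positivity) h1
    rw [div_le_iff₀ ha]
    calc r ^ 3 = 2 / κ * r ^ 2 * (κ / 2 * r) := by field_simp
      _ ≤ 2 / κ * r ^ 2 * a r := by gcongr
  have hr3a0 : ∀ r, R0 ≤ r → 0 ≤ r ^ 3 / a r := fun r hr => by
    have hr0 := lt_of_lt_of_le hR hr
    have ha : 0 < a r := lt_of_lt_of_le (by positivity) (ha0 r hr)
    positivity
  have hE0 : ∀ r, R0 ≤ r → 0 ≤ E r := fun r hr => by
    have hr0 := lt_of_lt_of_le hR hr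
    exact mul_nonneg (by positivity) (hS0 r)
  set C1 : ℝ := 6 * C / κ + 2 * (2 / κ) * (n * (C * n * B)) with hC1
  have hC10 : 0 ≤ C1 := by positivity
  have hE'b : ∀ r, R0 ≤ r → |E' r| ≤ C1 / r ^ 2 * E r := fun r hr => by
    have hr0 := lt_of_lt_of_le hR hr
    have h1 : |(3 * r ^ 2 - 3 * κ * r ^ 3 / a r) * S r| ≤ 6 * C / κ * r * S r := by
      rw [abs_mul, abs_of_nonneg (hS0 r)]
      exact mul_le_mul_of_nonneg_right (hra r hr) (hS0 r)
    have h2 : |2 * r ^ 3 / a r * ∑ j, p j r * e j r| ≤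
        2 * (2 / κ * r ^ 2) * (n * (C * n * B) / r * S r) := by
      rw [abs_mul, mul_div_assoc, abs_mul, abs_two, abs_of_nonneg (hr3a0 r hr)]
      exact mul_le_mul (mul_le_mul_of_nonneg_left (hr3a r hr) zero_le_two) (hpe r hr)
        (abs_nonneg _) (by positivity)
    refine (abs_add_le _ _).trans ((add_le_add h1 h2).trans (le_of_eq ?_))
    simp only [E, hC1]
    field_simp
  have hcomp := fun r (hr : R0 ≤ r) => energy_comparable hR hEd hE'b hE0 hC10 hr
  -- the energy vanishes
  have hEz : E R0 = 0 := by
    by_contra hne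
    have hpos : 0 < E R0 := lt_of_le_of_ne (hE0 R0 le_rfl) (Ne.symm hne)
    set Elow := E R0 * Real.exp (-(C1 / R0)) with hlow
    set Eup := E R0 * Real.exp (C1 / R0) with hup
    have hlow0 : 0 < Elow := mul_pos hpos (Real.exp_pos _)
    have hup0 : 0 < Eup := mul_pos hpos (Real.exp_pos _)
    -- The virial function. For one component a∂_r(pw) = p² - μ²w² - 3κpw + we, and p² - μ²w² is S
    -- minus 2μ²w². The S term contributes at least a multiple of 1/r to F', while the integral of
    -- r²w² is finite.
    let F : ℝ → ℝ := fun r => r ^ 3 * ∑ j, p j r * w j r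
    let F' : ℝ → ℝ := fun r => (3 * r ^ 2 - 3 * κ * r ^ 3 / a r) * ∑ j, p j r * w j r +
      r ^ 3 / a r * (S r - 2 * μ ^ 2 * ∑ j, w j r ^ 2 + ∑ j, w j r * e j r)
    have hFd : ∀ r, R0 ≤ r → HasDerivAt F (F' r) r := fun r hr => by
      have h1 : HasDerivAt (fun r => ∑ j, p j r * w j r)
          (∑ j, ((-(3 / 2) * κ * p j r - μ ^ 2 * w j r + e j r) / a r * w j r +
            p j r * ((p j r - 3 / 2 * κ * w j r) / a r))) r :=
        HasDerivAt.fun_sum fun j _ => (dp j r hr).mul (dw' j r hr)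
      have h4 : ∑ j, ((-(3 / 2) * κ * p j r - μ ^ 2 * w j r + e j r) / a r * w j r +
            p j r * ((p j r - 3 / 2 * κ * w j r) / a r)) =
          -(3 * κ / a r) * ∑ j, p j r * w j r +
            1 / a r * (S r - 2 * μ ^ 2 * ∑ j, w j r ^ 2 + ∑ j, w j r * e j r) := by
        simp only [S, Finset.mul_sum, ← Finset.sum_add_distrib, ← Finset.sum_sub_distrib]
        exact Finset.sum_congr rfl fun j _ => by ring
      rw [h4] at h1
      refine ((hasDerivAt_pow 3 r).mul h1).congr_deriv ?_
      simp only [F']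
      push_cast
      ring
    refine virial_contradiction (F := F) (F' := F') (g := fun r => r ^ 2 * ∑ j, w j r ^ 2)
      (c := Elow / (2 * κ)) (C := (6 * C / κ * (n / μ) + 2 / κ * (n * (C * n * B) / μ)) * Eup)
      (K := 4 * μ ^ 2 / κ) hR (by positivity) hFd ?_ ?_ (by positivity) (by positivity)
      (fun r hr => ?_) (fun r hr => ?_) ?_
    · intro r hr
      have hr0 := lt_of_lt_of_le hR hr
      have ha : 0 < a r := lt_of_lt_of_le (by positivity) (ha0 r hr)
      have h1 : -(6 * C / κ * (n / μ) * Eup / r ^ 2) ≤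
          (3 * r ^ 2 - 3 * κ * r ^ 3 / a r) * ∑ j, p j r * w j r := by
        have h2 : |(3 * r ^ 2 - 3 * κ * r ^ 3 / a r) * ∑ j, p j r * w j r| ≤
            6 * C / κ * r * (n / μ * S r) := by
          rw [abs_mul]
          exact mul_le_mul (hra r hr) (hpw r) (abs_nonneg _) (by positivity)
        have h3 : 6 * C / κ * r * (n / μ * S r) = 6 * C / κ * (n / μ) * E r / r ^ 2 := by
          simp only [E]
          field_simp
        have h4 : 6 * C / κ * (n / μ) * E r / r ^ 2 ≤ 6 * C / κ * (n / μ) * Eup / r ^ 2 := by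
          gcongr
          exact (hcomp r hr).2
        have := neg_abs_le ((3 * r ^ 2 - 3 * κ * r ^ 3 / a r) * ∑ j, p j r * w j r)
        linarith
      have h5 : Elow / (2 * κ) / r ≤ r ^ 3 / a r * S r := by
        have h6 : r ^ 3 / a r * S r = E r / a r := by
          simp only [E]
          ring
        rw [h6, div_div]
        exact div_le_div₀ (hE0 r hr) (hcomp r hr).1 ha (ha2 r hr)
      have h7 : r ^ 3 / a r * (2 * μ ^ 2 * ∑ j, w j r ^ 2) ≤
          4 * μ ^ 2 / κ * (r ^ 2 * ∑ j, w j r ^ 2) := by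
        have h8 : 0 ≤ ∑ j, w j r ^ 2 := Finset.sum_nonneg fun j _ => sq_nonneg _
        have h9 := mul_le_mul_of_nonneg_right (hr3a r hr)
          (show 0 ≤ 2 * μ ^ 2 * ∑ j, w j r ^ 2 by positivity)
        refine h9.trans (le_of_eq ?_)
        ring
      have h10 : -(2 / κ * (n * (C * n * B) / μ) * Eup / r ^ 2) ≤
          r ^ 3 / a r * ∑ j, w j r * e j r := by
        have h2 : |r ^ 3 / a r * ∑ j, w j r * e j r| ≤
            2 / κ * r ^ 2 * (n * (C * n * B) / μ / r * S r) := by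
          rw [abs_mul, abs_of_nonneg (hr3a0 r hr)]
          exact mul_le_mul (hr3a r hr) (hwe r hr) (abs_nonneg _) (by positivity)
        have h3 : 2 / κ * r ^ 2 * (n * (C * n * B) / μ / r * S r) =
            2 / κ * (n * (C * n * B) / μ) * E r / r ^ 2 := by
          simp only [E]
          field_simp
        have h4 : 2 / κ * (n * (C * n * B) / μ) * E r / r ^ 2 ≤
            2 / κ * (n * (C * n * B) / μ) * Eup / r ^ 2 := by
          gcongr
          exact (hcomp r hr).2
        have := neg_abs_le (r ^ 3 / a r * ∑ j, w j r * e j r)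
        linarith
      have h11 : (6 * C / κ * (n / μ) + 2 / κ * (n * (C * n * B) / μ)) * Eup / r ^ 2 =
          6 * C / κ * (n / μ) * Eup / r ^ 2 + 2 / κ * (n * (C * n * B) / μ) * Eup / r ^ 2 := by
        ring
      rw [h11]
      simp only [F', mul_add, mul_sub]
      linarith
    · refine ⟨n / μ * Eup, fun r hr => ?_⟩
      have hr0 := lt_of_lt_of_le hR hr
      simp only [F]
      rw [abs_mul, abs_of_pos (show 0 < r ^ 3 by positivity)]
      calc r ^ 3 * |∑ j, p j r * w j r| ≤ r ^ 3 * (n / μ * S r) := by gcongr; exact hpw r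
        _ = n / μ * E r := by simp only [E]; ring
        _ ≤ n / μ * Eup := by gcongr; exact (hcomp r hr).2
    · exact mul_nonneg (sq_nonneg r) (Finset.sum_nonneg fun j _ => sq_nonneg _)
    · refine (continuousAt_id.pow 2).mul (tendsto_finsetSum _ fun j _ => ?_)
      exact (dw j r hr).continuousAt.pow 2
    · simp only [Finset.mul_sum]
      exact integrable_finsetSum _ fun j _ => hL j
  have hSz : S R0 = 0 := by
    have : R0 ^ 3 ≠ 0 := by positivity
    exact (mul_eq_zero.1 hEz).resolve_left this
  intro j
  have h1 := hterm j R0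
  rw [hSz] at h1
  have h2 : w j R0 = 0 := by
    have : μ ^ 2 * w j R0 ^ 2 = 0 := le_antisymm (by nlinarith [sq_nonneg (p j R0)]) (by positivity)
    simpa [hμ0.ne'] using this
  have h3 : p j R0 = 0 := by
    have : p j R0 ^ 2 = 0 := le_antisymm (by nlinarith [sq_nonneg (μ * w j R0)]) (by positivity)
    simpa using this
  refine ⟨h2, ?_⟩
  simp only [p, h2] at h3
  linarith

end AdSTaubNUT

end

noncomputable section

namespace AdSTaubNUT

open Matrix Filter Asymptotics

/-! ### Asymptotic expansions at infinity -/

/-- `f` is an analytic function of `1 / r` near infinity, with value `c` at infinity. -/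
def AnalyticAtInf (f : ℝ → ℝ) (c : ℝ) : Prop :=
  ∃ G : ℝ → ℝ, AnalyticAt ℝ G 0 ∧ G 0 = c ∧ f =ᶠ[atTop] fun r => G r⁻¹

namespace AnalyticAtInf

variable {f g : ℝ → ℝ} {c d : ℝ}

lemma const (c : ℝ) : AnalyticAtInf (fun _ => c) c :=
  ⟨fun _ => c, analyticAt_const, rfl, EventuallyEq.rfl⟩

lemma inv_id : AnalyticAtInf (fun r => r⁻¹) 0 :=
  ⟨fun u => u, analyticAt_id, rfl, EventuallyEq.rfl⟩

lemma congr (h : AnalyticAtInf f c) (e : g =ᶠ[atTop] f) : AnalyticAtInf g c :=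
  let ⟨G, h1, h2, h3⟩ := h
  ⟨G, h1, h2, e.trans h3⟩

lemma add (hf : AnalyticAtInf f c) (hg : AnalyticAtInf g d) :
    AnalyticAtInf (fun r => f r + g r) (c + d) :=
  let ⟨F, h1, h2, h3⟩ := hf
  let ⟨G, k1, k2, k3⟩ := hg
  ⟨fun u => F u + G u, h1.add k1, by simp [h2, k2], h3.add k3⟩

lemma mul (hf : AnalyticAtInf f c) (hg : AnalyticAtInf g d) :
    AnalyticAtInf (fun r => f r * g r) (c * d) :=
  let ⟨F, h1, h2, h3⟩ := hf
  let ⟨G, k1, k2, k3⟩ := hg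
  ⟨fun u => F u * G u, h1.mul k1, by simp [h2, k2], h3.mul k3⟩

lemma neg (hf : AnalyticAtInf f c) : AnalyticAtInf (fun r => -f r) (-c) :=
  let ⟨F, h1, h2, h3⟩ := hf
  ⟨fun u => -F u, h1.neg, by simp [h2], h3.neg⟩

lemma sub (hf : AnalyticAtInf f c) (hg : AnalyticAtInf g d) :
    AnalyticAtInf (fun r => f r - g r) (c - d) := by
  simpa [sub_eq_add_neg] using hf.add hg.neg

lemma div (hf : AnalyticAtInf f c) (hg : AnalyticAtInf g d) (hd : d ≠ 0) :
    AnalyticAtInf (fun r => f r / g r) (c / d) :=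
  let ⟨F, h1, h2, h3⟩ := hf
  let ⟨G, k1, k2, k3⟩ := hg
  ⟨fun u => F u / G u, h1.div k1 (by rwa [k2]), by simp [h2, k2], h3.div k3⟩

lemma sqrt (hf : AnalyticAtInf f c) (hc : c ≠ 0) : AnalyticAtInf (fun r => √(f r)) (√c) := by
  obtain ⟨F, h1, h2, h3⟩ := hf
  refine ⟨fun u => √(F u), ?_, by simp [h2], h3.fun_comp _⟩
  exact (h1.contDiffAt (n := ⊤).sqrt (by rwa [h2])).analyticAt

/-- The Euler derivative. -/
lemma mul_deriv (hf : AnalyticAtInf f c) : AnalyticAtInf (fun r => r * deriv f r) 0 := by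
  obtain ⟨F, h1, h2, h3⟩ := hf
  -- In u = 1/r the operator r d/dr is -u d/du, whose value at u = 0 is zero.
  refine ⟨fun u => -(u * deriv F u), (analyticAt_id.mul h1.deriv).neg, by simp, ?_⟩
  have ht : Tendsto (fun r : ℝ => r⁻¹) atTop (nhds 0) := tendsto_inv_atTop_zero
  have hd : ∀ᶠ u in nhds (0 : ℝ), AnalyticAt ℝ F u := h1.eventually_analyticAt
  obtain ⟨R, hR⟩ := eventually_atTop.1 h3
  filter_upwards [eventually_gt_atTop R, ht.eventually hd, eventually_gt_atTop 0] with r e0 e2 e3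
  have e1 : f =ᶠ[nhds r] fun t => F t⁻¹ :=
    eventually_of_mem (Ioi_mem_nhds e0) fun t ht => hR t (le_of_lt ht)
  have h4 : HasDerivAt (fun t : ℝ => F t⁻¹) (deriv F r⁻¹ * -(r ^ 2)⁻¹) r :=
    e2.differentiableAt.hasDerivAt.comp r (hasDerivAt_inv e3.ne')
  rw [e1.deriv_eq, h4.deriv]
  field_simp

lemma isBigO (hf : AnalyticAtInf f c) : (fun r => f r - c) =O[atTop] fun r => r⁻¹ := by
  obtain ⟨F, h1, h2, h3⟩ := hf
  have h4 := h1.differentiableAt.isBigO_sub.comp_tendsto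
    (tendsto_inv_atTop_zero : Tendsto (fun r : ℝ => r⁻¹) atTop (nhds 0))
  refine IsBigO.congr' h4 ?_ ?_
  · filter_upwards [h3] with r hr
    simp [hr, h2]
  · exact Eventually.of_forall fun r => by simp

end AnalyticAtInf

namespace Instanton

variable (I : Instanton)

/-- The inverse of the radius of curvature. -/
def kap : ℝ := I.ℓ⁻¹

lemma kap_pos : 0 < I.kap := inv_pos.2 I.ℓ_pos

/-- In u = 1/r the quotient A/r² is a rational function with the value κ² > 0 at u = 0, so its
square root is analytic there. The coefficients of the connection are built from this function, its
Euler derivative, B and u. -/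
lemma analyticAtInf_sA_div : AnalyticAtInf (fun r => I.sA r / r) I.kap := by
  have hu := AnalyticAtInf.inv_id
  have h2 := hu.mul hu
  have h3 := h2.mul hu
  have h4 := h2.mul h2
  have hnum := ((h2.add ((AnalyticAtInf.const (I.N ^ 2)).mul h4)).sub
    ((AnalyticAtInf.const (2 * I.mass)).mul h3)).add ((AnalyticAtInf.const (I.kap ^ 2)).mul
      (((AnalyticAtInf.const 1).sub ((AnalyticAtInf.const (6 * I.N ^ 2)).mul h2)).sub
        ((AnalyticAtInf.const (3 * I.N ^ 4)).mul h4)))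
  have hden := (AnalyticAtInf.const 1).sub ((AnalyticAtInf.const (I.N ^ 2)).mul h2)
  have hq := (hnum.div hden (by norm_num)).sqrt (by have := I.kap_pos; simp; positivity)
  simp only [mul_zero, sub_zero, add_zero, mul_one, zero_add, div_one,
    Real.sqrt_sq I.kap_pos.le] at hq
  refine hq.congr ?_
  filter_upwards [eventually_gt_atTop I.rPlus, eventually_gt_atTop 0] with r hr hr0
  have hB : r ^ 2 - I.N ^ 2 ≠ 0 := (I.B_pos hr).ne'
  have hl := I.ℓ_pos
  have h5 : (1 : ℝ) - I.N ^ 2 * (r⁻¹ * r⁻¹) ≠ 0 := by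
    have : (1 : ℝ) - I.N ^ 2 * (r⁻¹ * r⁻¹) = (r ^ 2 - I.N ^ 2) / r ^ 2 := by field_simp
    rw [this]
    positivity
  rw [eq_comm, eq_div_iff hr0.ne', sA, ← Real.sqrt_sq hr0.le, ← Real.sqrt_mul' _ (sq_nonneg _)]
  rw [Real.sqrt_sq hr0.le]
  congr 1
  rw [A, kap, div_mul_eq_mul_div, div_eq_div_iff h5 hB]
  field_simp

lemma analyticAtInf_β_mul : AnalyticAtInf (fun r => I.β r * r) 1 := by
  have hu := AnalyticAtInf.inv_id
  have hden := ((AnalyticAtInf.const 1).sub ((AnalyticAtInf.const (I.N ^ 2)).mul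
    (hu.mul hu))).sqrt (by norm_num)
  have hq := (AnalyticAtInf.const 1).div hden (by norm_num)
  simp only [mul_zero, sub_zero, Real.sqrt_one, div_one] at hq
  refine hq.congr ?_
  filter_upwards [eventually_gt_atTop I.rPlus, eventually_gt_atTop 0] with r hr hr0
  have hB : 0 < I.B r := I.B_pos hr
  have e : (1 : ℝ) - I.N ^ 2 * (r⁻¹ * r⁻¹) = I.B r / r ^ 2 := by
    rw [B]
    field_simp
  rw [e, Real.sqrt_div hB.le, Real.sqrt_sq hr0.le, β]
  field_simp

lemma analyticAtInf_β : AnalyticAtInf I.β 0 := by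
  have h := I.analyticAtInf_β_mul.mul AnalyticAtInf.inv_id
  rw [mul_zero] at h
  refine h.congr ?_
  filter_upwards [eventually_gt_atTop 0] with r hr0
  field_simp

lemma analyticAtInf_γ : AnalyticAtInf I.γ 0 := by
  have h := ((AnalyticAtInf.const (1 / (2 * I.N))).mul AnalyticAtInf.inv_id).div
    I.analyticAtInf_sA_div I.kap_pos.ne'
  simp only [mul_zero, zero_div] at h
  refine h.congr ?_
  filter_upwards [eventually_gt_atTop I.rPlus, eventually_gt_atTop 0] with r hr hr0
  have h1 := I.sA_pos hr
  have h2 := I.N_pos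
  change 1 / (2 * I.N * I.sA r) = _
  field_simp

lemma analyticAtInf_κ1 : AnalyticAtInf I.κ1 I.kap := by
  have h := I.analyticAtInf_sA_div.mul (I.analyticAtInf_β_mul.mul I.analyticAtInf_β_mul)
  simp only [mul_one] at h
  refine h.congr ?_
  filter_upwards [eventually_gt_atTop I.rPlus, eventually_gt_atTop 0] with r hr hr0
  have hB := I.B_pos hr
  have e : I.β r * r * (I.β r * r) = r ^ 2 / I.B r := by
    have : √(I.B r) ^ 2 = I.B r := Real.sq_sqrt hB.le
    rw [β]
    field_simp
    rw [this]
  rw [e, κ1]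
  field_simp

/-- From a' = a/r + r(a/r)', where the Euler derivative contributes nothing to the limit. -/
lemma analyticAtInf_κ3 : AnalyticAtInf I.κ3 I.kap := by
  have h := I.analyticAtInf_sA_div.add I.analyticAtInf_sA_div.mul_deriv
  rw [add_zero] at h
  refine h.congr ?_
  filter_upwards [eventually_gt_atTop I.rPlus, eventually_gt_atTop 0] with r hr hr0
  have h1 := (I.differentiableAt_radial I.contDiffOn_sA hr).hasDerivAt
  have h2 := h1.div (hasDerivAt_id r) hr0.ne'
  have h3 : deriv (fun r => I.sA r / r) r = (deriv I.sA r * r - I.sA r * 1) / r ^ 2 := h2.deriv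
  rw [h3, κ3]
  field_simp
  ring

lemma analyticAtInf_Γ1 : AnalyticAtInf I.Γ1 0 := by
  have h := ((AnalyticAtInf.const I.N).mul (I.analyticAtInf_κ1.mul AnalyticAtInf.inv_id)).neg
  simp only [mul_zero, neg_zero] at h
  refine h.congr ?_
  filter_upwards [eventually_gt_atTop 0] with r hr0
  rw [Γ1, κ1]
  field_simp

lemma analyticAtInf_Γ3 : AnalyticAtInf I.Γ3 0 := by
  have h := I.analyticAtInf_Γ1.neg.sub I.analyticAtInf_γ
  simp only [neg_zero, sub_zero] at h
  refine h.congr (Eventually.of_forall fun r => ?_)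
  simp [Γ3, Γ1]

lemma analyticAtInf_invb (c : Fin 4) : AnalyticAtInf (I.invb c) 0 := by
  fin_cases c
  · exact AnalyticAtInf.const 0
  · exact I.analyticAtInf_β
  · exact I.analyticAtInf_β
  · exact I.analyticAtInf_γ

/-- The limits of the connection matrices at infinity, those of hyperbolic space. -/
def connInf (c : Fin 4) : M4 := I.kap • (Matrix.single 0 c 1 - Matrix.single c 0 1)

lemma analyticAtInf_conn (c i j : Fin 4) :
    AnalyticAtInf (fun r => I.conn c r i j) (I.connInf c i j) := by
  have h1 := I.analyticAtInf_κ1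
  have h2 := I.analyticAtInf_κ3
  have h3 := I.analyticAtInf_Γ1
  have h4 := I.analyticAtInf_Γ3
  have h5 := h3.neg
  have h6 := h4.neg
  rw [neg_zero] at h5 h6
  have h0 := AnalyticAtInf.const 0
  fin_cases c <;> fin_cases i <;> fin_cases j <;>
    simp [connInf, Matrix.single] <;> first
    | exact h0 | exact h1 | exact h2 | exact h3 | exact h4 | exact h1.neg | exact h2.neg
    | exact h5 | exact h6

/-- The derivative along the unit radial vector is a/r, which is bounded near infinity, times the
Euler derivative, which vanishes at infinity and hence is O(1/r). -/
lemma isBigO_sA_mul_deriv {f : ℝ → ℝ} {c : ℝ} (hf : AnalyticAtInf f c) :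
    (fun r => I.sA r * deriv f r) =O[atTop] fun r => r⁻¹ := by
  have h := I.analyticAtInf_sA_div.mul hf.mul_deriv
  rw [mul_zero] at h
  have h1 := h.isBigO
  refine IsBigO.congr' h1 ?_ EventuallyEq.rfl
  filter_upwards [eventually_gt_atTop 0] with r hr0
  field_simp
  ring

lemma isBigO_connD (c i j : Fin 4) : (fun r => I.connD c r i j) =O[atTop] fun r => r⁻¹ :=
  I.isBigO_sA_mul_deriv (I.analyticAtInf_conn c i j)

lemma isBigO_invb (c : Fin 4) : I.invb c =O[atTop] fun r => r⁻¹ := by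
  simpa using (I.analyticAtInf_invb c).isBigO

lemma isBigO_conn (c i j : Fin 4) :
    (fun r => I.conn c r i j - I.connInf c i j) =O[atTop] fun r => r⁻¹ :=
  (I.analyticAtInf_conn c i j).isBigO

lemma isBigO_κtr : (fun r => I.κtr r - 3 * I.kap) =O[atTop] fun r => r⁻¹ := by
  have h := (((AnalyticAtInf.const 2).mul I.analyticAtInf_κ1).add I.analyticAtInf_κ3).isBigO
  refine h.congr_left fun r => ?_
  rw [κtr]
  ring

lemma isBigO_sA : (fun r => I.sA r - I.kap * r) =O[atTop] fun _ => (1 : ℝ) := by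
  have h := I.analyticAtInf_sA_div.isBigO.mul (isBigO_refl (fun r : ℝ => r) atTop)
  refine IsBigO.congr' h ?_ ?_
  · filter_upwards [eventually_gt_atTop 0] with r hr0
    field_simp
  · filter_upwards [eventually_gt_atTop 0] with r hr0
    field_simp

end Instanton

end AdSTaubNUT

end

noncomputable section

namespace AdSTaubNUT

open Matrix Filter Asymptotics

namespace Instanton

variable (I : Instanton)

/-! ### The limits at infinity of the terms of order zero -/

/-- The limit of `act`. -/
def actInf (c : Fin 4) (M : M4) : M4 := I.connInf c * M - M * I.connInf c

/-- The limit of `curv`. -/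
def curvInf (p q : Fin 4) : M4 :=
  -∑ c, (I.connInf p q c - I.connInf q p c) • I.connInf c +
    I.connInf q * I.connInf p - I.connInf p * I.connInf q

/-- The limit of `curvAct`. -/
def curvActInf (M : M4) : M4 := Matrix.of fun P Q => ∑ C, ∑ D, I.curvInf Q D C P * M C D

lemma connInf_apply (c i j : Fin 4) : I.connInf c i j =
    I.kap * ((if 0 = i ∧ c = j then 1 else 0) - (if c = i ∧ 0 = j then 1 else 0)) := by
  simp [connInf, Matrix.single_apply]

/-- Constant curvature -κ². The overall sign looks reversed because the pair i, j stands in the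
opposite order in the curvature tensor. -/
lemma curvInf_apply (p q i j : Fin 4) : I.curvInf p q i j =
    I.kap ^ 2 * ((if p = i ∧ q = j then 1 else 0) - (if q = i ∧ p = j then 1 else 0)) := by
  simp only [curvInf, Matrix.add_apply, Matrix.sub_apply, Matrix.neg_apply,
    Matrix.smul_apply, Matrix.mul_apply, connInf_apply, Fin.sum_univ_four, smul_eq_mul]
  fin_cases p <;> fin_cases q <;> fin_cases i <;> fin_cases j <;> simp <;> ring

/-- In constant curvature -κ² the contraction R_{acbd} M^{cd} is -κ²(g tr M - M), and the trace
vanishes. -/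
lemma curvActInf_apply {M : M4} (hs : Mᵀ = M) (ht : M.trace = 0) (P Q : Fin 4) :
    I.curvActInf M P Q = I.kap ^ 2 * M P Q := by
  have h1 : ∀ i j, M i j = M j i := fun i j => congrFun (congrFun hs j) i
  simp only [Matrix.trace, Matrix.diag_apply, Fin.sum_univ_four] at ht
  simp only [curvActInf, Matrix.of_apply, curvInf_apply, Fin.sum_univ_four]
  have e := h1 P Q
  fin_cases P <;> fin_cases Q <;> simp only [Fin.reduceFinMk, Fin.isValue] at e ⊢ <;> simp <;>
    first | linear_combination (-I.kap ^ 2) * ht | exact Or.inl e.symm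

/-- The limit of the terms of order zero of the modified Lichnerowicz operator. -/
def orderZeroInf (M : M4) : M4 :=
  ∑ c, I.actInf c (I.actInf c M) + (2 : ℝ) • I.curvActInf M

/-- Tangential components receive no term of order zero except 2M₀₀ on the diagonal, so their
limiting equation has the threshold 9κ²/4. The weights -6 and -4 of the radial components are what
`isBigO_radial` needs. -/
lemma orderZeroInf_apply {M : M4} (hs : Mᵀ = M) (ht : M.trace = 0) (P Q : Fin 4) :
    I.orderZeroInf M P Q = I.kap ^ 2 * (if P = 0 then (if Q = 0 then -6 * M 0 0 else -4 * M 0 Q)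
      else if Q = 0 then -4 * M P 0 else if P = Q then 2 * M 0 0 else 0) := by
  have h1 : ∀ i j, M i j = M j i := fun i j => congrFun (congrFun hs j) i
  have ht' : M 0 0 + M 1 1 + M 2 2 + M 3 3 = 0 := by
    rw [← ht]
    simp [Matrix.trace, Fin.sum_univ_four]
  simp only [orderZeroInf, Matrix.add_apply, Matrix.smul_apply, smul_eq_mul,
    I.curvActInf_apply hs ht, Matrix.sum_apply]
  simp only [actInf, Matrix.sub_apply, Matrix.mul_apply, connInf_apply, Fin.sum_univ_four]
  have e01 := h1 0 1
  have e02 := h1 0 2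
  have e03 := h1 0 3
  have e12 := h1 1 2
  have e13 := h1 1 3
  have e23 := h1 2 3
  fin_cases P <;> fin_cases Q <;> simp [e01, e02, e03, e12, e13, e23] <;>
    first | ring1 | linear_combination (2 * I.kap ^ 2) * ht'

end Instanton

end AdSTaubNUT

end

noncomputable section

namespace AdSTaubNUT

open Matrix Filter Asymptotics

namespace Instanton

variable (I : Instanton)

/-! ### Radial systems -/

/-- The action on a family of tensors of a matrix of coefficients. -/
def mix {ι : Type*} [Fintype ι] (X : ι → ι → ℝ) (Y : ι → M4) (α : ι) : M4 :=
  ∑ β, X α β • Y β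

/-- The terms of order zero of the modified Lichnerowicz operator at radius `r`, for a family of
tensors on which the vector fields dual to the left-invariant forms act by `X`. -/
def orderZero {ι : Type*} [Fintype ι] (X : Fin 4 → ι → ι → ℝ) (r : ℝ) (Y : ι → M4) (α : ι) : M4 :=
  ∑ c, (I.invb c r ^ 2 • mix (X c) (mix (X c) Y) α -
    (2 * I.invb c r) • I.act c r (mix (X c) Y α) + I.act c r (I.act c r (Y α))) +
    (2 : ℝ) • I.curvAct r (Y α)

/-- The limit of the terms of order zero of the divergence. -/
lemma sum_actInf_apply {M : M4} (hs : Mᵀ = M) (ht : M.trace = 0) (Q : Fin 4) :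
    ∑ c, I.actInf c M c Q = -(4 * I.kap) * M 0 Q := by
  have h1 : ∀ i j, M i j = M j i := fun i j => congrFun (congrFun hs j) i
  have ht' : M 0 0 + M 1 1 + M 2 2 + M 3 3 = 0 := by
    rw [← ht]
    simp [Matrix.trace, Fin.sum_univ_four]
  simp only [actInf, Matrix.sub_apply, Matrix.mul_apply, connInf_apply, Fin.sum_univ_four]
  have e01 := h1 0 1
  have e02 := h1 0 2
  have e03 := h1 0 3
  fin_cases Q <;> simp [e01, e02, e03] <;>
    first | ring1 | linear_combination I.kap * ht'

variable {I} {l : Filter ℝ} {g ε : ℝ → ℝ}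

/-- Two bounds on the action of matrices whose entries are known up to an error. -/
lemma isBigO_commutator_sub {W M : ℝ → M4} {W' : M4} 
    (hW : ∀ i j, (fun r => W r i j - W' i j) =O[l] ε)
    (hM : ∀ i j, (fun r => M r i j) =O[l] g) (i j : Fin 4) :
    (fun r => (W r * M r - M r * W r) i j - (W' * M r - M r * W') i j) =O[l]
      fun r => ε r * g r := by
  have h : ∀ r, (W r * M r - M r * W r) i j - (W' * M r - M r * W') i j =
      ∑ a, (W r i a - W' i a) * M r a j - ∑ a, (W r a j - W' a j) * M r i a := fun r => by
    simp only [Matrix.sub_apply, Matrix.mul_apply, ← Finset.sum_sub_distrib]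
    exact Finset.sum_congr rfl fun a _ => by ring
  simp only [h]
  exact (IsBigO.fun_sum fun a _ => (hW i a).mul (hM a j)).sub
    (IsBigO.fun_sum fun a _ => (hW a j).mul (hM i a))

lemma isBigO_commutator {W M : ℝ → M4} (hW : ∀ i j, (fun r => W r i j) =O[l] ε)
    (hM : ∀ i j, (fun r => M r i j) =O[l] g) (i j : Fin 4) :
    (fun r => (W r * M r - M r * W r) i j) =O[l] fun r => ε r * g r := by
  have := isBigO_commutator_sub (W' := 0) (by simpa using hW) hM i j
  simpa using this

lemma isBigO_mix {ι : Type*} [Fintype ι] {Y : ι → ℝ → M4} (X : ι → ι → ℝ)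
    (hY : ∀ α i j, (fun r => Y α r i j) =O[l] g) (α : ι) (i j : Fin 4) :
    (fun r => mix X (fun β => Y β r) α i j) =O[l] g := by
  simp only [mix, Matrix.sum_apply, Matrix.smul_apply, smul_eq_mul]
  exact IsBigO.fun_sum fun β _ => (hY β i j).const_mul_left _

/-- The curvature action -/
lemma isBigO_curvAct {M : ℝ → M4} {W : Fin 4 → Fin 4 → ℝ → M4} 
    (hW : ∀ p q i j, (fun r => W p q r i j) =O[l] ε) (hM : ∀ i j, (fun r => M r i j) =O[l] g)
    (P Q : Fin 4) :
    (fun r => ∑ C, ∑ D, W Q D r C P * M r C D) =O[l] fun r => ε r * g r :=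
  IsBigO.fun_sum fun C _ => IsBigO.fun_sum fun D _ => (hW Q D C P).mul (hM C D)

lemma isBigO_conn_one (c i j : Fin 4) :
    (fun r => I.conn c r i j) =O[atTop] fun _ => (1 : ℝ) := by
  have h2 := ((I.isBigO_conn c i j).trans (tendsto_inv_atTop_zero.isBigO_one ℝ)).add
    (isBigO_const_const (I.connInf c i j) (one_ne_zero (α := ℝ)) atTop)
  simpa using h2

/-- The curvature tends to that of hyperbolic space. -/
lemma isBigO_curv (p q i j : Fin 4) :
    (fun r => I.curv p q r i j - I.curvInf p q i j) =O[atTop] fun r => r⁻¹ := by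
  have h3 : ∀ c d i j a b, (fun r => I.conn c r i j * I.conn d r a b -
      I.connInf c i j * I.connInf d a b) =O[atTop] fun r => r⁻¹ := fun c d i j a b => by
    have h4 := (I.isBigO_conn c i j).mul (isBigO_conn_one (I := I) d a b)
    simp only [mul_one] at h4
    refine (h4.add ((I.isBigO_conn d a b).const_mul_left (I.connInf c i j))).congr_left fun r => ?_
    ring
  have h : ∀ r, I.curv p q r i j - I.curvInf p q i j =
      (if p = 0 then I.connD q r i j else 0) - (if q = 0 then I.connD p r i j else 0) -
      ∑ c, ((I.conn p r q c * I.conn c r i j - I.connInf p q c * I.connInf c i j) -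
        (I.conn q r p c * I.conn c r i j - I.connInf q p c * I.connInf c i j)) +
      ∑ a, (I.conn q r i a * I.conn p r a j - I.connInf q i a * I.connInf p a j) -
      ∑ a, (I.conn p r i a * I.conn q r a j - I.connInf p i a * I.connInf q a j) := fun r => by
    have e1 : (if p = 0 then I.connD q r else 0) i j = if p = 0 then I.connD q r i j else 0 := by
      split_ifs <;> rfl
    have e2 : (if q = 0 then I.connD p r else 0) i j = if q = 0 then I.connD p r i j else 0 := by
      split_ifs <;> rfl
    simp only [curv, curvInf, Matrix.add_apply, Matrix.sub_apply, Matrix.neg_apply,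
      Matrix.sum_apply, Matrix.smul_apply, Matrix.mul_apply, smul_eq_mul, e1, e2,
      Finset.sum_sub_distrib, sub_mul]
    ring
  simp only [h]
  refine (((IsBigO.sub ?_ ?_).sub (IsBigO.fun_sum fun c _ => (h3 _ _ _ _ _ _).sub (h3 _ _ _ _ _ _))).add
    (IsBigO.fun_sum fun a _ => h3 _ _ _ _ _ _)).sub (IsBigO.fun_sum fun a _ => h3 _ _ _ _ _ _)
  · split_ifs
    · exact I.isBigO_connD q i j
    · exact isBigO_zero _ _
  · split_ifs
    · exact I.isBigO_connD p i j
    · exact isBigO_zero _ _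

lemma isBigO_orderZero {ι : Type*} [Fintype ι] (X : Fin 4 → ι → ι → ℝ) {Y : ι → ℝ → M4}
    (hb : ∀ c, I.invb c =O[l] fun _ => (1 : ℝ))
    (hc : ∀ c i j, (fun r => I.conn c r i j) =O[l] fun _ => (1 : ℝ))
    (hk : ∀ p q i j, (fun r => I.curv p q r i j) =O[l] fun _ => (1 : ℝ))
    (hY : ∀ α i j, (fun r => Y α r i j) =O[l] g) (α : ι) (i j : Fin 4) :
    (fun r => I.orderZero X r (fun β => Y β r) α i j) =O[l] g := by
  have h1 : ∀ c (M : ℝ → M4), (∀ i j, (fun r => M r i j) =O[l] g) → ∀ i j,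
      (fun r => I.act c r (M r) i j) =O[l] g := fun c M hM i j => by
    have := isBigO_commutator (hc c) hM i j
    simp only [one_mul] at this
    exact this
  have h2 : ∀ c β i j, (fun r => mix (X c) (fun β => Y β r) β i j) =O[l] g := fun c =>
    isBigO_mix (X c) hY
  simp only [orderZero, curvAct, Matrix.add_apply, Matrix.sub_apply, Matrix.sum_apply,
    Matrix.smul_apply, smul_eq_mul, Matrix.of_apply]
  refine IsBigO.add (IsBigO.fun_sum fun c _ => IsBigO.add (IsBigO.sub ?_ ?_) ?_) ?_
  · simpa using ((hb c).pow 2).mul (isBigO_mix (X c) (h2 c) α i j)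
  · simpa using ((hb c).const_mul_left 2).mul (h1 c _ (h2 c α) i j)
  · exact h1 c _ (h1 c _ (hY α)) i j
  · simpa using (isBigO_curvAct hk (hY α) i j).const_mul_left 2

lemma isBigO_act_sub (c : Fin 4) {M : ℝ → M4} (hM : ∀ i j, (fun r => M r i j) =O[atTop] g)
    (i j : Fin 4) : (fun r => I.act c r (M r) i j - I.actInf c (M r) i j) =O[atTop]
      fun r => r⁻¹ * g r :=
  isBigO_commutator_sub (I.isBigO_conn c) hM i j

/-- Tangential derivatives carry a factor `invb`, which is O(1/r), and the connection and curvature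
differ from their hyperbolic limits by O(1/r). -/
lemma isBigO_orderZero_sub {ι : Type*} [Fintype ι] (X : Fin 4 → ι → ι → ℝ) {Y : ι → ℝ → M4}
    (hY : ∀ α i j, (fun r => Y α r i j) =O[atTop] g) (α : ι) (i j : Fin 4) :
    (fun r => I.orderZero X r (fun β => Y β r) α i j - I.orderZeroInf (Y α r) i j) =O[atTop]
      fun r => r⁻¹ * g r := by
  have h1 : ∀ c (M : ℝ → M4) {g : ℝ → ℝ}, (∀ i j, (fun r => M r i j) =O[atTop] g) → ∀ i j,
      (fun r => I.act c r (M r) i j) =O[atTop] g := fun c M g hM i j => by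
    have := isBigO_commutator (isBigO_conn_one (I := I) c) hM i j
    simp only [one_mul] at this
    exact this
  have h2 : ∀ c β i j, (fun r => mix (X c) (fun β => Y β r) β i j) =O[atTop] g := fun c =>
    isBigO_mix (X c) hY
  have hone : ∀ c, I.invb c =O[atTop] fun _ => (1 : ℝ) := fun c =>
    (I.isBigO_invb c).trans (tendsto_inv_atTop_zero.isBigO_one ℝ)
  have h3 : ∀ c i j, (fun r => I.act c r (I.act c r (Y α r)) i j -
      I.actInf c (I.actInf c (Y α r)) i j) =O[atTop] fun r => r⁻¹ * g r := fun c i j => by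
    have e1 := isBigO_act_sub (I := I) c (h1 c _ (hY α)) i j
    have e2 := isBigO_commutator (W := fun _ => I.connInf c)
      (M := fun r => I.act c r (Y α r) - I.actInf c (Y α r)) (ε := fun _ => (1 : ℝ))
      (fun i j => isBigO_const_const _ one_ne_zero _) (isBigO_act_sub (I := I) c (hY α)) i j
    simp only [one_mul] at e2
    refine (e1.add e2).congr_left fun r => ?_
    simp only [actInf, Matrix.sub_apply, Matrix.mul_sub, Matrix.sub_mul]
    ring
  have h4 : (fun r => I.curvAct r (Y α r) i j - I.curvActInf (Y α r) i j) =O[atTop]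
      fun r => r⁻¹ * g r := by
    refine (isBigO_curvAct (W := fun p q r => I.curv p q r - I.curvInf p q) isBigO_curv
      (hY α) i j).congr_left fun r => ?_
    simp only [curvAct, curvActInf, Matrix.of_apply, ← Finset.sum_sub_distrib, Matrix.sub_apply,
      sub_mul]
  have h : ∀ r, I.orderZero X r (fun β => Y β r) α i j - I.orderZeroInf (Y α r) i j =
      ∑ c, (I.invb c r * (I.invb c r * mix (X c) (mix (X c) fun β => Y β r) α i j) -
        I.invb c r * (2 * I.act c r (mix (X c) (fun β => Y β r) α) i j) +
        (I.act c r (I.act c r (Y α r)) i j - I.actInf c (I.actInf c (Y α r)) i j)) +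
      2 * (I.curvAct r (Y α r) i j - I.curvActInf (Y α r) i j) := fun r => by
    simp only [orderZero, orderZeroInf, Matrix.add_apply, Matrix.sub_apply, Matrix.sum_apply,
      Matrix.smul_apply, smul_eq_mul, Finset.sum_add_distrib, Finset.sum_sub_distrib]
    have e5 : ∀ c, I.invb c r ^ 2 * mix (X c) (mix (X c) fun β => Y β r) α i j =
      I.invb c r * (I.invb c r * mix (X c) (mix (X c) fun β => Y β r) α i j) := fun c => by ring
    have e6 : ∀ c, 2 * I.invb c r * I.act c r (mix (X c) (fun β => Y β r) α) i j =
      I.invb c r * (2 * I.act c r (mix (X c) (fun β => Y β r) α) i j) := fun c => by ring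
    simp only [e5, e6]
    ring
  simp only [h]
  refine IsBigO.add (IsBigO.fun_sum fun c _ => IsBigO.add (IsBigO.sub ?_ ?_) (h3 c i j))
    (h4.const_mul_left 2)
  · refine (I.isBigO_invb c).mul ?_
    simpa using (hone c).mul (isBigO_mix (X c) (h2 c) α i j)
  · exact (I.isBigO_invb c).mul ((h1 c _ (h2 c α) i j).const_mul_left 2)

end Instanton

end AdSTaubNUT

end

/-! ### Radial systems and the decay of the components with a radial index -/

noncomputable section

namespace AdSTaubNUT

open Matrix Filter Asymptotics

namespace Instanton

/-- A solution of the eigenvalue equation for transverse traceless tensors, given by a family of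
functions of the radial coordinate. -/
structure RadialSystem (I : Instanton) (lam : ℝ) {ι : Type*} [Fintype ι]
    (X : Fin 4 → ι → ι → ℝ) (Y Y1 Y2 : ι → ℝ → M4) : Prop where
  hasDerivAt : ∀ α i j r, I.rPlus < r →
    HasDerivAt (fun t => Y α t i j) (Y1 α r i j / I.sA r) r
  hasDerivAt_one : ∀ α i j r, I.rPlus < r →
    HasDerivAt (fun t => Y1 α t i j) (Y2 α r i j / I.sA r) r
  symm : ∀ α r, I.rPlus < r → (Y α r)ᵀ = Y α r
  trace : ∀ α r, I.rPlus < r → (Y α r).trace = 0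
  eigen : ∀ α r, I.rPlus < r → Y2 α r + I.κtr r • Y1 α r +
    I.orderZero X r (fun β => Y β r) α + lam • Y α r = 0
  div : ∀ α r, I.rPlus < r → ∀ Q, Y1 α r 0 Q +
    ∑ c, (I.invb c r * mix (X c) (fun β => Y β r) α c Q - I.act c r (Y α r) c Q) = 0

namespace RadialSystem

variable {I : Instanton} {lam : ℝ} {ι : Type*} [Fintype ι] {X : Fin 4 → ι → ι → ℝ}
  {Y Y1 Y2 : ι → ℝ → M4} (h : RadialSystem I lam X Y Y1 Y2)

include h

lemma symm_one (α : ι) {r : ℝ} (hr : I.rPlus < r) : (Y1 α r)ᵀ = Y1 α r := by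
  ext i j
  have h1 := h.hasDerivAt α i j r hr
  have h2 : HasDerivAt (fun t => Y α t i j) (Y1 α r j i / I.sA r) r :=
    (h.hasDerivAt α j i r hr).congr_of_eventuallyEq (eventually_of_mem (Ioi_mem_nhds hr)
      fun t ht => (congrFun (congrFun (h.symm α t ht) j) i))
  have h3 := h2.unique h1
  rwa [div_left_inj' (I.sA_pos hr).ne'] at h3

lemma trace_one (α : ι) {r : ℝ} (hr : I.rPlus < r) : (Y1 α r).trace = 0 := by
  have h1 : HasDerivAt (fun t => (Y α t).trace) (∑ i, Y1 α r i i / I.sA r) r :=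
    HasDerivAt.fun_sum fun i _ => h.hasDerivAt α i i r hr
  have h2 : HasDerivAt (fun t => (Y α t).trace) 0 r :=
    (hasDerivAt_const r 0).congr_of_eventuallyEq (eventually_of_mem (Ioi_mem_nhds hr)
      fun t ht => h.trace α t ht)
  have h3 := h1.unique h2
  rw [← Finset.sum_div, div_eq_zero_iff] at h3
  exact h3.resolve_right (I.sA_pos hr).ne'

/-- The constraint `div` differentiated along the unit radial vector. It supplies the second
derivative of the components Y_{0Q}, so that the eigenvalue equation for them becomes algebraic up
to O(1/r). -/
lemma div_one (α : ι) {r : ℝ} (hr : I.rPlus < r) (Q : Fin 4) : Y2 α r 0 Q +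
    ∑ c, ((I.sA r * deriv (I.invb c) r) * mix (X c) (fun β => Y β r) α c Q +
      I.invb c r * mix (X c) (fun β => Y1 β r) α c Q -
      ((I.connD c r * Y α r - Y α r * I.connD c r) c Q + I.act c r (Y1 α r) c Q)) = 0 := by
  have hs := (I.sA_pos hr).ne'
  have hmix : ∀ c i j, HasDerivAt (fun t => mix (X c) (fun β => Y β t) α i j)
      (mix (X c) (fun β => Y1 β r) α i j / I.sA r) r := fun c i j => by
    simp only [mix, Matrix.sum_apply, Matrix.smul_apply, smul_eq_mul, Finset.sum_div,
      mul_div_assoc]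
    exact HasDerivAt.fun_sum fun β _ => (h.hasDerivAt β i j r hr).const_mul _
  have hconn : ∀ c i j, HasDerivAt (fun t => I.conn c t i j) (I.connD c r i j / I.sA r) r :=
    fun c i j => by
    refine (I.differentiableAt_radial (I.contDiffOn_conn c i j) hr).hasDerivAt.congr_deriv ?_
    rw [connD, Matrix.of_apply]
    field_simp
  have hact : ∀ c i j, HasDerivAt (fun t => I.act c t (Y α t) i j)
      (((I.connD c r * Y α r - Y α r * I.connD c r) i j + I.act c r (Y1 α r) i j) / I.sA r) r :=
    fun c i j => by
    have h1 : HasDerivAt (fun t => ∑ a, I.conn c t i a * Y α t a j -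
        ∑ a, Y α t i a * I.conn c t a j) _ r := HasDerivAt.sub
      (HasDerivAt.fun_sum fun a _ => (hconn c i a).mul (h.hasDerivAt α a j r hr))
      (HasDerivAt.fun_sum fun a _ => (h.hasDerivAt α i a r hr).mul (hconn c a j))
    refine h1.congr_deriv ?_
    simp only [act, Matrix.sub_apply, Matrix.mul_apply, ← Finset.sum_sub_distrib,
      ← Finset.sum_add_distrib, Finset.sum_div]
    exact Finset.sum_congr rfl fun a _ => by ring
  have hD := (h.hasDerivAt_one α 0 Q r hr).add (HasDerivAt.fun_sum (u := Finset.univ) fun c _ =>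
    ((I.differentiableAt_radial (I.contDiffOn_invb c) hr).hasDerivAt.mul (hmix c c Q)).sub
      (hact c c Q))
  have h0 := hD.unique ((hasDerivAt_const r 0).congr_of_eventuallyEq
    (eventually_of_mem (Ioi_mem_nhds hr) fun t ht => h.div α t ht Q))
  rw [← mul_eq_zero_iff_left hs, mul_add, Finset.mul_sum] at h0
  rw [← h0]
  congr 1
  · field_simp
  · exact Finset.sum_congr rfl fun c _ => by field_simp

omit h in
/-- The size of a solution. -/
lemma isBigO_size (Z : ι → ℝ → M4) (l : Filter ℝ) (α : ι) (i j : Fin 4) :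
    (fun r => Z α r i j) =O[l] fun r => ∑ α, ∑ i, ∑ j, |Z α r i j| := by
  refine IsBigO.of_bound 1 (Eventually.of_forall fun r => ?_)
  have h1 : ∀ α i, 0 ≤ ∑ j, |Z α r i j| := fun α i => Finset.sum_nonneg fun j _ => abs_nonneg _
  have h2 : ∀ α, 0 ≤ ∑ i, ∑ j, |Z α r i j| := fun α => Finset.sum_nonneg fun i _ => h1 α i
  rw [one_mul, Real.norm_eq_abs, Real.norm_of_nonneg (Finset.sum_nonneg fun α _ => h2 α)]
  exact ((Finset.single_le_sum (f := fun j => |Z α r i j|) (fun j _ => abs_nonneg _)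
    (Finset.mem_univ j)).trans (Finset.single_le_sum (f := fun i => ∑ j, |Z α r i j|)
    (fun i _ => h1 α i) (Finset.mem_univ i))).trans (Finset.single_le_sum
    (f := fun α => ∑ i, ∑ j, |Z α r i j|) (fun α _ => h2 α) (Finset.mem_univ α))

variable {g : ℝ → ℝ} (h0 : ∀ α i j, (fun r => Y α r i j) =O[atTop] g)
  (h1 : ∀ α i j, (fun r => Y1 α r i j) =O[atTop] g)

include h0 h1

omit h1 in
lemma isBigO_div (α : ι) (Q : Fin 4) :
    (fun r => Y1 α r 0 Q + 4 * I.kap * Y α r 0 Q) =O[atTop] fun r => r⁻¹ * g r := by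
  have e1 := IsBigO.fun_sum (s := Finset.univ) fun c _ =>
    (I.isBigO_invb c).mul (isBigO_mix (X c) h0 α c Q)
  have e2 := IsBigO.fun_sum (s := Finset.univ) fun c _ =>
    isBigO_act_sub (I := I) c (h0 α) c Q
  refine IsBigO.congr' (e2.sub e1) (?_ : _ =ᶠ[atTop] _) EventuallyEq.rfl
  filter_upwards [eventually_gt_atTop I.rPlus] with r hr
  have e := h.div α r hr Q
  have e1 := I.sum_actInf_apply (h.symm α r hr) (h.trace α r hr) Q
  rw [Finset.sum_sub_distrib] at e ⊢
  rw [e1]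
  linear_combination -e

lemma isBigO_div_one (α : ι) (Q : Fin 4) :
    (fun r => Y2 α r 0 Q + 4 * I.kap * Y1 α r 0 Q) =O[atTop] fun r => r⁻¹ * g r := by
  have e0 := IsBigO.fun_sum (s := Finset.univ) fun c _ => (I.isBigO_sA_mul_deriv
    (I.analyticAtInf_invb c)).mul (isBigO_mix (X c) h0 α c Q)
  have e1 := IsBigO.fun_sum (s := Finset.univ) fun c _ =>
    (I.isBigO_invb c).mul (isBigO_mix (X c) h1 α c Q)
  have e2 := IsBigO.fun_sum (s := Finset.univ) fun c _ =>
    isBigO_commutator (I.isBigO_connD c) (h0 α) c Q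
  have e3 := IsBigO.fun_sum (s := Finset.univ) fun c _ =>
    isBigO_act_sub (I := I) c (h1 α) c Q
  refine IsBigO.congr' (((e3.add e2).sub e1).sub e0) (?_ : _ =ᶠ[atTop] _) EventuallyEq.rfl
  filter_upwards [eventually_gt_atTop I.rPlus] with r hr
  have e := h.div_one α hr Q
  have e4 := I.sum_actInf_apply (h.symm_one α hr) (h.trace_one α hr) Q
  simp only [Finset.sum_sub_distrib, Finset.sum_add_distrib] at e ⊢
  rw [e4]
  linear_combination -e

lemma isBigO_eigen (α : ι) (i j : Fin 4) :
    (fun r => Y2 α r i j + 3 * I.kap * Y1 α r i j + I.orderZeroInf (Y α r) i j +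
      lam * Y α r i j) =O[atTop] fun r => r⁻¹ * g r := by
  refine IsBigO.congr' ((I.isBigO_κtr.mul (h1 α i j)).add
    (isBigO_orderZero_sub (I := I) X h0 α i j)).neg_left (?_ : _ =ᶠ[atTop] _) EventuallyEq.rfl
  filter_upwards [eventually_gt_atTop I.rPlus] with r hr
  have e := congrFun (congrFun (h.eigen α r hr) i) j
  simp only [Matrix.add_apply, Matrix.smul_apply, smul_eq_mul, Matrix.zero_apply] at e
  linear_combination -e

variable (hlam : 9 / 4 * I.kap ^ 2 < lam)

include hlam

/-- The radial components decay faster than the others. -/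
lemma isBigO_radial (α : ι) (Q : Fin 4) :
    (fun r => Y α r 0 Q) =O[atTop] fun r => r⁻¹ * g r := by
  have hk := I.kap_pos
  -- The constraints give Y1 ≈ -4κY and Y2 ≈ 16κ²Y for the index pair 0, Q. In the eigenvalue
  -- equation the coefficient of κ²Y is then 16 - 12 - 6 = -2 for Q = 0 and 16 - 12 - 4 = 0
  -- otherwise. What remains, λ - 2κ² or λ, is positive since λ > 9κ²/4.
  set c : ℝ := if Q = 0 then lam - 2 * I.kap ^ 2 else lam with hc
  have hc0 : c ≠ 0 := by
    rw [hc]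
    split_ifs <;> nlinarith
  have e0 := h.isBigO_div h0 α Q
  have e1 := h.isBigO_div_one h0 h1 α Q
  have e2 := h.isBigO_eigen h0 h1 α 0 Q
  have e3 := ((e2.sub e1).add (e0.const_mul_left I.kap)).const_mul_left c⁻¹
  refine IsBigO.congr' e3 (?_ : _ =ᶠ[atTop] _) EventuallyEq.rfl
  filter_upwards [eventually_gt_atTop I.rPlus] with r hr
  rw [I.orderZeroInf_apply (h.symm α r hr) (h.trace α r hr)]
  rw [inv_mul_eq_iff_eq_mul₀ hc0, hc]
  by_cases hQ : Q = 0
  · subst hQ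
    simp
    ring
  · simp [hQ]
    ring

lemma isBigO_radial_one (α : ι) (Q : Fin 4) :
    (fun r => Y1 α r 0 Q) =O[atTop] fun r => r⁻¹ * g r := by
  refine ((h.isBigO_div h0 α Q).sub
    ((h.isBigO_radial h0 h1 hlam α Q).const_mul_left (4 * I.kap))).congr_left fun r => ?_
  ring

/-- The only coupling left in the limit is to Y₀₀, and `isBigO_radial` turns it into an error term.
-/
lemma isBigO_tangential (α : ι) (i j : Fin 3) :
    (fun r => Y2 α r i.succ j.succ + 3 * I.kap * Y1 α r i.succ j.succ +
      lam * Y α r i.succ j.succ) =O[atTop] fun r => r⁻¹ * g r := by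
  refine IsBigO.congr' ((h.isBigO_eigen h0 h1 α i.succ j.succ).sub
    ((h.isBigO_radial h0 h1 hlam α 0).const_mul_left
      (I.kap ^ 2 * (if i = j then 2 else 0)))) (?_ : _ =ᶠ[atTop] _) EventuallyEq.rfl
  filter_upwards [eventually_gt_atTop I.rPlus] with r hr
  rw [I.orderZeroInf_apply (h.symm α r hr) (h.trace α r hr)]
  by_cases hij : i = j
  · simp [hij, Fin.succ_ne_zero]
    ring
  · simp [hij, Fin.succ_ne_zero]

end RadialSystem

end Instanton

end AdSTaubNUT

end

/-! ### Vanishing of square-integrable radial solutions -/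

noncomputable section

namespace AdSTaubNUT

open Matrix Filter Asymptotics

namespace Instanton

namespace RadialSystem

variable {I : Instanton} {lam : ℝ} {ι : Type*} [Fintype ι] {X : Fin 4 → ι → ι → ℝ}
  {Y Y1 Y2 : ι → ℝ → M4}

/-- A sum with a small relative error. -/
lemma isBigO_of_add_small {f g e : ℝ → ℝ} (hf : f = fun r => g r + e r)
    (he : e =O[atTop] fun r => r⁻¹ * f r) : f =O[atTop] g := by
  have h1 : e =o[atTop] f := by
    refine he.trans_isLittleO ?_
    have h2 : (fun r : ℝ => r⁻¹) =o[atTop] fun _ => (1 : ℝ) :=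
      (isLittleO_one_iff ℝ).2 tendsto_inv_atTop_zero
    simpa using h2.mul_isBigO (isBigO_refl f atTop)
  have h3 : g = fun r => f r - e r := by
    rw [hf]
    funext r
    simp
  rw [h3]
  exact h1.right_isBigO_sub

variable (h : RadialSystem I lam X Y Y1 Y2)

include h

/-- A square-integrable solution vanishes near infinity. -/
lemma eventually_eq_zero (hlam : 9 / 4 * I.kap ^ 2 < lam)
    (hL : ∀ α i j, IntegrableOn (fun r => r ^ 2 * Y α r i j ^ 2) (Set.Ioi (I.rPlus + 1))) :
    ∀ᶠ r in atTop, ∀ α, Y α r = 0 ∧ Y1 α r = 0 := by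
  have hk := I.kap_pos
  let J : Type _ := ι × Fin 3 × Fin 3
  let w : J → ℝ → ℝ := fun p r => Y p.1 r p.2.1.succ p.2.2.succ
  let w1 : J → ℝ → ℝ := fun p r => Y1 p.1 r p.2.1.succ p.2.2.succ
  let w2 : J → ℝ → ℝ := fun p r => Y2 p.1 r p.2.1.succ p.2.2.succ
  let g : ℝ → ℝ := fun r => ∑ α, ∑ i, ∑ j, |Y α r i j| + ∑ α, ∑ i, ∑ j, |Y1 α r i j|
  let gw : ℝ → ℝ := fun r => ∑ p : J, (|w p r| + |w1 p r|)
  have hpos : ∀ (Z : ι → ℝ → M4) r, 0 ≤ ∑ α, ∑ i, ∑ j, |Z α r i j| := fun Z r =>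
    Finset.sum_nonneg fun α _ => Finset.sum_nonneg fun i _ => Finset.sum_nonneg fun j _ =>
      abs_nonneg _
  have h0 : ∀ α i j, (fun r => Y α r i j) =O[atTop] g := fun α i j => by
    refine (isBigO_size Y atTop α i j).trans (IsBigO.of_bound 1 (Eventually.of_forall fun r => ?_))
    rw [one_mul, Real.norm_of_nonneg (hpos Y r), Real.norm_of_nonneg
      (add_nonneg (hpos Y r) (hpos Y1 r))]
    exact le_add_of_nonneg_right (hpos Y1 r)
  have h1 : ∀ α i j, (fun r => Y1 α r i j) =O[atTop] g := fun α i j => by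
    refine (isBigO_size Y1 atTop α i j).trans (IsBigO.of_bound 1 (Eventually.of_forall fun r => ?_))
    rw [one_mul, Real.norm_of_nonneg (hpos Y1 r), Real.norm_of_nonneg
      (add_nonneg (hpos Y r) (hpos Y1 r))]
    exact le_add_of_nonneg_left (hpos Y r)
  have hr0 := h.isBigO_radial h0 h1 hlam
  have hr1 := h.isBigO_radial_one h0 h1 hlam
  have hs0 : ∀ α Q, (fun r => Y α r Q 0) =O[atTop] fun r => r⁻¹ * g r := fun α Q => by
    refine IsBigO.congr' (hr0 α Q) (?_ : _ =ᶠ[atTop] _) EventuallyEq.rfl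
    filter_upwards [eventually_gt_atTop I.rPlus] with r hr
    exact congrFun (congrFun (h.symm α r hr) Q) 0
  have hs1 : ∀ α Q, (fun r => Y1 α r Q 0) =O[atTop] fun r => r⁻¹ * g r := fun α Q => by
    refine IsBigO.congr' (hr1 α Q) (?_ : _ =ᶠ[atTop] _) EventuallyEq.rfl
    filter_upwards [eventually_gt_atTop I.rPlus] with r hr
    exact congrFun (congrFun (h.symm_one α hr) Q) 0
  -- Here g is the size of the whole solution and gw that of its tangential part. The components
  -- with an index 0 amount to O(g/r) and are absorbed, so the error terms are O(gw/r) and the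
  -- tangential part forms a closed oscillating system.
  have hgw : g =O[atTop] gw := by
    refine isBigO_of_add_small (e := fun r =>
      ∑ α, (|Y α r 0 0| + ∑ j : Fin 3, |Y α r 0 j.succ| + ∑ i : Fin 3, |Y α r i.succ 0|) +
      ∑ α, (|Y1 α r 0 0| + ∑ j : Fin 3, |Y1 α r 0 j.succ| + ∑ i : Fin 3, |Y1 α r i.succ 0|))
      (funext fun r => ?_) ?_
    · simp only [g, gw, w, w1, J, Fintype.sum_prod_type, Fin.sum_univ_succ (n := 3),
        Finset.sum_add_distrib]
      ring
    · have n0 : ∀ {f : ℝ → ℝ}, f =O[atTop] (fun r => r⁻¹ * g r) →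
          (fun r => |f r|) =O[atTop] fun r => r⁻¹ * g r := fun hf => hf.norm_left
      exact (IsBigO.fun_sum fun α _ => ((n0 (hr0 α 0)).add (IsBigO.fun_sum fun j _ =>
        n0 (hr0 α _))).add (IsBigO.fun_sum fun j _ => n0 (hs0 α _))).add
        (IsBigO.fun_sum fun α _ => ((n0 (hr1 α 0)).add (IsBigO.fun_sum fun j _ =>
        n0 (hr1 α _))).add (IsBigO.fun_sum fun j _ => n0 (hs1 α _)))
  have hE : (fun r => ∑ p : J, |w2 p r + 3 * I.kap * w1 p r + lam * w p r|) =O[atTop]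
      fun r => r⁻¹ * gw r := by
    refine (IsBigO.fun_sum fun p _ => ?_).trans ((isBigO_refl (fun r : ℝ => r⁻¹) atTop).mul hgw)
    exact (h.isBigO_tangential h0 h1 hlam p.1 p.2.1 p.2.2).norm_left
  obtain ⟨C1, hC1, b1⟩ := hE.exists_nonneg
  obtain ⟨C2, hC2, b2⟩ := I.isBigO_sA.exists_nonneg
  obtain ⟨C3, b3⟩ := hgw.bound
  have b4 := I.analyticAtInf_sA_div.isBigO.trans_isLittleO
    ((isLittleO_one_iff ℝ).2 tendsto_inv_atTop_zero)
  have b5 := b4.bound (show 0 < I.kap / 2 by positivity)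
  have hgood : ∀ᶠ r in atTop, I.rPlus + 1 < r ∧ 0 < r ∧ I.kap / 2 * r ≤ I.sA r ∧
      I.sA r ≤ 2 * I.kap * r ∧ |I.sA r - I.kap * r| ≤ C1 + C2 ∧
      ∑ p : J, |w2 p r + 3 * I.kap * w1 p r + lam * w p r| ≤ (C1 + C2) / r * gw r ∧
      g r ≤ C3 * gw r := by
    filter_upwards [eventually_gt_atTop (I.rPlus + 1), eventually_gt_atTop 0, b1.bound, b2.bound,
      b3, b5] with r e1 e2 e3 e4 e5 e6
    have hgw0 : 0 ≤ gw r := Finset.sum_nonneg fun p _ => add_nonneg (abs_nonneg _) (abs_nonneg _)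
    rw [Real.norm_eq_abs, norm_one, mul_one] at e6
    have e7 := abs_le.1 e6
    have e8 : I.sA r / r * r = I.sA r := by field_simp
    rw [Real.norm_eq_abs, norm_one, mul_one] at e4
    rw [Real.norm_of_nonneg (Finset.sum_nonneg fun p _ => abs_nonneg _), Real.norm_of_nonneg
      (by positivity)] at e3
    rw [Real.norm_of_nonneg hgw0, Real.norm_of_nonneg (add_nonneg (hpos Y r) (hpos Y1 r))] at e5
    refine ⟨e1, e2, ?_, ?_, by linarith, e3.trans ?_, e5⟩
    · rw [← e8]
      exact mul_le_mul_of_nonneg_right (by linarith) e2.le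
    · rw [← e8]
      exact mul_le_mul_of_nonneg_right (by linarith) e2.le
    · have : (C1 + C2) / r * gw r = C1 * (r⁻¹ * gw r) + C2 / r * gw r := by
        field_simp
      rw [this]
      have : 0 ≤ C2 / r * gw r := by positivity
      linarith
  obtain ⟨R, hR⟩ := eventually_atTop.1 hgood
  filter_upwards [eventually_ge_atTop R] with R0 hR0
  have hRR : ∀ r, R0 ≤ r → R ≤ r := fun r hr => hR0.trans hr
  have hp : ∀ r, R0 ≤ r → I.rPlus < r := fun r hr => by
    have := (hR r (hRR r hr)).1
    linarith
  have hz := eq_zero_of_oscillating (w := w) (w1 := w1) (w2 := w2) (a := I.sA) (C := C1 + C2)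
    hk hlam (hR R0 hR0).2.1 (by positivity) (fun r hr => (hR r (hRR r hr)).2.2.1)
    (fun r hr => (hR r (hRR r hr)).2.2.2.1) (fun r hr => (hR r (hRR r hr)).2.2.2.2.1)
    (fun p r hr => h.hasDerivAt _ _ _ r (hp r hr)) (fun p r hr => h.hasDerivAt_one _ _ _ r (hp r hr))
    (fun p r hr => (Finset.single_le_sum
      (f := fun p => |w2 p r + 3 * I.kap * w1 p r + lam * w p r|)
      (fun p _ => abs_nonneg _) (Finset.mem_univ p)).trans (hR r (hRR r hr)).2.2.2.2.2.1)
    (fun p => (hL _ _ _).mono_set (Set.Ioi_subset_Ioi (hR R0 hR0).1.le))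
  have hgw0 : gw R0 = 0 := Finset.sum_eq_zero fun p _ => by simp [hz p]
  have hg0 : g R0 = 0 := by
    have e1 := (hR R0 hR0).2.2.2.2.2.2
    rw [hgw0, mul_zero] at e1
    exact le_antisymm e1 (add_nonneg (hpos Y R0) (hpos Y1 R0))
  have hall : ∀ Z : ι → ℝ → M4, ∑ α, ∑ i, ∑ j, |Z α R0 i j| = 0 → ∀ α, Z α R0 = 0 :=
    fun Z hZ α => by
    ext i j
    rw [Finset.sum_eq_zero_iff_of_nonneg fun α _ => Finset.sum_nonneg fun i _ =>
      Finset.sum_nonneg fun j _ => abs_nonneg _] at hZ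
    have e1 := hZ α (Finset.mem_univ α)
    rw [Finset.sum_eq_zero_iff_of_nonneg fun i _ => Finset.sum_nonneg fun j _ => abs_nonneg _] at e1
    have e2 := e1 i (Finset.mem_univ i)
    rw [Finset.sum_eq_zero_iff_of_nonneg fun j _ => abs_nonneg _] at e2
    exact abs_eq_zero.1 (e2 j (Finset.mem_univ j))
  obtain ⟨z1, z2⟩ := (add_eq_zero_iff_of_nonneg (hpos Y R0) (hpos Y1 R0)).1 hg0
  exact fun α => ⟨hall Y z1 α, hall Y1 z2 α⟩

/-- Uniqueness for the initial value problem. -/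
lemma eq_zero_of_eq_zero {a b : ℝ} (ha : I.rPlus < a) (hab : a ≤ b)
    (hb : ∀ α, Y α b = 0 ∧ Y1 α b = 0) (α : ι) : Y α a = 0 := by
  -- On this compact interval away from r_+ all coefficients, and 1/a, are bounded.
  set K := Set.Icc a b with hK
  have hKs : K ⊆ Set.Ioi I.rPlus := fun r hr => ha.trans_le hr.1
  have hKc : IsCompact K := isCompact_Icc
  have bd : ∀ {f : ℝ → ℝ}, ContinuousOn f (Set.Ioi I.rPlus) → f =O[𝓟 K] fun _ => (1 : ℝ) :=
    fun hf => (hf.mono hKs).isBigO_principal hKc (by simp)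
  have hconn : ∀ c i j, ContinuousOn (fun r => I.conn c r i j) (Set.Ioi I.rPlus) :=
    fun c i j => (I.contDiffOn_conn c i j).continuousOn
  have hconnD : ∀ c i j, ContinuousOn (fun r => I.connD c r i j) (Set.Ioi I.rPlus) :=
    fun c i j => I.contDiffOn_sA.continuousOn.mul
      ((I.contDiffOn_conn c i j).continuousOn_deriv_of_isOpen isOpen_Ioi (by simp))
  have hcurv : ∀ p q i j, ContinuousOn (fun r => I.curv p q r i j) (Set.Ioi I.rPlus) := by
    intro p q i j
    have e1 : ∀ p q : Fin 4, ContinuousOn (fun r => (if p = 0 then I.connD q r else 0 : M4) i j)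
        (Set.Ioi I.rPlus) := fun p q => by
      split_ifs
      · exact hconnD q i j
      · exact continuousOn_const
    simp only [curv, Matrix.add_apply, Matrix.sub_apply, Matrix.sum_apply, Matrix.smul_apply,
      Matrix.mul_apply, smul_eq_mul]
    refine ContinuousOn.sub (ContinuousOn.add (ContinuousOn.sub ((e1 p q).sub (e1 q p))
      (continuousOn_finsetSum _ fun c _ => ?_)) (continuousOn_finsetSum _ fun c _ => ?_))
      (continuousOn_finsetSum _ fun c _ => ?_)
    · exact ((hconn p q c).sub (hconn q p c)).mul (hconn c i j)
    · exact (hconn q i c).mul (hconn p c j)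
    · exact (hconn p i c).mul (hconn q c j)
  -- Grönwall backwards: |n'| ≤ C n on K makes n(t) exp(Ct) increasing there, so its vanishing at b
  -- forces it to vanish at a.
  let n : ℝ → ℝ := fun r => ∑ α, ∑ i, ∑ j, (Y α r i j ^ 2 + Y1 α r i j ^ 2)
  let n' : ℝ → ℝ := fun r => ∑ α, ∑ i, ∑ j, (2 * Y α r i j * (Y1 α r i j / I.sA r) +
    2 * Y1 α r i j * (Y2 α r i j / I.sA r))
  have hn : ∀ r, I.rPlus < r → HasDerivAt n (n' r) r := fun r hr => by
    refine HasDerivAt.fun_sum fun α _ => HasDerivAt.fun_sum fun i _ => HasDerivAt.fun_sum fun j _ => ?_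
    refine (((h.hasDerivAt α i j r hr).fun_pow 2).fun_add
      ((h.hasDerivAt_one α i j r hr).fun_pow 2)).congr_deriv ?_
    push_cast
    ring
  have hn0 : ∀ r, 0 ≤ n r := fun r => Finset.sum_nonneg fun α _ => Finset.sum_nonneg fun i _ =>
    Finset.sum_nonneg fun j _ => by positivity
  have hle : ∀ α i j r, Y α r i j ^ 2 + Y1 α r i j ^ 2 ≤ n r := fun α i j r =>
    ((Finset.single_le_sum (f := fun j => Y α r i j ^ 2 + Y1 α r i j ^ 2)
      (fun j _ => by positivity) (Finset.mem_univ j)).trans (Finset.single_le_sum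
      (f := fun i => ∑ j, (Y α r i j ^ 2 + Y1 α r i j ^ 2)) (fun i _ => Finset.sum_nonneg
      fun j _ => by positivity) (Finset.mem_univ i))).trans (Finset.single_le_sum
      (f := fun α => ∑ i, ∑ j, (Y α r i j ^ 2 + Y1 α r i j ^ 2)) (fun α _ => Finset.sum_nonneg
      fun i _ => Finset.sum_nonneg fun j _ => by positivity) (Finset.mem_univ α))
  have h0 : ∀ α i j, (fun r => Y α r i j) =O[𝓟 K] fun r => √(n r) := fun α i j =>
    IsBigO.of_bound 1 (Eventually.of_forall fun r => by
      rw [one_mul, Real.norm_of_nonneg (Real.sqrt_nonneg _)]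
      exact Real.abs_le_sqrt (by nlinarith [hle α i j r]))
  have h1 : ∀ α i j, (fun r => Y1 α r i j) =O[𝓟 K] fun r => √(n r) := fun α i j =>
    IsBigO.of_bound 1 (Eventually.of_forall fun r => by
      rw [one_mul, Real.norm_of_nonneg (Real.sqrt_nonneg _)]
      exact Real.abs_le_sqrt (by nlinarith [hle α i j r]))
  have hκ : I.κtr =O[𝓟 K] fun _ => (1 : ℝ) :=
    bd ((I.contDiffOn_κ1.continuousOn.const_smul (2 : ℝ)).add I.contDiffOn_κ3.continuousOn)
  have h2 : ∀ α i j, (fun r => Y2 α r i j) =O[𝓟 K] fun r => √(n r) := fun α i j => by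
    have e1 := isBigO_orderZero (I := I) X (fun c => bd (I.contDiffOn_invb c).continuousOn)
      (fun c i j => bd (hconn c i j)) (fun p q i j => bd (hcurv p q i j)) h0 α i j
    have e2 := hκ.mul (h1 α i j)
    simp only [one_mul] at e2
    refine IsBigO.congr' ((e2.add e1).add ((h0 α i j).const_mul_left lam)).neg_left
      (?_ : _ =ᶠ[𝓟 K] _) EventuallyEq.rfl
    filter_upwards [mem_principal_self K] with r hr
    have e := congrFun (congrFun (h.eigen α r (hKs hr)) i) j
    simp only [Matrix.add_apply, Matrix.smul_apply, smul_eq_mul, Matrix.zero_apply] at e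
    linear_combination -e
  have hs : (fun r => (I.sA r)⁻¹) =O[𝓟 K] fun _ => (1 : ℝ) :=
    bd (I.contDiffOn_sA.continuousOn.inv₀ fun r hr => (I.sA_pos hr).ne')
  have hn' : n' =O[𝓟 K] n := by
    have e0 : ∀ {u v : ℝ → ℝ}, u =O[𝓟 K] (fun r => √(n r)) → v =O[𝓟 K] (fun r => √(n r)) →
        (fun r => 2 * u r * (v r / I.sA r)) =O[𝓟 K] n := fun hu hv => by
      have e1 := (hu.const_mul_left 2).mul (hv.mul hs)
      simp only [mul_one, Real.mul_self_sqrt (hn0 _)] at e1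
      simpa only [div_eq_mul_inv] using e1
    exact IsBigO.fun_sum fun α _ => IsBigO.fun_sum fun i _ => IsBigO.fun_sum fun j _ =>
      (e0 (h0 α i j) (h1 α i j)).add (e0 (h1 α i j) (h2 α i j))
  obtain ⟨C, hC⟩ := isBigO_principal.1 hn'
  have hd : ∀ r, I.rPlus < r → HasDerivAt (fun t => n t * Real.exp (C * t))
      (n' r * Real.exp (C * r) + n r * (Real.exp (C * r) * C)) r := fun r hr => by
    refine (hn r hr).mul ?_
    have := ((hasDerivAt_id r).const_mul C).exp
    simpa using this
  have hm : MonotoneOn (fun t => n t * Real.exp (C * t)) K := by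
    refine monotoneOn_of_deriv_nonneg (convex_Icc a b)
      (fun r hr => (hd r (hKs hr)).continuousAt.continuousWithinAt) ?_ ?_
    · intro r hr
      exact (hd r (hKs (interior_subset hr))).differentiableAt.differentiableWithinAt
    · intro r hr
      have hr' := interior_subset hr
      rw [(hd r (hKs hr')).deriv]
      have e1 := hC r hr'
      rw [Real.norm_eq_abs, Real.norm_of_nonneg (hn0 r)] at e1
      have e2 := (abs_le.1 e1).1
      have e3 : n' r * Real.exp (C * r) + n r * (Real.exp (C * r) * C) =
        (n' r + C * n r) * Real.exp (C * r) := by ring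
      rw [e3]
      exact mul_nonneg (by linarith) (Real.exp_pos _).le
  have hnb : n b = 0 := by simp [n, hb]
  have e1 := hm (Set.left_mem_Icc.2 hab) (Set.right_mem_Icc.2 hab) hab
  simp only [hnb, zero_mul] at e1
  have hna : n a = 0 := le_antisymm (nonpos_of_mul_nonpos_left e1 (Real.exp_pos _)) (hn0 a)
  ext i j
  have e2 := hle α i j a
  rw [hna] at e2
  have e3 : Y α a i j ^ 2 = 0 := le_antisymm (by nlinarith [sq_nonneg (Y1 α a i j)]) (sq_nonneg _)
  simpa using e3

/-- A square-integrable solution vanishes. -/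
theorem eq_zero (hlam : 9 / 4 * I.kap ^ 2 < lam)
    (hL : ∀ α i j, IntegrableOn (fun r => r ^ 2 * Y α r i j ^ 2) (Set.Ioi (I.rPlus + 1)))
    {r : ℝ} (hr : I.rPlus < r) (α : ι) : Y α r = 0 := by
  obtain ⟨b, hb, hrb⟩ := ((h.eventually_eq_zero hlam hL).and (eventually_ge_atTop r)).exists
  exact h.eq_zero_of_eq_zero hr hrb hb α

end RadialSystem

end Instanton

end AdSTaubNUT

end

noncomputable section

namespace AdSTaubNUT

open Matrix

/-! ### Moments of fields of matrices -/

/-- Entrywise continuity on the dense chart. -/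
def MCont (F : Pt → M4) : Prop := ∀ i j, ContinuousOn (fun x => F x i j) dense

/-- Entrywise moments over spheres. -/
def mmom (F : Pt → M4) (P : Pt → ℝ) (s : ℝ) : M4 := Matrix.of fun i j => mom (fun x => F x i j) P s

section mmom

variable {F G : Pt → M4} {P : Pt → ℝ} {s : ℝ}

lemma mmom_congr (h : ∀ q, F (ray s q) = G (ray s q)) : mmom F P s = mmom G P s := by
  ext i j
  exact mom_congr (f := fun x => F x i j) (g := fun x => G x i j) fun q => by simp only [h q]

lemma mmom_add (hF : MCont F) (hG : MCont G) (hP : Continuous P) (hs : 0 < s) :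
    mmom (fun x => F x + G x) P s = mmom F P s + mmom G P s := by
  ext i j
  exact mom_add (hF i j) (hG i j) hP hs

lemma mmom_smul (c : ℝ) : mmom (fun x => c • F x) P s = c • mmom F P s := by
  ext i j
  exact mom_const_mul c (fun x => F x i j) P s

lemma mmom_sum {ι : Type*} (t : Finset ι) {F : ι → Pt → M4} (hF : ∀ i, MCont (F i))
    (hP : Continuous P) (hs : 0 < s) :
    mmom (fun x => ∑ i ∈ t, F i x) P s = ∑ i ∈ t, mmom (F i) P s := by
  ext i j
  simp only [mmom, Matrix.of_apply, Matrix.sum_apply]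
  exact mom_sum t (fun k => hF k i j) hP hs

lemma mmom_zero : mmom (fun _ => 0) P s = 0 := by
  ext i j
  simp [mmom, mom]

lemma MCont.add (hF : MCont F) (hG : MCont G) : MCont fun x => F x + G x := fun i j =>
  (hF i j).add (hG i j)

lemma MCont.smul (hF : MCont F) (c : ℝ) : MCont fun x => c • F x := fun i j =>
  (hF i j).const_smul c

lemma linear_apply_eq (T : M4 →ₗ[ℝ] M4) (M : M4) (i j : Fin 4) :
    T M i j = ∑ a, ∑ b, T (Matrix.single a b 1) i j * M a b := by
  conv_lhs => rw [Matrix.matrix_eq_sum_single M]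
  simp only [map_sum, Matrix.sum_apply]
  refine Finset.sum_congr rfl fun a _ => Finset.sum_congr rfl fun b _ => ?_
  have : Matrix.single a b (M a b) = M a b • Matrix.single a b (1 : ℝ) := by
    rw [Matrix.smul_single, smul_eq_mul, mul_one]
  rw [this, map_smul, Matrix.smul_apply, smul_eq_mul, mul_comm]

lemma MCont.linear (hF : MCont F) (T : M4 →ₗ[ℝ] M4) : MCont fun x => T (F x) := fun i j => by
  simp only [fun x => linear_apply_eq T (F x)]
  exact continuousOn_finsetSum _ fun a _ => continuousOn_finsetSum _ fun b _ =>
    continuousOn_const.mul (hF a b)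

lemma mmom_linear (T : M4 →ₗ[ℝ] M4) (hF : MCont F) (hP : Continuous P) (hs : 0 < s) :
    mmom (fun x => T (F x)) P s = T (mmom F P s) := by
  ext i j
  have h1 : ∀ a b, ContinuousOn (fun x => T (Matrix.single a b 1) i j * F x a b) dense :=
    fun a b => continuousOn_const.mul (hF a b)
  rw [linear_apply_eq T (mmom F P s)]
  simp only [mmom, Matrix.of_apply, fun x => linear_apply_eq T (F x)]
  rw [mom_sum Finset.univ (fun a => continuousOn_finsetSum _ fun b _ => h1 a b) hP hs]
  refine Finset.sum_congr rfl fun a _ => ?_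
  rw [mom_sum Finset.univ (fun b => h1 a b) hP hs]
  exact Finset.sum_congr rfl fun b _ => mom_const_mul _ _ P s

end mmom

namespace Instanton

variable (I : Instanton)

/-- `act` as a linear map. -/
def actL (c : Fin 4) (r : ℝ) : M4 →ₗ[ℝ] M4 :=
  LinearMap.mulLeft ℝ (I.conn c r) - LinearMap.mulRight ℝ (I.conn c r)

lemma actL_apply (c : Fin 4) (r : ℝ) (M : M4) : I.actL c r M = I.act c r M := rfl

/-- `curvAct` as a linear map. -/
def curvActL (r : ℝ) : M4 →ₗ[ℝ] M4 where
  toFun := I.curvAct r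
  map_add' M N := by
    ext i j
    simp [curvAct, mul_add, Finset.sum_add_distrib]
  map_smul' t M := by
    ext i j
    simp only [curvAct, Matrix.of_apply, Matrix.smul_apply, smul_eq_mul, Finset.mul_sum,
      RingHom.id_apply]
    exact Finset.sum_congr rfl fun a _ => Finset.sum_congr rfl fun b _ => by ring

lemma curvActL_apply (r : ℝ) (M : M4) : I.curvActL r M = I.curvAct r M := rfl

variable {I}

lemma mom_dirD {f P : Pt → ℝ} {s : ℝ} (hs : 0 < s) :
    mom (dirD I.fr 0 f) P s = I.sA (I.rPlus + s) * mom (radD f) P s := by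
  rw [← mom_const_mul]
  refine mom_congr fun q => ?_
  simp only [dirD, radD, fr_apply, rad_ray I hs.le, normSq_ray hs.le, Finset.mul_sum]
  refine Finset.sum_congr rfl fun k _ => ?_
  have h1 : I.frad 0 (I.rPlus + s) = I.sA (I.rPlus + s) / (2 * s) := by
    simp [frad]
  have h2 : wMat (ray s q) 0 k = ray s q k := rfl
  rw [h1, h2]
  ring

lemma hasDerivAt_mmom {F : Pt → M4} {P : Pt → ℝ} (hF : ∀ i j, ContDiffOn ℝ 1 (fun x => F x i j) dense)
    (hP : Continuous P) (i j : Fin 4) {r : ℝ} (hr : I.rPlus < r) :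
    HasDerivAt (fun t => mmom F P (t - I.rPlus) i j)
      (mmom (mdirD I.fr 0 F) P (r - I.rPlus) i j / I.sA r) r := by
  have hs : 0 < r - I.rPlus := sub_pos.2 hr
  have h1 := (hasDerivAt_mom (hF i j) hP hs).comp_sub_const r I.rPlus
  refine h1.congr_deriv ?_
  have h2 : mmom (mdirD I.fr 0 F) P (r - I.rPlus) i j =
      mom (dirD I.fr 0 fun x => F x i j) P (r - I.rPlus) := by
    simp only [mmom, Matrix.of_apply, mdirD_apply]
  rw [h2, mom_dirD hs, add_sub_cancel, mul_div_cancel_left₀ _ (I.sA_pos hr).ne']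

lemma mmom_mxD {F : Pt → M4} (hF : ∀ i j, ContDiffOn ℝ 1 (fun x => F x i j) dense) {k : ℕ}
    {L : (Fin k → Fin 4) → (Fin k → Fin 4) → ℝ} {c : Fin 4} (hc : c ≠ 0)
    (hL : ∀ α x, xD c (word α) x = ∑ β, L α β * word β x) (α : Fin k → Fin 4) {s : ℝ}
    (hs : 0 < s) :
    mmom (mxD c F) (word α) s = mix (fun α β => -L α β) (fun β => mmom F (word β) s) α := by
  ext i j
  have h1 : mmom (mxD c F) (word α) s i j = mom (xD c fun x => F x i j) (word α) s := by
    simp only [mmom, Matrix.of_apply, mxD_apply]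
  have h2 : xD c (word α) = fun x => ∑ β, L α β * word β x := funext (hL α)
  rw [h1, mom_xD (hF i j) ((contDiff_word α).of_le le_top) hc hs, h2,
    mom_sum_right _ _ (hF i j).continuousOn (fun β => (contDiff_word β).continuous) hs]
  simp [mix, Matrix.sum_apply, mmom]

/-- The moments of an eigentensor are a solution of the radial system. -/
lemma exists_radialSystem {h : Field} {lam : ℝ} (hh : I.IsC2 h) (ht : I.IsTT h)
    (he : ∀ x ∈ dense, modLich I.metric h x = lam • h x) (k : ℕ) :
    ∃ X, RadialSystem I lam X
      (fun (α : Fin k → Fin 4) r => mmom (frameMat I.fr h) (word α) (r - I.rPlus))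
      (fun α r => mmom (mdirD I.fr 0 (frameMat I.fr h)) (word α) (r - I.rPlus))
      (fun α r => mmom (mdirD I.fr 0 (mdirD I.fr 0 (frameMat I.fr h))) (word α)
        (r - I.rPlus)) := by
  choose L hL using exists_xD_word k
  have hH := hh.mc2
  set H := frameMat I.fr h with hHd
  have hH1 : ∀ i j, ContDiffOn ℝ 1 (fun x => H x i j) dense := fun i j =>
    (hH.cd i j).of_le (by norm_num)
  have c0 : MCont H := fun i j => (hH.cd i j).continuousOn
  have c1 : MCont (mdirD I.fr 0 H) := fun i j => (hH.contDiffOn_mdirD 0 i j).continuousOn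
  have c2 : MCont (mdirD I.fr 0 (mdirD I.fr 0 H)) := fun i j => by
    simp only [mdirD_apply I.fr, dirD]
    exact continuousOn_finsetSum _ fun k _ => (I.smooth_fr 0 k).continuousOn.mul
      (continuousOn_pd (by simpa only [mdirD_apply, dirD] using hH.contDiffOn_mdirD 0 i j) k)
  have c3 : ∀ c, MCont (mxD c H) := fun c i j => (hH.contDiffOn_mxD c i j).continuousOn
  have c4 : ∀ c, MCont (mxD c (mxD c H)) := fun c i j => by
    simp only [mxD_apply c (mxD c H)]
    exact continuousOn_xD (hH.contDiffOn_mxD c i j) c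
  have hP : ∀ α : Fin k → Fin 4, Continuous (word α) := fun α => (contDiff_word α).continuous
  have hb0 : ∀ r, I.invb 0 r = 0 := fun r => rfl
  -- The sign comes from integration by parts on the spheres. The entry c = 0 plays no role, because
  -- `invb 0` is zero.
  set X : Fin 4 → (Fin k → Fin 4) → (Fin k → Fin 4) → ℝ := fun c α β => -L c α β with hX
  have hm1 : ∀ c α r, I.rPlus < r → I.invb c r • mmom (mxD c H) (word α) (r - I.rPlus) =
      I.invb c r • mix (X c) (fun β => mmom H (word β) (r - I.rPlus)) α := fun c α r hr => by
    by_cases hc : c = 0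
    · rw [hc, hb0, zero_smul, zero_smul]
    · rw [mmom_mxD hH1 hc (hL c) α (sub_pos.2 hr)]
  have hm2 : ∀ c α r, I.rPlus < r → I.invb c r ^ 2 • mmom (mxD c (mxD c H)) (word α) (r - I.rPlus) =
      I.invb c r ^ 2 • mix (X c) (mix (X c) fun β => mmom H (word β) (r - I.rPlus)) α :=
    fun c α r hr => by
    by_cases hc : c = 0
    · rw [hc, hb0, sq, zero_mul, zero_smul, zero_smul]
    · rw [mmom_mxD (hH.contDiffOn_mxD c) hc (hL c) α (sub_pos.2 hr)]
      have : (fun β => mmom (mxD c H) (word β) (r - I.rPlus)) =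
          mix (X c) fun β => mmom H (word β) (r - I.rPlus) :=
        funext fun β => mmom_mxD hH1 hc (hL c) β (sub_pos.2 hr)
      rw [this]
  refine ⟨X, ⟨fun α i j r hr => hasDerivAt_mmom hH1 (hP α) i j hr,
    fun α i j r hr => hasDerivAt_mmom (hH.contDiffOn_mdirD 0) (hP α) i j hr,
    fun α r hr => ?_, fun α r hr => ?_, fun α r hr => ?_, fun α r hr Q => ?_⟩⟩
  · have hs := sub_pos.2 hr
    ext i j
    change mom (fun x => H x j i) _ _ = mom (fun x => H x i j) _ _
    refine mom_congr fun q => ?_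
    have h1 : ∀ a b, h (ray (r - I.rPlus) q) a b = h (ray (r - I.rPlus) q) b a :=
      (ht _ (ray_mem hs q)).1
    have h2 : (Matrix.of (h (ray (r - I.rPlus) q)))ᵀ = Matrix.of (h (ray (r - I.rPlus) q)) := by
      ext a b
      exact h1 b a
    have h3 : (H (ray (r - I.rPlus) q))ᵀ = H (ray (r - I.rPlus) q) := by
      simp only [hHd, frameMat, Matrix.transpose_mul, Matrix.transpose_transpose, h2,
        Matrix.mul_assoc]
    exact congrFun (congrFun h3 i) j
  · have hs := sub_pos.2 hr
    have h1 : (mmom H (word α) (r - I.rPlus)).trace =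
        mom (fun x => ∑ i, H x i i) (word α) (r - I.rPlus) :=
      (mom_sum Finset.univ (fun i => c0 i i) (hP α) hs).symm
    rw [h1]
    have h2 : mom (fun x => ∑ i, H x i i) (word α) (r - I.rPlus) =
        mom (fun _ => 0) (word α) (r - I.rPlus) := mom_congr fun q => by
      rw [← (ht _ (ray_mem hs q)).2.1, I.isFrame.frame_trace (ray_mem hs q)]
    rw [h2]
    simp [mom]
  · have hs := sub_pos.2 hr
    set s := r - I.rPlus with hsd
    have hrs : ∀ q, I.rad (ray s q) = r := fun q => by
      rw [rad_ray I hs.le, hsd]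
      ring
    let A : Fin 4 → Pt → M4 := fun c x => I.invb c r ^ 2 • mxD c (mxD c H) x +
      (-(2 * I.invb c r)) • I.actL c r (mxD c H x) + I.actL c r (I.actL c r (H x))
    have hA1 : ∀ c, MCont fun x => I.invb c r ^ 2 • mxD c (mxD c H) x +
        (-(2 * I.invb c r)) • I.actL c r (mxD c H x) := fun c =>
      ((c4 c).smul _).add (((c3 c).linear _).smul _)
    have hA : ∀ c, MCont (A c) := fun c => (hA1 c).add ((c0.linear _).linear _)
    have eA : ∀ c, mmom (A c) (word α) s =
        I.invb c r ^ 2 • mix (X c) (mix (X c) fun β => mmom H (word β) s) α -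
        (2 * I.invb c r) • I.act c r (mix (X c) (fun β => mmom H (word β) s) α) +
        I.act c r (I.act c r (mmom H (word α) s)) := fun c => by
      rw [mmom_add (hA1 c) ((c0.linear _).linear _) (hP α) hs,
        mmom_add ((c4 c).smul _) (((c3 c).linear _).smul _) (hP α) hs, mmom_smul, mmom_smul,
        mmom_linear _ (c3 c) (hP α) hs, mmom_linear _ (c0.linear _) (hP α) hs,
        mmom_linear _ c0 (hP α) hs, hm2 c α r hr]
      have h1 := congrArg (fun M => (2 : ℝ) • I.actL c r M) (hm1 c α r hr)
      simp only [map_smul, smul_smul] at h1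
      rw [neg_smul, h1, ← sub_eq_add_neg]
      rfl
    have hS : MCont fun x => ∑ c, A c x := fun i j => by
      simp only [Matrix.sum_apply]
      exact continuousOn_finsetSum _ fun c _ => hA c i j
    have hZ : MCont fun x => ∑ c, A c x + (2 : ℝ) • I.curvActL r (H x) :=
      hS.add ((c0.linear _).smul _)
    have h1 : mmom (fun x => mdirD I.fr 0 (mdirD I.fr 0 H) x + I.κtr r • mdirD I.fr 0 H x +
        (∑ c, A c x + (2 : ℝ) • I.curvActL r (H x)) + lam • H x) (word α) s =
        mmom (fun _ => 0) (word α) s := mmom_congr fun q => by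
      have h2 := frameMat_modLich hh hH (ray_mem hs q)
      have h3 : frameMat I.fr (modLich I.metric h) (ray s q) = lam • H (ray s q) := by
        simp only [hHd, frameMat, he _ (ray_mem hs q)]
        have : Matrix.of (lam • h (ray s q)) = lam • Matrix.of (h (ray s q)) := rfl
        rw [this, Matrix.mul_smul, Matrix.smul_mul]
      rw [h3, hrs, ← hHd] at h2
      rw [h2]
      simp only [A, actL_apply, curvActL_apply, Finset.sum_add_distrib, Finset.sum_sub_distrib,
        neg_smul, Finset.sum_neg_distrib]
      module
    rw [mmom_zero, mmom_add ((c2.add (c1.smul _)).add hZ) (c0.smul _) (hP α) hs,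
      mmom_add (c2.add (c1.smul _)) hZ (hP α) hs, mmom_add c2 (c1.smul _) (hP α) hs,
      mmom_add hS ((c0.linear _).smul _) (hP α) hs, mmom_sum _ hA (hP α) hs, mmom_smul, mmom_smul,
      mmom_smul, mmom_linear _ c0 (hP α) hs] at h1
    simp only [eA] at h1
    exact h1
  · have hs := sub_pos.2 hr
    set s := r - I.rPlus with hsd
    have hrs : ∀ q, I.rad (ray s q) = r := fun q => by
      rw [rad_ray I hs.le, hsd]
      ring
    let A : Fin 4 → Pt → M4 := fun c x => I.invb c r • mxD c H x + (-1 : ℝ) • I.actL c r (H x)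
    have hA : ∀ c, MCont (A c) := fun c => ((c3 c).smul _).add ((c0.linear _).smul _)
    have eA : ∀ c, mmom (A c) (word α) s =
        I.invb c r • mix (X c) (fun β => mmom H (word β) s) α - I.act c r (mmom H (word α) s) :=
      fun c => by
      rw [mmom_add ((c3 c).smul _) ((c0.linear _).smul _) (hP α) hs, mmom_smul, mmom_smul,
        mmom_linear _ c0 (hP α) hs, hm1 c α r hr, neg_one_smul, ← sub_eq_add_neg]
      rfl
    have h1 : mom (fun x => mdirD I.fr 0 H x 0 Q + ∑ c, A c x c Q) (word α) s =
        mom (fun _ => 0) (word α) s := mom_congr fun q => by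
      have h2 := frame_divergence_eq hh (ray_mem hs q) Q
      simp only [(ht _ (ray_mem hs q)).2.2, mul_zero, Finset.sum_const_zero, hrs, ← hHd] at h2
      rw [h2]
      congr 1
      refine Finset.sum_congr rfl fun c _ => ?_
      simp only [A, Matrix.add_apply, Matrix.smul_apply, smul_eq_mul, actL_apply]
      ring
    rw [mom_add (c1 0 Q) (continuousOn_finsetSum _ fun c _ => hA c c Q) (hP α) hs,
      mom_sum _ (fun c => hA c c Q) (hP α) hs] at h1
    have h2 : ∀ c, mom (fun x => A c x c Q) (word α) s = (I.invb c r • mix (X c)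
        (fun β => mmom H (word β) s) α - I.act c r (mmom H (word α) s)) c Q := fun c => by
      rw [← eA c]
      rfl
    simp only [h2, Matrix.sub_apply, Matrix.smul_apply, smul_eq_mul] at h1
    refine Eq.trans h1 ?_
    simp [mom]

end Instanton

end AdSTaubNUT

end

/-! ### Absence of square-integrable eigentensors -/

noncomputable section

namespace AdSTaubNUT

open Matrix

namespace Instanton

variable {I : Instanton}

/-- The moments of a square-integrable function are square-integrable. -/
lemma integrableOn_sq_mom {f : Pt → ℝ} (hf : ContDiffOn ℝ 1 f dense)
    (hL : ∫⁻ x, ENNReal.ofReal (f x ^ 2) ∂I.vol < ⊤) {k : ℕ} (α : Fin k → Fin 4) :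
    IntegrableOn (fun r => r ^ 2 * mom f (word α) (r - I.rPlus) ^ 2) (Set.Ioi (I.rPlus + 1)) := by
  have hN := I.N_pos
  have hNr := I.N_le_rPlus
  rw [lintegral_vol I (f := fun x => f x ^ 2) (hf.continuousOn.pow 2)] at hL
  set V := sph.real Set.univ
  have hV : 0 ≤ V := measureReal_nonneg
  -- B/r² = 1 - N²/r² increases with r; c is its value at r_+ + 1, positive since N ≤ r_+. At r_+
  -- itself B vanishes in the case of a nut.
  set c := 1 - I.N ^ 2 / (I.rPlus + 1) ^ 2 with hc
  have hc0 : 0 < c := by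
    rw [hc, sub_pos, div_lt_one (by nlinarith)]
    nlinarith
  have hB : ∀ r, I.rPlus + 1 < r → c * r ^ 2 ≤ I.B r := fun r hr => by
    have h1 : (I.rPlus + 1) ^ 2 ≤ r ^ 2 := by nlinarith
    have h2 : I.N ^ 2 ≤ I.N ^ 2 / (I.rPlus + 1) ^ 2 * r ^ 2 := by
      rw [div_mul_eq_mul_div, le_div_iff₀ (by nlinarith)]
      exact mul_le_mul_of_nonneg_left h1 (sq_nonneg _)
    rw [hc, B]
    linarith
  have hcont : ContinuousOn (fun r => r ^ 2 * mom f (word α) (r - I.rPlus) ^ 2)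
      (Set.Ioi (I.rPlus + 1)) := by
    intro r hr
    have hs : 0 < r - I.rPlus := by
      have := Set.mem_Ioi.1 hr
      linarith
    have h1 : ContinuousAt (fun t => mom f (word α) (t - I.rPlus)) r :=
      ((hasDerivAt_mom hf (contDiff_word α).continuous hs).comp_sub_const r I.rPlus).continuousAt
    exact ((continuousAt_id.pow 2).mul (h1.pow 2)).continuousWithinAt
  refine ⟨hcont.aestronglyMeasurable measurableSet_Ioi, ?_⟩
  rw [hasFiniteIntegral_iff_ofReal (Filter.Eventually.of_forall fun r => by positivity)]
  have hle : ∀ r ∈ Set.Ioi (I.rPlus + 1),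
      ENNReal.ofReal (r ^ 2 * mom f (word α) (r - I.rPlus) ^ 2) ≤
      ENNReal.ofReal (V / (16 * I.N * c)) * (ENNReal.ofReal (16 * I.N * I.B r) *
        ∫⁻ q, ENNReal.ofReal (f (ray (r - I.rPlus) q) ^ 2) ∂sph) := fun r hr => by
    have hr' := Set.mem_Ioi.1 hr
    have hs : 0 < r - I.rPlus := by linarith
    have hBr : 0 < I.B r := I.B_pos (by linarith)
    have hq : Continuous fun q => f (ray (r - I.rPlus) q) ^ 2 :=
      (continuous_comp_ray hf.continuousOn hs).pow 2
    rw [← ofReal_integral_eq_lintegral_ofReal (integrable_sph hq)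
      (Filter.Eventually.of_forall fun q => sq_nonneg _),
      ← ENNReal.ofReal_mul (by positivity), ← ENNReal.ofReal_mul (by positivity)]
    refine ENNReal.ofReal_le_ofReal ?_
    have h1 := sq_mom_le hf.continuousOn α hs
    have h2 : 0 ≤ V * ∫ q, f (ray (r - I.rPlus) q) ^ 2 ∂sph :=
      mul_nonneg hV (integral_nonneg fun q => sq_nonneg _)
    calc r ^ 2 * mom f (word α) (r - I.rPlus) ^ 2
        ≤ r ^ 2 * (V * ∫ q, f (ray (r - I.rPlus) q) ^ 2 ∂sph) := by gcongr
      _ ≤ I.B r / c * (V * ∫ q, f (ray (r - I.rPlus) q) ^ 2 ∂sph) := by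
        refine mul_le_mul_of_nonneg_right ?_ h2
        rw [le_div_iff₀ hc0]
        linarith [hB r hr']
      _ = _ := by field_simp
  refine (setLIntegral_mono' measurableSet_Ioi hle).trans_lt ?_
  rw [lintegral_const_mul' _ _ ENNReal.ofReal_ne_top]
  refine ENNReal.mul_lt_top ENNReal.ofReal_lt_top (lt_of_le_of_lt ?_ hL)
  exact lintegral_mono_set (Set.Ioi_subset_Ioi (by linarith))

/-- There are no square-integrable eigentensors. -/
theorem eq_zero_of_modLich_eq_smul {h : Field} {lam : ℝ} (hh : I.IsC2 h) (ht : I.IsTT h)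
    (he : ∀ x ∈ dense, modLich I.metric h x = lam • h x) (hlam : 9 / 4 * I.kap ^ 2 < lam)
    (hL : MemLp (I.frameComp h) 2 I.vol) {x : Pt} (hx : x ∈ dense) : h x = 0 := by
  have hH := hh.mc2
  have hf : ∀ i j, ContDiffOn ℝ 1 (fun x => frameMat I.fr h x i j) dense := fun i j =>
    (hH.cd i j).of_le (by norm_num)
  have hfin : ∀ i j, ∫⁻ x, ENNReal.ofReal (frameMat I.fr h x i j ^ 2) ∂I.vol < ⊤ := fun i j => by
    have h1 := ((memLp_two_iff_integrable_sq_norm hL.1).1 hL).lintegral_lt_top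
    refine lt_of_le_of_lt (lintegral_mono fun x => ENNReal.ofReal_le_ofReal ?_) h1
    rw [← frameComp_apply, EuclideanSpace.norm_sq_eq]
    have h2 := Finset.single_le_sum (f := fun p => ‖I.frameComp h x p‖ ^ 2)
      (fun p _ => sq_nonneg _) (Finset.mem_univ (i, j))
    simpa using h2
  have hmom : ∀ (k : ℕ) (α : Fin k → Fin 4) r, I.rPlus < r →
      mmom (frameMat I.fr h) (word α) (r - I.rPlus) = 0 := fun k α r hr => by
    obtain ⟨X, hX⟩ := exists_radialSystem hh ht he k
    exact hX.eq_zero hlam (fun α i j => integrableOn_sq_mom (hf i j) (hfin i j) α) hr α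
  have hs : 0 < normSq x := normSq_pos hx
  have hz : ∀ i j q, frameMat I.fr h (ray (normSq x) q) i j = 0 := fun i j q => by
    refine eq_zero_of_moments (continuous_comp_ray (hf i j).continuousOn hs) (fun k α => ?_) q
    have h1 := congrFun (congrFun (hmom k α (I.rPlus + normSq x) (by linarith)) i) j
    rw [add_sub_cancel_left] at h1
    exact h1
  have hq : ∃ q : S3, ray (normSq x) q = x := by
    have h1 : ‖(WithLp.toLp 2 x : E4)‖ = √(normSq x) := by
      rw [EuclideanSpace.norm_eq]
      simp [normSq]
    have h2 : √(normSq x) ≠ 0 := (Real.sqrt_pos.2 hs).ne'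
    refine ⟨⟨(√(normSq x))⁻¹ • WithLp.toLp 2 x, ?_⟩, ?_⟩
    · rw [mem_sphere_zero_iff_norm, norm_smul, h1, norm_inv, Real.norm_of_nonneg
        (Real.sqrt_nonneg _), inv_mul_cancel₀ h2]
    · funext i
      simp only [ray, PiLp.smul_apply, smul_eq_mul]
      field_simp
  obtain ⟨q, hq⟩ := hq
  refine eq_zero_of_frameComp (I := I) hx ?_
  ext p
  have h1 := hz p.1 p.2 q
  rw [hq] at h1
  rw [← Prod.mk.eta (p := p), frameComp_apply, h1]
  rfl

end Instanton

end AdSTaubNUT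

end

noncomputable section

namespace AdSTaubNUT

open Matrix Filter
open scoped ContDiff

/-! ### Test tensors -/

lemma contDiff_pd {m n : WithTop ℕ∞} {f : Pt → ℝ} (hf : ContDiff ℝ n f) (hm : m + 1 ≤ n)
    (i : Fin 4) : ContDiff ℝ m (pd i f) :=
  (hf.fderiv_right hm).clm_apply contDiff_const

lemma two_le_smooth : (2 : WithTop ℕ∞) ≤ ∞ := WithTop.coe_le_coe.2 (le_top : (2 : ℕ∞) ≤ ⊤)

lemma three_le_smooth : (2 : WithTop ℕ∞) + 1 ≤ ∞ :=
  WithTop.coe_le_coe.2 (le_top : (2 : ℕ∞) + 1 ≤ ⊤)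

/-- The frame components of `√B σ₁ ⊗ √B σ₁ - √B σ₂ ⊗ √B σ₂`. -/
def diagM : M4 := Matrix.diagonal ![0, 1, -1, 0]

namespace Instanton

variable (I : Instanton)

/-- The tensor field `f(r) B (σ₁² - σ₂²)`. -/
def tens (f : ℝ → ℝ) : Field := fun x i j =>
  f (I.rad x) * (I.B (I.rad x) * (σ1 x i * σ1 x j - σ2 x i * σ2 x j))

/-- Smooth functions of the radial coordinate that vanish outside of a compact interval. -/
structure IsProfile (f : ℝ → ℝ) : Prop where
  smooth : ContDiffOn ℝ ∞ f (Set.Ioi I.rPlus)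
  support : ∃ a b, I.rPlus < a ∧ ∀ r, r ∉ Set.Icc a b → f r = 0

/-- The derivative along the unit radial vector. -/
def radial (f : ℝ → ℝ) (r : ℝ) : ℝ := I.sA r * deriv f r

/-- The potential in the modified Lichnerowicz operator on test tensors. -/
def pot (r : ℝ) : ℝ := -4 * I.Γ3 r * (I.Γ3 r + I.Γ1 r)

/-- The modified Lichnerowicz operator on test tensors. -/
def radialOp (f : ℝ → ℝ) (r : ℝ) : ℝ :=
  -I.radial (I.radial f) r - I.κtr r * I.radial f r - I.pot r * f r

variable {I} {f g : ℝ → ℝ}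

lemma IsProfile.mul_left (hf : I.IsProfile f) (hg : ContDiffOn ℝ ∞ g (Set.Ioi I.rPlus)) :
    I.IsProfile fun r => g r * f r :=
  ⟨hg.mul hf.smooth, let ⟨a, b, h1, h2⟩ := hf.support
    ⟨a, b, h1, fun r hr => by simp [h2 r hr]⟩⟩

lemma IsProfile.add (hf : I.IsProfile f) (hg : I.IsProfile g) :
    I.IsProfile fun r => f r + g r := by
  obtain ⟨a, b, h1, h2⟩ := hf.support
  obtain ⟨c, d, h3, h4⟩ := hg.support
  refine ⟨hf.smooth.add hg.smooth, min a c, max b d, lt_min h1 h3, fun r hr => ?_⟩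
  rw [h2 r fun h => hr ⟨(min_le_left _ _).trans h.1, h.2.trans (le_max_left _ _)⟩,
    h4 r fun h => hr ⟨(min_le_right _ _).trans h.1, h.2.trans (le_max_right _ _)⟩, add_zero]

lemma IsProfile.deriv (hf : I.IsProfile f) : I.IsProfile (deriv f) := by
  obtain ⟨a, b, h1, h2⟩ := hf.support
  refine ⟨hf.smooth.deriv_of_isOpen isOpen_Ioi (by simp), a, b, h1, fun r hr => ?_⟩
  have e : f =ᶠ[nhds r] fun _ => 0 :=
    eventually_of_mem (isClosed_Icc.isOpen_compl.mem_nhds hr) fun t ht => h2 t ht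
  rw [e.deriv_eq, deriv_const]

lemma IsProfile.radial (hf : I.IsProfile f) : I.IsProfile (I.radial f) :=
  hf.deriv.mul_left (I.contDiffOn_sA.of_le le_top)

lemma contDiffOn_κtr : ContDiffOn ℝ ⊤ I.κtr (Set.Ioi I.rPlus) :=
  (contDiffOn_const.mul I.contDiffOn_κ1).add I.contDiffOn_κ3

lemma contDiffOn_pot : ContDiffOn ℝ ⊤ I.pot (Set.Ioi I.rPlus) :=
  (contDiffOn_const.mul I.contDiffOn_Γ3).mul (I.contDiffOn_Γ3.add I.contDiffOn_Γ1)

lemma IsProfile.radialOp_sub (hf : I.IsProfile f) (lam : ℝ) :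
    I.IsProfile fun r => I.radialOp f r - lam * f r := by
  have h1 := (hf.radial.radial.mul_left (g := fun _ => -1) contDiffOn_const).add
    ((hf.radial.mul_left (g := fun r => -I.κtr r) (contDiffOn_κtr.of_le le_top).neg).add
      (hf.mul_left (g := fun r => -I.pot r - lam)
        ((contDiffOn_pot.of_le le_top).neg.sub contDiffOn_const)))
  convert h1 using 2 with r
  rw [radialOp]
  ring

lemma IsProfile.radialOp (hf : I.IsProfile f) : I.IsProfile (I.radialOp f) := by
  simpa using hf.radialOp_sub 0

lemma IsProfile.eq_zero (hf : I.IsProfile f) : f I.rPlus = 0 := by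
  obtain ⟨a, b, h1, h2⟩ := hf.support
  exact h2 _ fun h => absurd h.1 (not_le.2 h1)

/-- The support of a profile begins at some a > r_+, so the tensor vanishes near the origin, where
the forms σ_i are singular. -/
lemma IsProfile.contDiff_tens (hf : I.IsProfile f) (i j : Fin 4) :
    ContDiff ℝ ∞ (fun x => I.tens f x i j) := by
  rw [contDiff_iff_contDiffAt]
  intro x
  by_cases hx : x ∈ dense
  · have hs : ContDiffOn ℝ ∞ normSq dense := (contDiff_normSq.of_le le_top).contDiffOn
    have hσ : ∀ a k, ContDiffOn ℝ ∞ (fun x => 2 / normSq x * wMat x a k) dense := fun a k =>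
      (contDiffOn_const.div hs fun x hx => (normSq_pos hx).ne').mul
        ((contDiff_wMat a k).of_le le_top).contDiffOn
    have h1 : ContDiffOn ℝ ∞ (fun x => I.tens f x i j) dense :=
      (I.contDiffOn_comp_rad hf.smooth).mul (((I.contDiff_B.comp I.contDiff_rad).of_le
        le_top).contDiffOn.mul (((hσ 1 i).mul (hσ 1 j)).sub ((hσ 2 i).mul (hσ 2 j))))
    exact h1.contDiffAt (isOpen_dense.mem_nhds hx)
  · have hx0 : x = 0 := not_not.1 hx
    subst hx0
    obtain ⟨a, b, h1, h2⟩ := hf.support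
    have h3 : I.rad 0 < a := by simpa [rad, normSq] using h1
    have h4 : (fun x => I.tens f x i j) =ᶠ[nhds 0] fun _ => 0 := by
      filter_upwards [I.contDiff_rad.continuous.continuousAt.eventually_lt_const h3] with y hy
      rw [tens, h2 _ fun h => absurd h.1 (not_le.2 hy), zero_mul]
    exact contDiffAt_const.congr_of_eventuallyEq h4

lemma contDiff_blowUp0 (a : Fin 4) : ContDiff ℝ ∞ fun y => blowUp0 y a := by
  fin_cases a <;> simp [blowUp0] <;> fun_prop

lemma contDiff_blowUp1 (a : Fin 4) : ContDiff ℝ ∞ fun y => blowUp1 y a := by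
  fin_cases a <;> simp [blowUp1] <;> fun_prop

lemma contDiff_chart {Φ : Pt → Pt} (hΦ : Φ ∈ I.charts) (a : Fin 4) :
    ContDiff ℝ ∞ fun y => Φ y a := by
  unfold charts at hΦ
  rcases hk : I.kind with _ | _ | _ <;> simp only [hk] at hΦ
  · rw [Set.mem_singleton_iff.1 hΦ]
    exact contDiff_apply ℝ ℝ a
  all_goals
    rcases hΦ with h | h
    · rw [h]
      exact contDiff_blowUp0 a
    · rw [Set.mem_singleton_iff.1 h]
      exact contDiff_blowUp1 a

/-- The charts around the nut or bolt are polynomial maps, so components of class C² on all of ℝ⁴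
pull back to components of class C². -/
lemma isC2_of_contDiff {h : Field} (hh : ∀ i j, ContDiff ℝ 2 (fun x => h x i j)) : I.IsC2 h := by
  refine ⟨fun i j => (hh i j).contDiffOn, fun Φ hΦ => ⟨pullback Φ h, fun i j => ?_,
    fun y _ => rfl⟩⟩
  have h1 : ContDiff ℝ 2 Φ := contDiff_pi.2 fun a => (contDiff_chart hΦ a).of_le two_le_smooth
  have h2 : ∀ i a, ContDiff ℝ 2 (pd i fun z => Φ z a) := fun i a =>
    contDiff_pd (contDiff_chart hΦ a) three_le_smooth i
  exact ContDiff.sum fun a _ => ContDiff.sum fun b _ =>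
    ((h2 i a).mul (h2 j b)).mul ((hh a b).comp h1)

lemma IsProfile.isC2 (hf : I.IsProfile f) : I.IsC2 (I.tens f) :=
  isC2_of_contDiff fun i j => (hf.contDiff_tens i j).of_le two_le_smooth

lemma sum_fr_mul_wMat (x : Pt) (a b : Fin 4) :
    ∑ i, I.fr x a i * wMat x b i = if a = b then I.frad a (I.rad x) * normSq x else 0 := by
  have h1 := congrFun (congrFun (wMat_mul x) a) b
  simp only [Matrix.mul_apply, Matrix.transpose_apply, Matrix.smul_apply, Matrix.one_apply] at h1
  simp only [fr_apply, mul_assoc, ← Finset.mul_sum, h1]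
  split_ifs <;> simp

lemma frameMat_tens (f : ℝ → ℝ) {x : Pt} (hx : x ∈ dense) :
    frameMat I.fr (I.tens f) x = f (I.rad x) • diagM := by
  have hs := normSq_pos hx
  have hB := I.B_pos (I.rad_gt hx)
  have e : I.B (I.rad x) * I.β (I.rad x) ^ 2 = 1 := by
    rw [β, div_pow, Real.sq_sqrt hB.le]
    field_simp
  ext a b
  have h1 : frameMat I.fr (I.tens f) x a b = f (I.rad x) * (I.B (I.rad x) * (2 / normSq x) ^ 2 *
      ((∑ i, I.fr x a i * wMat x 1 i) * (∑ j, I.fr x b j * wMat x 1 j) -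
        (∑ i, I.fr x a i * wMat x 2 i) * (∑ j, I.fr x b j * wMat x 2 j))) := by
    simp only [frameMat, Matrix.mul_apply, Matrix.transpose_apply, Matrix.of_apply, tens, σ1, σ2]
    have e1 : ∀ i, wMat x 1 i = w1 x i := fun i => rfl
    have e2 : ∀ i, wMat x 2 i = w2 x i := fun i => rfl
    simp only [e1, e2, Fin.sum_univ_four]
    ring
  have f1 : I.frad 1 (I.rad x) = I.β (I.rad x) / 2 := rfl
  have f2 : I.frad 2 (I.rad x) = I.β (I.rad x) / 2 := rfl
  rw [h1]
  simp only [sum_fr_mul_wMat]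
  fin_cases a <;> fin_cases b <;> simp [diagM, f1, f2] <;> field_simp <;>
    linear_combination f (I.rad x) * e

lemma IsProfile.frameMat_tens (hf : I.IsProfile f) :
    frameMat I.fr (I.tens f) = fun x => f (I.rad x) • diagM := by
  funext x
  by_cases hx : x ∈ dense
  · exact Instanton.frameMat_tens f hx
  · have hx0 : x = 0 := not_not.1 hx
    have h1 : f (I.rad x) = 0 := by
      rw [hx0]
      simpa [rad, normSq] using hf.eq_zero
    have h2 : I.tens f x = 0 := by
      funext i j
      simp [tens, h1]
    simp [frameMat, h1, h2]

lemma mdirD_radial_smul (hf : I.IsProfile f) (M : M4) {x : Pt} (hx : x ∈ dense) (c : Fin 4) :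
    mdirD I.fr c (fun x => f (I.rad x) • M) x =
      if c = 0 then I.radial f (I.rad x) • M else 0 := by
  have hd : DifferentiableAt ℝ f (I.rad x) := (hf.smooth.differentiableOn (by simp)).differentiableAt
    (isOpen_Ioi.mem_nhds (I.rad_gt hx))
  ext i j
  have h1 : DifferentiableAt ℝ (fun x => f (I.rad x)) x :=
    differentiableAt_of_contDiffOn (by simp) (I.contDiffOn_comp_rad hf.smooth) hx
  have h2 := I.dirD_radial hx hd c
  have h3 : dirD I.fr c (fun y => f (I.rad y) * M i j) x =
      dirD I.fr c (fun y => f (I.rad y)) x * M i j := by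
    simp only [dirD, Finset.sum_mul]
    refine Finset.sum_congr rfl fun k _ => ?_
    rw [pd_mul h1 (differentiableAt_const _)]
    simp [pd, mul_assoc]
  rw [mdirD_apply]
  simp only [Matrix.smul_apply, smul_eq_mul]
  rw [h3, h2]
  split_ifs <;> simp [radial]

lemma mxD_radial_smul (hf : I.IsProfile f) (M : M4) {x : Pt} (hx : x ∈ dense) {c : Fin 4}
    (hc : c ≠ 0) : mxD c (fun x => f (I.rad x) • M) x = 0 := by
  have h1 := mdirD_radial_smul hf M hx c
  rw [mdirD_eq_mxD hc, if_neg hc] at h1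
  refine (smul_eq_zero.1 h1).resolve_left ?_
  have hr := I.rad_gt hx
  fin_cases c
  · exact absurd rfl hc
  · exact (I.β_pos hr).ne'
  · exact (I.β_pos hr).ne'
  · exact (I.γ_pos hr).ne'

lemma connD_eq (c : Fin 4) (r : ℝ) : I.connD c r =
    ![0,
    !![0, I.radial I.κ1 r, 0, 0; -I.radial I.κ1 r, 0, 0, 0;
      0, 0, 0, I.radial I.Γ1 r; 0, 0, -I.radial I.Γ1 r, 0],
    !![0, 0, I.radial I.κ1 r, 0; 0, 0, 0, -I.radial I.Γ1 r;
      -I.radial I.κ1 r, 0, 0, 0; 0, I.radial I.Γ1 r, 0, 0],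
    !![0, 0, 0, I.radial I.κ3 r; 0, 0, I.radial I.Γ3 r, 0;
      0, -I.radial I.Γ3 r, 0, 0; -I.radial I.κ3 r, 0, 0, 0]] c := by
  ext i j
  simp only [connD, conn, radial, Matrix.of_apply]
  fin_cases c <;> fin_cases i <;> fin_cases j <;> simp

lemma curvAct_diagM (r : ℝ) (P Q : Fin 4) :
    I.curvAct r diagM P Q = I.curv Q 1 r 1 P - I.curv Q 2 r 2 P := by
  simp [curvAct, diagM, Fin.sum_univ_four]
  ring

/-- `diagM` is an eigenvector of the terms of order zero, which is what reduces the operator on test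
tensors to a single ordinary differential operator. The derivatives of the connection matrices
cancel between e_1 and e_2, and so do the contributions of κ1 and κ3. The potential tends to zero at
infinity, in accordance with `orderZeroInf_apply`. -/
lemma orderZero_diagM (r : ℝ) :
    ∑ c, I.act c r (I.act c r diagM) + (2 : ℝ) • I.curvAct r diagM = I.pot r • diagM := by
  ext P Q
  simp only [Matrix.add_apply, Matrix.smul_apply, curvAct_diagM, smul_eq_mul]
  simp only [curv, act, Matrix.sum_apply, Matrix.sub_apply, Matrix.add_apply, Matrix.mul_apply,
    Matrix.smul_apply, connD_eq, Fin.sum_univ_four, smul_eq_mul]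
  fin_cases P <;> fin_cases Q <;> simp [conn, diagM, pot] <;> ring

lemma div_diagM (r : ℝ) (Q : Fin 4) : ∑ c, I.act c r diagM c Q = 0 := by
  simp only [act, Matrix.sub_apply, Matrix.mul_apply, Fin.sum_univ_four]
  fin_cases Q <;> simp [conn, diagM]

end Instanton

end AdSTaubNUT

end

/-! ### The operator on test tensors and their norms -/

noncomputable section

namespace AdSTaubNUT

open Matrix Filter
open scoped ContDiff

namespace Instanton

variable {I : Instanton} {f g : ℝ → ℝ}

lemma eq_of_frameMat_eq {h k : Field} {x : Pt} (hx : x ∈ dense)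
    (e : frameMat I.fr h x = frameMat I.fr k x) : h x = k x := by
  have h1 : I.frameComp ((-1 : ℝ) • h + k) x = 0 := by
    rw [frameComp_lin]
    ext p
    have := congrFun (congrFun e p.1) p.2
    rw [← frameComp_apply, ← frameComp_apply, Prod.mk.eta] at this
    simp [this]
  have h2 := eq_zero_of_frameComp (I := I) hx h1
  funext i j
  have h3 := congrFun (congrFun h2 i) j
  simp only [Pi.add_apply, Pi.smul_apply, smul_eq_mul, Pi.zero_apply] at h3
  linarith

/-- Left-invariant derivatives annihilate radial multiples of the constant matrix `diagM`, so only
the radial derivatives and the potential of `orderZero_diagM` survive. -/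
lemma IsProfile.modLich_tens (hf : I.IsProfile f) {x : Pt} (hx : x ∈ dense) :
    modLich I.metric (I.tens f) x = I.tens (I.radialOp f) x := by
  apply eq_of_frameMat_eq (I := I) hx
  rw [frameMat_modLich hf.isC2 hf.isC2.mc2 hx, hf.radialOp.frameMat_tens, hf.frameMat_tens]
  have h0 : mdirD I.fr 0 (mdirD I.fr 0 fun x => f (I.rad x) • diagM) x =
      I.radial (I.radial f) (I.rad x) • diagM := by
    have h1 := mdirD_radial_smul hf.radial diagM hx 0
    rw [if_pos rfl] at h1
    rw [← h1]
    ext i j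
    rw [mdirD_apply, mdirD_apply]
    simp only [dirD]
    refine Finset.sum_congr rfl fun k _ => ?_
    congr 1
    have e : (fun y => mdirD I.fr 0 (fun x => f (I.rad x) • diagM) y i j) =ᶠ[nhds x]
        fun y => (I.radial f (I.rad y) • diagM) i j :=
      eventually_of_mem (isOpen_dense.mem_nhds hx) fun y hy => by
        simp only [mdirD_radial_smul hf diagM hy 0, if_true]
    simp only [pd, e.fderiv_eq]
  have h2 : mdirD I.fr 0 (fun x => f (I.rad x) • diagM) x = I.radial f (I.rad x) • diagM := by
    rw [mdirD_radial_smul hf diagM hx 0, if_pos rfl]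
  have h3 : ∀ c, c ≠ 0 → mxD c (fun x => f (I.rad x) • diagM) x = 0 := fun c hc =>
    mxD_radial_smul hf diagM hx hc
  have h4 : ∀ c, c ≠ 0 → mxD c (mxD c fun x => f (I.rad x) • diagM) x = 0 := fun c hc => by
    ext i j
    rw [mxD_apply, xD]
    refine Finset.sum_eq_zero fun k _ => ?_
    have e : (fun y => mxD c (fun x => f (I.rad x) • diagM) y i j) =ᶠ[nhds x] fun y => 0 :=
      eventually_of_mem (isOpen_dense.mem_nhds hx) fun y hy => by
        simp only [mxD_radial_smul hf diagM hy hc, Matrix.zero_apply]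
    simp [pd, e.fderiv_eq]
  have h5 : ∀ c, (I.invb c (I.rad x) ^ 2 • mxD c (mxD c fun x => f (I.rad x) • diagM) x -
      (2 * I.invb c (I.rad x)) • I.act c (I.rad x) (mxD c (fun x => f (I.rad x) • diagM) x) +
      I.act c (I.rad x) (I.act c (I.rad x) (f (I.rad x) • diagM))) =
      f (I.rad x) • I.act c (I.rad x) (I.act c (I.rad x) diagM) := fun c => by
    have e1 : I.act c (I.rad x) (I.act c (I.rad x) (f (I.rad x) • diagM)) =
        f (I.rad x) • I.act c (I.rad x) (I.act c (I.rad x) diagM) := by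
      simp only [← actL_apply, map_smul]
    rw [e1]
    by_cases hc : c = 0
    · subst hc
      have : I.invb 0 (I.rad x) = 0 := rfl
      simp [this]
    · rw [h3 c hc, h4 c hc, ← actL_apply, map_zero]
      simp
  have h6 : I.curvAct (I.rad x) (f (I.rad x) • diagM) = f (I.rad x) • I.curvAct (I.rad x) diagM := by
    simp only [← curvActL_apply, map_smul]
  have h7 := congrArg (fun M => f (I.rad x) • M) (orderZero_diagM (I := I) (I.rad x))
  simp only [smul_add, Finset.smul_sum] at h7
  simp only [h0, h2, h5, h6, Instanton.radialOp]
  rw [sub_sub _ (∑ c, _), smul_comm (2 : ℝ), h7]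
  module

lemma IsProfile.isTT (hf : I.IsProfile f) : I.IsTT (I.tens f) := by
  intro x hx
  have hF := I.isFrame
  refine ⟨fun i j => ?_, ?_, ?_⟩
  · simp only [tens]
    ring
  · rw [hF.frame_trace hx, hf.frameMat_tens]
    simp [Fin.sum_univ_four, diagM]
  · have h1 : I.fr x *ᵥ (divergence I.metric (I.tens f) x) = 0 := by
      funext Q
      have h2 := frame_divergence_eq hf.isC2 hx Q
      have h3 : (I.fr x *ᵥ (divergence I.metric (I.tens f) x)) Q =
        ∑ b, I.fr x Q b * divergence I.metric (I.tens f) x b := rfl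
      rw [h3, h2, hf.frameMat_tens, mdirD_radial_smul hf diagM hx 0, if_pos rfl]
      have h4 : ∀ c, I.invb c (I.rad x) * mxD c (fun x => f (I.rad x) • diagM) x c Q -
          I.act c (I.rad x) (f (I.rad x) • diagM) c Q =
          -(f (I.rad x) * I.act c (I.rad x) diagM c Q) := fun c => by
        rw [← actL_apply, map_smul, actL_apply]
        by_cases hc : c = 0
        · subst hc
          have : I.invb 0 (I.rad x) = 0 := rfl
          simp [this]
        · rw [mxD_radial_smul hf diagM hx hc]
          simp
      simp only [h4, Finset.sum_neg_distrib, ← Finset.mul_sum, div_diagM]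
      simp only [Matrix.smul_apply, mul_zero, neg_zero, add_zero, Pi.zero_apply, smul_eq_mul]
      fin_cases Q <;> simp [diagM]
    have h5 : IsUnit (I.fr x) := by
      have := I.frame_orthonormal hx
      rw [Matrix.mul_assoc] at this
      exact IsUnit.of_mul_eq_one _ this
    have h6 := Matrix.mulVec_injective_of_isUnit h5 (h1.trans (Matrix.mulVec_zero _).symm)
    exact fun b => congrFun h6 b

lemma norm_sq_frameComp_tens (f : ℝ → ℝ) {x : Pt} (hx : x ∈ dense) :
    ‖I.frameComp (I.tens f) x‖ ^ 2 = 2 * f (I.rad x) ^ 2 := by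
  rw [EuclideanSpace.norm_sq_eq, Fintype.sum_prod_type]
  simp only [frameComp_apply, Instanton.frameMat_tens f hx]
  simp [Fin.sum_univ_four, diagM]
  ring

/-- The surface measure of the unit sphere. -/
def area : ℝ := sph.real Set.univ

lemma area_pos : 0 < area := by
  have : Nonempty S3 := ⟨⟨EuclideanSpace.single 0 1, by simp⟩⟩
  exact ENNReal.toReal_pos (isOpen_univ.measure_pos sph Set.univ_nonempty).ne' (measure_ne_top _ _)

lemma IsProfile.continuousOn (hf : I.IsProfile f) : ContinuousOn f (Set.Ioi I.rPlus) :=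
  hf.smooth.continuousOn

lemma IsProfile.integrableOn (hf : I.IsProfile f) (hg : ContinuousOn g (Set.Ioi I.rPlus)) :
    IntegrableOn (fun r => g r * f r ^ 2) (Set.Ioi I.rPlus) := by
  obtain ⟨a, b, h1, h2⟩ := hf.support
  have hs : Set.Icc a b ⊆ Set.Ioi I.rPlus := fun r hr => h1.trans_le hr.1
  have h3 : IntegrableOn (fun r => g r * f r ^ 2) (Set.Icc a b) :=
    ((hg.mul (hf.continuousOn.pow 2)).mono hs).integrableOn_compact isCompact_Icc
  refine h3.of_forall_sdiff_eq_zero measurableSet_Ioi fun r hr => ?_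
  rw [h2 r hr.2]
  simp

/-- The factor 32 N is the 16 N of `lintegral_vol` times the squared norm 2 of `diagM`. -/
lemma IsProfile.lintegral_tens (hf : I.IsProfile f) :
    ∫⁻ x, ENNReal.ofReal (‖I.frameComp (I.tens f) x‖ ^ 2) ∂I.vol =
      ENNReal.ofReal (32 * I.N * area * ∫ r in Set.Ioi I.rPlus, I.B r * f r ^ 2) := by
  have hN := I.N_pos
  have h1 : ∫⁻ x, ENNReal.ofReal (‖I.frameComp (I.tens f) x‖ ^ 2) ∂I.vol =
      ∫⁻ x, ENNReal.ofReal (2 * f (I.rad x) ^ 2) ∂I.vol := by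
    refine lintegral_congr_ae ?_
    filter_upwards [I.ae_dense] with x hx
    rw [norm_sq_frameComp_tens f hx]
  have hc : ContinuousOn (fun x => 2 * f (I.rad x) ^ 2) dense :=
    continuousOn_const.mul ((I.contDiffOn_comp_rad hf.smooth).continuousOn.pow 2)
  have h2 : ∀ r ∈ Set.Ioi I.rPlus, ENNReal.ofReal (16 * I.N * I.B r) *
      ∫⁻ q, ENNReal.ofReal (2 * f (I.rad (ray (r - I.rPlus) q)) ^ 2) ∂sph =
      ENNReal.ofReal (32 * I.N * area * (I.B r * f r ^ 2)) := fun r hr => by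
    have hs : 0 ≤ r - I.rPlus := (sub_pos.2 hr).le
    have hB := I.B_pos hr
    simp only [rad_ray I hs, add_sub_cancel]
    rw [lintegral_const, ← ofReal_measureReal, ← ENNReal.ofReal_mul (by positivity),
      ← ENNReal.ofReal_mul (by positivity)]
    congr 1
    rw [area]
    ring
  rw [h1, lintegral_vol I hc, setLIntegral_congr_fun measurableSet_Ioi h2,
    ← ofReal_integral_eq_lintegral_ofReal, integral_const_mul]
  · exact (hf.integrableOn I.contDiff_B.continuous.continuousOn).const_mul _
  · refine (ae_restrict_iff' measurableSet_Ioi).2 (Eventually.of_forall fun r hr => ?_)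
    have hB := I.B_pos hr
    have := area_pos
    positivity

lemma IsProfile.memLp (hf : I.IsProfile f) : MemLp (I.frameComp (I.tens f)) 2 I.vol := by
  have hm : AEStronglyMeasurable (I.frameComp (I.tens f)) I.vol := by
    have hc : ContinuousOn (I.frameComp (I.tens f)) dense := by
      have h1 : ∀ p : Fin 4 × Fin 4, ContinuousOn (fun x => I.frameComp (I.tens f) x p) dense :=
        fun p => by
        have := (hf.isC2.mc2.cd p.1 p.2).continuousOn
        simpa only [← frameComp_apply, Prod.mk.eta] using this
      exact (PiLp.continuous_toLp 2 _).comp_continuousOn (continuousOn_pi.2 h1)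
    have h2 := hc.aestronglyMeasurable (μ := I.vol) isOpen_dense.measurableSet
    rwa [Measure.restrict_eq_self_of_ae_mem I.ae_dense] at h2
  rw [memLp_two_iff_integrable_sq_norm hm]
  refine ⟨hm.norm.pow 2, ?_⟩
  rw [hasFiniteIntegral_iff_ofReal (Eventually.of_forall fun x => sq_nonneg _),
    hf.lintegral_tens]
  exact ENNReal.ofReal_lt_top

lemma IsProfile.norm_sq_toLp (hf : I.IsProfile f) : ‖hf.memLp.toLp‖ ^ 2 =
    32 * I.N * area * ∫ r in Set.Ioi I.rPlus, I.B r * f r ^ 2 := by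
  have hN := I.N_pos
  have ha := area_pos
  have h0 : 0 ≤ ∫ r in Set.Ioi I.rPlus, I.B r * f r ^ 2 :=
    setIntegral_nonneg measurableSet_Ioi fun r hr =>
      mul_nonneg (I.B_pos hr).le (sq_nonneg _)
  rw [← real_inner_self_eq_norm_sq, L2.inner_def]
  have h1 : ∫ x, inner ℝ (hf.memLp.toLp _ x) (hf.memLp.toLp _ x) ∂I.vol =
      ∫ x, ‖I.frameComp (I.tens f) x‖ ^ 2 ∂I.vol := by
    refine integral_congr_ae ?_
    filter_upwards [hf.memLp.coeFn_toLp] with x hx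
    rw [hx, real_inner_self_eq_norm_sq]
  rw [h1, integral_eq_lintegral_of_nonneg_ae (Eventually.of_forall fun x => sq_nonneg _)
    (hf.memLp.1.norm.pow 2), hf.lintegral_tens, ENNReal.toReal_ofReal (by positivity)]

end Instanton

end AdSTaubNUT

end

noncomputable section

namespace AdSTaubNUT

open Matrix Filter Asymptotics
open scoped ContDiff

/-! ### Approximate eigentensors -/

lemma exists_cutoff : ∃ (χ χ1 χ2 : ℝ → ℝ) (M : ℝ), ContDiff ℝ ∞ χ ∧
    (∀ s, HasDerivAt χ (χ1 s) s) ∧ (∀ s, HasDerivAt χ1 (χ2 s) s) ∧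
    (∀ s, |χ s| ≤ M ∧ |χ1 s| ≤ M ∧ |χ2 s| ≤ M) ∧
    (∀ s, s ∉ Set.Icc (1 : ℝ) 2 → χ s = 0 ∧ χ1 s = 0 ∧ χ2 s = 0) ∧
    ∀ s ∈ Set.Icc (5 / 4 : ℝ) (7 / 4), χ s = 1 := by
  let b : ContDiffBump (3 / 2 : ℝ) := ⟨1 / 4, 1 / 2, by norm_num, by norm_num⟩
  have h0 : ContDiff ℝ ∞ b := b.contDiff
  have h1 : ContDiff ℝ ∞ (deriv b) := (contDiff_infty_iff_deriv.1 h0).2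
  have h2 : ContDiff ℝ ∞ (deriv (deriv b)) := (contDiff_infty_iff_deriv.1 h1).2
  have hz0 : ∀ s, s ∉ Set.Icc (1 : ℝ) 2 → b s = 0 := fun s hs => by
    by_contra hc
    have : s ∈ Function.support b := hc
    rw [b.support_eq, Metric.mem_ball, Real.dist_eq, abs_lt] at this
    have e : b.rOut = 1 / 2 := rfl
    rw [e] at this
    exact hs ⟨by linarith, by linarith⟩
  have hz : ∀ {u : ℝ → ℝ}, (∀ s, s ∉ Set.Icc (1 : ℝ) 2 → u s = 0) →
      ∀ s, s ∉ Set.Icc (1 : ℝ) 2 → deriv u s = 0 := fun {u} hu s hs => by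
    have e : u =ᶠ[nhds s] fun _ => 0 :=
      eventually_of_mem (isClosed_Icc.isOpen_compl.mem_nhds hs) fun t ht => hu t ht
    rw [e.deriv_eq, deriv_const]
  have hb : ∀ {u : ℝ → ℝ}, Continuous u → (∀ s, s ∉ Set.Icc (1 : ℝ) 2 → u s = 0) →
      ∃ M, ∀ s, |u s| ≤ M := fun {u} hu hu0 => by
    obtain ⟨M, hM⟩ := (isCompact_Icc (a := (1 : ℝ)) (b := 2)).exists_bound_of_continuousOn
      hu.continuousOn
    refine ⟨max M 0, fun s => ?_⟩
    by_cases hs : s ∈ Set.Icc (1 : ℝ) 2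
    · exact (hM s hs).trans (le_max_left _ _)
    · rw [hu0 s hs, abs_zero]
      exact le_max_right _ _
  obtain ⟨M0, hM0⟩ := hb h0.continuous hz0
  obtain ⟨M1, hM1⟩ := hb h1.continuous (hz hz0)
  obtain ⟨M2, hM2⟩ := hb h2.continuous (hz (hz hz0))
  refine ⟨b, deriv b, deriv (deriv b), max M0 (max M1 M2), h0,
    fun s => (h0.differentiable (by simp) s).hasDerivAt,
    fun s => (h1.differentiable (by simp) s).hasDerivAt, fun s => ⟨(hM0 s).trans (le_max_left _ _),
      (hM1 s).trans ((le_max_left _ _).trans (le_max_right _ _)),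
      (hM2 s).trans ((le_max_right _ _).trans (le_max_right _ _))⟩,
    fun s hs => ⟨hz0 s hs, hz hz0 s hs, hz (hz hz0) s hs⟩, fun s hs => ?_⟩
  apply b.one_of_mem_closedBall
  rw [Metric.mem_closedBall, Real.dist_eq, abs_le]
  have e : b.rIn = 1 / 4 := rfl
  rw [e]
  exact ⟨by linarith [hs.1], by linarith [hs.2]⟩

/-- A slowly modulated oscillation, with its first two derivatives and the error in the limiting
equation. -/
lemma exists_wave {κ lam : ℝ} (hκ : 0 < κ) (hlam : 9 / 4 * κ ^ 2 < lam) :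
    ∃ K : ℝ, 0 ≤ K ∧ ∀ n : ℝ, 1 ≤ n → ∃ w w1 w2 : Fin 2 → ℝ → ℝ,
      (∀ e, ContDiff ℝ ∞ (w e)) ∧
      (∀ e t, HasDerivAt (w e) (w1 e t) t) ∧ (∀ e t, HasDerivAt (w1 e) (w2 e t) t) ∧
      (∀ e t, t ∉ Set.Icc n (2 * n) → w e t = 0 ∧ w1 e t = 0 ∧ w2 e t = 0) ∧
      (∀ e t, |w e t| ≤ K * Real.exp (-(3 / 2) * t) ∧ |w1 e t| ≤ K * Real.exp (-(3 / 2) * t) ∧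
        |w2 e t| ≤ K * Real.exp (-(3 / 2) * t)) ∧
      (∀ e t, |κ ^ 2 * w2 e t + 3 * κ ^ 2 * w1 e t + lam * w e t| ≤
        K / n * Real.exp (-(3 / 2) * t)) ∧
      ∀ t ∈ Set.Icc (5 / 4 * n) (7 / 4 * n), w 0 t ^ 2 + w 1 t ^ 2 = Real.exp (-3 * t) := by
  obtain ⟨χ, χ1, χ2, M, hχ, d0, d1, hM, hz, hone⟩ := exists_cutoff
  have hM0 : 0 ≤ M := (abs_nonneg _).trans (hM 0).1
  -- The frequency in the variable log r: the roots of κ²(x² + 3x) + λ are -3/2 ± iν.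
  set ν := √(lam / κ ^ 2 - 9 / 4) with hν
  have hν2 : κ ^ 2 * ν ^ 2 = lam - 9 / 4 * κ ^ 2 := by
    rw [hν, Real.sq_sqrt]
    · field_simp
    · rw [sub_nonneg, le_div_iff₀ (by positivity)]
      exact hlam.le
  have hν0 : 0 ≤ ν := Real.sqrt_nonneg _
  -- The two phases give cosine and sine. Their squares add up to one, so no oscillating integral
  -- has to be estimated from below.
  let ph : Fin 2 → ℝ := ![0, -(Real.pi / 2)]
  let E : ℝ → ℝ := fun t => Real.exp (-(3 / 2) * t)
  let co : Fin 2 → ℝ → ℝ := fun e t => Real.cos (ν * t + ph e)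
  let si : Fin 2 → ℝ → ℝ := fun e t => Real.sin (ν * t + ph e)
  have hE0 : ∀ t, 0 < E t := fun t => Real.exp_pos _
  have dE : ∀ t, HasDerivAt E (-(3 / 2) * E t) t := fun t => by
    have := ((hasDerivAt_id t).const_mul (-(3 / 2) : ℝ)).exp
    refine this.congr_deriv ?_
    simp only [E, id]
    ring
  have dlin : ∀ e t, HasDerivAt (fun t => ν * t + ph e) ν t := fun e t => by
    simpa using ((hasDerivAt_id t).const_mul ν).add_const (ph e)
  have dco : ∀ e t, HasDerivAt (co e) (-(ν * si e t)) t := fun e t => by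
    refine (dlin e t).cos.congr_deriv ?_
    simp only [si]
    ring
  have dsi : ∀ e t, HasDerivAt (si e) (ν * co e t) t := fun e t => by
    refine (dlin e t).sin.congr_deriv ?_
    simp only [co]
    ring
  have hco : ∀ e t, |co e t| ≤ 1 := fun e t => Real.abs_cos_le_one _
  have hsi : ∀ e t, |si e t| ≤ 1 := fun e t => Real.abs_sin_le_one _
  let c0 : Fin 2 → ℝ → ℝ := fun e t => E t * co e t
  let c1 : Fin 2 → ℝ → ℝ := fun e t => E t * (-(3 / 2) * co e t - ν * si e t)
  let c2 : Fin 2 → ℝ → ℝ := fun e t => E t * ((9 / 4 - ν ^ 2) * co e t + 3 * ν * si e t)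
  have dc0 : ∀ e t, HasDerivAt (c0 e) (c1 e t) t := fun e t => by
    refine ((dE t).mul (dco e t)).congr_deriv ?_
    simp only [c1]
    ring
  have dc1 : ∀ e t, HasDerivAt (c1 e) (c2 e t) t := fun e t => by
    refine ((dE t).mul (((dco e t).const_mul (-(3 / 2))).sub
      ((dsi e t).const_mul ν))).congr_deriv ?_
    simp only [c2, Pi.sub_apply]
    ring
  set K0 : ℝ := 3 + 4 * ν + ν ^ 2 with hK0
  have hK00 : 0 ≤ K0 := by positivity
  have hc : ∀ e t, |c0 e t| ≤ K0 * E t ∧ |c1 e t| ≤ K0 * E t ∧ |c2 e t| ≤ K0 * E t := fun e t => by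
    have a1 := abs_le.1 (hco e t)
    have a2 := abs_le.1 (hsi e t)
    have hb : ∀ {x : ℝ}, |x| ≤ K0 → |E t * x| ≤ K0 * E t := fun {x} hx => by
      rw [abs_mul, abs_of_pos (hE0 t), mul_comm]
      exact mul_le_mul_of_nonneg_right hx (hE0 t).le
    refine ⟨hb ((hco e t).trans (by nlinarith)), hb ?_, hb ?_⟩
    · rw [abs_le]
      constructor <;> nlinarith
    · have := mul_nonneg hν0 hν0
      rw [abs_le]
      constructor <;> nlinarith
  have hode : ∀ e t, κ ^ 2 * c2 e t + 3 * κ ^ 2 * c1 e t + lam * c0 e t = 0 := fun e t => by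
    simp only [c0, c1, c2]
    linear_combination (-(E t * co e t)) * hν2
  -- One constant for both kinds of bounds: the second derivative consists of at most 1 + 2 + 1
  -- terms of size M K0 E, and the error of κ² times 1 + 2 + 3 terms of size M K0 E / n.
  refine ⟨6 * (1 + κ ^ 2) * (M * K0), by positivity, fun n hn => ?_⟩
  have hn0 : 0 < n := by linarith
  have hn1 : n⁻¹ ≤ 1 := inv_le_one_of_one_le₀ hn
  have hni : 0 ≤ n⁻¹ := by positivity
  have dχ : ∀ {u u' : ℝ → ℝ} (_ : ∀ s, HasDerivAt u (u' s) s) t,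
      HasDerivAt (fun t => u (t / n)) (u' (t / n) * n⁻¹) t := fun hu t => by
    have := (hu (t / n)).comp t ((hasDerivAt_id t).div_const n)
    simpa [Function.comp_def] using this
  have hmul : ∀ {x y : ℝ} t, |x| ≤ M → |y| ≤ K0 * E t → |x * y| ≤ M * K0 * E t :=
    fun {x y} t hx hy => by
    rw [abs_mul, mul_assoc]
    exact mul_le_mul hx hy (abs_nonneg _) hM0
  have hsm : ∀ {x : ℝ} t, |x| ≤ M * K0 * E t → |n⁻¹ * x| ≤ n⁻¹ * (M * K0 * E t) ∧
      |n⁻¹ * x| ≤ M * K0 * E t := fun {x} t hx => by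
    have e1 : |n⁻¹ * x| ≤ n⁻¹ * (M * K0 * E t) := by
      rw [abs_mul, abs_of_nonneg hni]
      exact mul_le_mul_of_nonneg_left hx hni
    refine ⟨e1, e1.trans ?_⟩
    have : 0 ≤ M * K0 * E t := by
      have := hE0 t
      positivity
    nlinarith
  refine ⟨fun e t => χ (t / n) * c0 e t,
    fun e t => n⁻¹ * (χ1 (t / n) * c0 e t) + χ (t / n) * c1 e t,
    fun e t => n⁻¹ * (n⁻¹ * (χ2 (t / n) * c0 e t)) + 2 * (n⁻¹ * (χ1 (t / n) * c1 e t)) +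
      χ (t / n) * c2 e t, fun e => ?_, fun e t => ?_, fun e t => ?_, fun e t ht => ?_, fun e t => ?_,
      fun e t => ?_, fun t ht => ?_⟩
  · have h1 : ContDiff ℝ ∞ (fun t => χ (t / n)) := hχ.comp (contDiff_id.div_const n)
    have h2 : ContDiff ℝ ∞ (c0 e) := by
      simp only [c0, E, co]
      fun_prop
    exact h1.mul h2
  · refine ((dχ d0 t).mul (dc0 e t)).congr_deriv ?_
    ring
  · refine ((((dχ d1 t).mul (dc0 e t)).const_mul n⁻¹).add
      ((dχ d0 t).mul (dc1 e t))).congr_deriv ?_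
    ring
  · have h1 : t / n ∉ Set.Icc (1 : ℝ) 2 := fun h => ht ⟨by
      have := (le_div_iff₀ hn0).1 h.1
      linarith, (div_le_iff₀ hn0).1 h.2⟩
    obtain ⟨z0, z1, z2⟩ := hz _ h1
    simp [z0, z1, z2]
  · obtain ⟨m0, m1, m2⟩ := hM (t / n)
    obtain ⟨b0, b1, b2⟩ := hc e t
    have x00 := hmul t m0 b0
    have x01 := hmul t m0 b1
    have x02 := hmul t m0 b2
    have x10 := (hsm t (hmul t m1 b0)).2
    have x11 := (hsm t (hmul t m1 b1)).2
    have x20 := (hsm t (hsm t (hmul t m2 b0)).2).2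
    have hP : 0 ≤ M * K0 * E t := (abs_nonneg _).trans x00
    have hbig : 4 * (M * K0 * E t) ≤ 6 * (1 + κ ^ 2) * (M * K0) * E t := by
      nlinarith [mul_nonneg (sq_nonneg κ) hP]
    have y00 := abs_le.1 x00
    have y01 := abs_le.1 x01
    have y02 := abs_le.1 x02
    have y10 := abs_le.1 x10
    have y11 := abs_le.1 x11
    have y20 := abs_le.1 x20
    refine ⟨?_, ?_, ?_⟩ <;>
    · refine le_trans ?_ hbig
      rw [abs_le]
      constructor <;> linarith
  · obtain ⟨m0, m1, m2⟩ := hM (t / n)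
    obtain ⟨b0, b1, b2⟩ := hc e t
    have x10 := (hsm t (hmul t m1 b0)).1
    have x11 := (hsm t (hmul t m1 b1)).1
    have x20 := (hsm t (hsm t (hmul t m2 b0)).2).1
    -- Terms in which the cut-off is not differentiated cancel by `hode`; every other term carries a
    -- factor 1/n.
    have e1 : κ ^ 2 * (n⁻¹ * (n⁻¹ * (χ2 (t / n) * c0 e t)) + 2 * (n⁻¹ * (χ1 (t / n) * c1 e t)) +
      χ (t / n) * c2 e t) + 3 * κ ^ 2 * (n⁻¹ * (χ1 (t / n) * c0 e t) + χ (t / n) * c1 e t) +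
      lam * (χ (t / n) * c0 e t) = κ ^ 2 * (n⁻¹ * (n⁻¹ * (χ2 (t / n) * c0 e t)) +
        2 * (n⁻¹ * (χ1 (t / n) * c1 e t)) + 3 * (n⁻¹ * (χ1 (t / n) * c0 e t))) := by
      linear_combination χ (t / n) * hode e t
    have y10 := abs_le.1 x10
    have y11 := abs_le.1 x11
    have y20 := abs_le.1 x20
    have hP : 0 ≤ n⁻¹ * (M * K0 * E t) := (abs_nonneg _).trans x10
    rw [e1, abs_mul, abs_of_nonneg (sq_nonneg κ)]
    have h6 : |n⁻¹ * (n⁻¹ * (χ2 (t / n) * c0 e t)) + 2 * (n⁻¹ * (χ1 (t / n) * c1 e t)) +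
        3 * (n⁻¹ * (χ1 (t / n) * c0 e t))| ≤ 6 * (n⁻¹ * (M * K0 * E t)) := by
      rw [abs_le]
      constructor <;> linarith
    have h7 := mul_le_mul_of_nonneg_left h6 (sq_nonneg κ)
    have h8 : 6 * (1 + κ ^ 2) * (M * K0) / n * E t = κ ^ 2 * (6 * (n⁻¹ * (M * K0 * E t))) +
      6 * (n⁻¹ * (M * K0 * E t)) := by
      field_simp
      ring
    change _ ≤ 6 * (1 + κ ^ 2) * (M * K0) / n * E t
    rw [h8]
    linarith
  · have h1 : χ (t / n) = 1 := hone _ ⟨(le_div_iff₀ hn0).2 ht.1, (div_le_iff₀ hn0).2 ht.2⟩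
    have h2 : co 1 t = Real.sin (ν * t) := by
      simp only [co, ph, Matrix.cons_val_one, Matrix.cons_val_fin_one]
      rw [← sub_eq_add_neg, Real.cos_sub_pi_div_two]
    have h3 : co 0 t = Real.cos (ν * t) := by simp [co, ph]
    have h4 : Real.exp (-3 * t) = E t ^ 2 := by
      simp only [E]
      rw [sq, ← Real.exp_add]
      congr 1
      ring
    simp only [h1, c0, h2, h3, h4]
    linear_combination E t ^ 2 * Real.sin_sq_add_cos_sq (ν * t)

end AdSTaubNUT

end

/-! ### The radial operator on slowly modulated waves -/

noncomputable section

namespace AdSTaubNUT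

open Matrix Filter Asymptotics
open scoped ContDiff

namespace Instanton

variable {I : Instanton}

lemma rPlus_pos (I : Instanton) : 0 < I.rPlus := I.N_pos.trans_le I.N_le_rPlus

/-- The coefficients of the modified Lichnerowicz operator in the variable `log r`. -/
lemma radialOp_comp_log {w w1 w2 : ℝ → ℝ} (d0 : ∀ t, HasDerivAt w (w1 t) t)
    (d1 : ∀ t, HasDerivAt w1 (w2 t) t) {r : ℝ} (hr : I.rPlus < r) :
    I.radialOp (fun r => w (Real.log r)) r = -((I.sA r / r) ^ 2 * w2 (Real.log r) +
      (I.radial (fun r => I.sA r / r) r + I.κtr r * (I.sA r / r)) * w1 (Real.log r) +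
      I.pot r * w (Real.log r)) := by
  have h0 : ∀ {u u' : ℝ → ℝ} (_ : ∀ t, HasDerivAt u (u' t) t) {r : ℝ}, I.rPlus < r →
      HasDerivAt (fun r => u (Real.log r)) (u' (Real.log r) / r) r := fun hu r hr =>
    ((hu _).comp r (Real.hasDerivAt_log (I.rPlus_pos.trans hr).ne')).congr_deriv (by
      rw [div_eq_mul_inv])
  have h1 : ∀ {r : ℝ}, I.rPlus < r → I.radial (fun r => w (Real.log r)) r =
      I.sA r / r * w1 (Real.log r) := fun {r} hr => by
    rw [radial, (h0 d0 hr).deriv]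
    ring
  have hp : HasDerivAt (fun r => I.sA r / r) (deriv (fun r => I.sA r / r) r) r :=
    ((I.differentiableAt_radial I.contDiffOn_sA hr).div differentiableAt_id
      (I.rPlus_pos.trans hr).ne').hasDerivAt
  have e : I.radial (fun r => w (Real.log r)) =ᶠ[nhds r]
      fun r => I.sA r / r * w1 (Real.log r) :=
    eventually_of_mem (Ioi_mem_nhds hr) fun t ht => h1 ht
  have h2 : I.radial (I.radial fun r => w (Real.log r)) r =
      I.radial (fun r => I.sA r / r) r * w1 (Real.log r) +
        (I.sA r / r) ^ 2 * w2 (Real.log r) := by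
    have h3 := e.deriv_eq.trans (hp.mul (h0 d1 hr)).deriv
    rw [radial, h3, radial]
    ring
  rw [radialOp, h1 hr, h2]
  ring

/-- In the variable log r the coefficients of the operator tend to κ², 3κ² and 0, with errors O(1/r)
by analyticity in 1/r. The condition 2N ≤ R serves to make B ≥ r²/2. -/
lemma exists_coef_bound (I : Instanton) : ∃ C R : ℝ, 0 ≤ C ∧ I.rPlus < R ∧ 2 * I.N ≤ R ∧ ∀ r, R ≤ r →
    |(I.sA r / r) ^ 2 - I.kap ^ 2| ≤ C / r ∧
    |I.radial (fun r => I.sA r / r) r + I.κtr r * (I.sA r / r) - 3 * I.kap ^ 2| ≤ C / r ∧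
    |I.pot r| ≤ C / r := by
  have hp := I.analyticAtInf_sA_div
  have hκ : AnalyticAtInf I.κtr (3 * I.kap) := by
    have := ((AnalyticAtInf.const 2).mul I.analyticAtInf_κ1).add I.analyticAtInf_κ3
    have e : 2 * I.kap + I.kap = 3 * I.kap := by ring
    rwa [e] at this
  have h1 : (fun r => (I.sA r / r) ^ 2 - I.kap ^ 2) =O[atTop] fun r => r⁻¹ := by
    simpa only [sq] using (hp.mul hp).isBigO
  have h2 : (fun r => I.radial (fun r => I.sA r / r) r + I.κtr r * (I.sA r / r) -
      3 * I.kap ^ 2) =O[atTop] fun r => r⁻¹ := by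
    refine ((I.isBigO_sA_mul_deriv hp).add (hκ.mul hp).isBigO).congr_left fun r => ?_
    rw [radial]
    ring
  have h3 : I.pot =O[atTop] fun r => r⁻¹ := by
    have := (((AnalyticAtInf.const (-4)).mul I.analyticAtInf_Γ3).mul
      (I.analyticAtInf_Γ3.add I.analyticAtInf_Γ1)).isBigO
    refine this.congr_left fun r => ?_
    rw [pot]
    ring
  obtain ⟨C1, p1, b1⟩ := h1.exists_nonneg
  obtain ⟨C2, p2, b2⟩ := h2.exists_nonneg
  obtain ⟨C3, p3, b3⟩ := h3.exists_nonneg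
  obtain ⟨R, hR⟩ := eventually_atTop.1 ((b1.bound.and b2.bound).and b3.bound)
  refine ⟨C1 + C2 + C3, max R (max (I.rPlus + 1) (2 * I.N)), by positivity,
    lt_of_lt_of_le (by linarith) ((le_max_left _ _).trans (le_max_right _ _)),
    (le_max_right _ _).trans (le_max_right _ _), fun r hr => ?_⟩
  have hr0 : 0 < r := by
    have := (le_max_left (I.rPlus + 1) (2 * I.N)).trans ((le_max_right R _).trans hr)
    linarith [I.rPlus_pos]
  obtain ⟨⟨e1, e2⟩, e3⟩ := hR r ((le_max_left _ _).trans hr)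
  rw [Real.norm_of_nonneg (inv_nonneg.2 hr0.le), ← div_eq_mul_inv, Real.norm_eq_abs] at e1 e2 e3
  refine ⟨e1.trans ?_, e2.trans ?_, e3.trans ?_⟩ <;>
  · apply div_le_div_of_nonneg_right _ hr0.le
    linarith

lemma integral_inv_log {a b : ℝ} (hab : a ≤ b) :
    ∫ r in Set.Icc (Real.exp a) (Real.exp b), r⁻¹ = b - a := by
  rw [integral_Icc_eq_integral_Ioc, ← intervalIntegral.integral_of_le (Real.exp_le_exp.2 hab),
    integral_inv_of_pos (Real.exp_pos _) (Real.exp_pos _), ← Real.exp_sub, Real.log_exp]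

lemma integrableOn_inv_log (a b : ℝ) :
    IntegrableOn (fun r : ℝ => r⁻¹) (Set.Icc (Real.exp a) (Real.exp b)) :=
  (continuousOn_inv₀.mono fun _ hr => ((Real.exp_pos a).trans_le hr.1).ne').integrableOn_compact
    isCompact_Icc

/-- The radial operator is not bounded below away from the spectral parameter. -/
theorem exists_profile {lam : ℝ} (hlam : 9 / 4 * I.kap ^ 2 < lam) {k : ℝ} (hk : 0 ≤ k) :
    ∃ f, I.IsProfile f ∧
      k * (∫ r in Set.Ioi I.rPlus, I.B r * (I.radialOp f r - lam * f r) ^ 2) <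
        ∫ r in Set.Ioi I.rPlus, I.B r * f r ^ 2 := by
  by_contra hcon
  push Not at hcon
  obtain ⟨C, R, hC, hR, hRN, hb⟩ := I.exists_coef_bound
  obtain ⟨K, hK, hw⟩ := exists_wave I.kap_pos hlam
  -- K for the error of the wave in the limiting equation, and C K for each of the three coefficient
  -- errors.
  set C2 := K + 3 * C * K with hC2
  have hC20 : 0 ≤ C2 := by positivity
  -- The last condition contradicts n/4 ≤ 2k C2²/n, which the assumption on profiles will yield.
  obtain ⟨n, hn⟩ : ∃ n : ℝ, 1 ≤ n ∧ R ≤ Real.exp n ∧ 8 * k * C2 ^ 2 < n ^ 2 := by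
    have h1 : Tendsto (fun n : ℝ => n ^ 2) atTop atTop := tendsto_pow_atTop two_ne_zero
    exact ((eventually_ge_atTop 1).and ((Real.tendsto_exp_atTop.eventually_ge_atTop R).and
      (h1.eventually_gt_atTop _))).exists
  obtain ⟨hn1, hnR, hnk⟩ := hn
  have hn0 : 0 < n := by linarith
  obtain ⟨w, w1, w2, hsm, d0, d1, hz, hbd, hode, hsq⟩ := hw n hn1
  -- `Real.log` is even, so negative r must be excluded by hand for the support to be a compact
  -- subset of (r_+, ∞).
  let f : Fin 2 → ℝ → ℝ := fun e r => if r ≤ 0 then 0 else w e (Real.log r)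
  have hfr : ∀ e r, 0 < r → f e r = w e (Real.log r) := fun e r hr => if_neg (not_le.2 hr)
  have hpos : ∀ {r}, I.rPlus < r → 0 < r := fun hr => I.rPlus_pos.trans hr
  have hout : ∀ {r}, 0 < r → r ∉ Set.Icc (Real.exp n) (Real.exp (2 * n)) →
      Real.log r ∉ Set.Icc n (2 * n) := fun hr hr' h => hr'
    ⟨(Real.le_log_iff_exp_le hr).1 h.1, (Real.log_le_iff_le_exp hr).1 h.2⟩
  have hprof : ∀ e, I.IsProfile (f e) := fun e => by
    refine ⟨?_, Real.exp n, Real.exp (2 * n), hR.trans_le hnR, fun r hr => ?_⟩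
    · have h1 : ContDiffOn ℝ ∞ (fun r => w e (Real.log r)) (Set.Ioi I.rPlus) :=
        (hsm e).comp_contDiffOn (Real.contDiffOn_log.mono fun r hr => (hpos hr).ne')
      exact h1.congr fun r hr => hfr e r (hpos hr)
    · by_cases h0 : r ≤ 0
      · exact if_pos h0
      · rw [hfr e r (not_le.1 h0)]
        exact (hz e _ (hout (not_le.1 h0) hr)).1
  have hop : ∀ e r, I.rPlus < r → I.radialOp (f e) r - lam * f e r =
      -((I.kap ^ 2 * w2 e (Real.log r) + 3 * I.kap ^ 2 * w1 e (Real.log r) +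
        lam * w e (Real.log r)) + ((I.sA r / r) ^ 2 - I.kap ^ 2) * w2 e (Real.log r) +
        (I.radial (fun r => I.sA r / r) r + I.κtr r * (I.sA r / r) - 3 * I.kap ^ 2) *
          w1 e (Real.log r) + I.pot r * w e (Real.log r)) := fun e r hr => by
    have h1 : I.radialOp (f e) r = I.radialOp (fun r => w e (Real.log r)) r := by
      have h2 : ∀ t, 0 < t → f e =ᶠ[nhds t] fun r => w e (Real.log r) := fun t ht =>
        eventually_of_mem (Ioi_mem_nhds ht) fun s hs => hfr e s hs
      have h3 : ∀ t, 0 < t → I.radial (f e) t = I.radial (fun r => w e (Real.log r)) t :=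
        fun t ht => by rw [radial, radial, (h2 t ht).deriv_eq]
      have h4 : I.radial (f e) =ᶠ[nhds r] I.radial (fun r => w e (Real.log r)) :=
        eventually_of_mem (Ioi_mem_nhds (hpos hr)) fun s hs => h3 s hs
      rw [radialOp, radialOp, h3 r (hpos hr), radial, h4.deriv_eq, hfr e r (hpos hr)]
      rfl
    rw [h1, radialOp_comp_log (d0 e) (d1 e) hr, hfr e r (hpos hr)]
    ring
  -- The residual is at most (C2/n) r^(-3/2) on the support; squared and multiplied by B ≤ r² it
  -- gives C2²/(n² r), whose integral over an interval of logarithmic length n is C2²/n.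
  have hup : ∀ e r, r ∈ Set.Ioi I.rPlus →
      I.B r * (I.radialOp (f e) r - lam * f e r) ^ 2 ≤
        (Set.Icc (Real.exp n) (Real.exp (2 * n))).indicator (fun r => C2 ^ 2 / n ^ 2 * r⁻¹) r := by
    intro e r hr
    have hr0 : 0 < r := hpos hr
    rw [hop e r hr]
    by_cases hmem : r ∈ Set.Icc (Real.exp n) (Real.exp (2 * n))
    · rw [Set.indicator_of_mem hmem]
      obtain ⟨e0, e1, e2⟩ := hbd e (Real.log r)
      obtain ⟨c1, c2, c3⟩ := hb r (hnR.trans hmem.1)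
      have h3 := hode e (Real.log r)
      set E := Real.exp (-(3 / 2) * Real.log r) with hE
      have hE0 : 0 < E := Real.exp_pos _
      have hE2 : E ^ 2 = r⁻¹ ^ 3 := by
        rw [hE, ← Real.exp_nat_mul]
        have : ((2 : ℕ) : ℝ) * (-(3 / 2) * Real.log r) = ((3 : ℕ) : ℝ) * Real.log r⁻¹ := by
          rw [Real.log_inv]
          push_cast
          ring
        rw [this, Real.exp_nat_mul, Real.exp_log (inv_pos.2 hr0)]
      -- On the support r ≥ eⁿ ≥ n, so the errors of the coefficients are no worse than those of the
      -- cut-off.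
      have hrn : C / r ≤ C / n := by
        refine div_le_div_of_nonneg_left hC hn0 ?_
        have := Real.add_one_le_exp n
        linarith [hmem.1]
      have hCn : 0 ≤ C / n := by positivity
      have hm : ∀ {x y : ℝ}, |x| ≤ C / r → |y| ≤ K * E → |x * y| ≤ C / n * (K * E) :=
        fun hx hy => by
        rw [abs_mul]
        exact mul_le_mul (hx.trans hrn) hy (abs_nonneg _) hCn
      have y0 := hm c3 e0
      have y1 := hm c2 e1
      have y2 := hm c1 e2
      have hsum : |-((I.kap ^ 2 * w2 e (Real.log r) + 3 * I.kap ^ 2 * w1 e (Real.log r) +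
          lam * w e (Real.log r)) + ((I.sA r / r) ^ 2 - I.kap ^ 2) * w2 e (Real.log r) +
          (I.radial (fun r => I.sA r / r) r + I.κtr r * (I.sA r / r) - 3 * I.kap ^ 2) *
          w1 e (Real.log r) + I.pot r * w e (Real.log r))| ≤ C2 / n * E := by
        rw [abs_neg]
        have h4 : C2 / n * E = K / n * E + 3 * (C / n * (K * E)) := by
          rw [hC2]
          ring
        rw [h4]
        refine (abs_add_le _ _).trans ?_
        have h5 := (abs_add_le (I.kap ^ 2 * w2 e (Real.log r) + 3 * I.kap ^ 2 * w1 e (Real.log r) +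
          lam * w e (Real.log r) + ((I.sA r / r) ^ 2 - I.kap ^ 2) * w2 e (Real.log r))
          ((I.radial (fun r => I.sA r / r) r + I.κtr r * (I.sA r / r) - 3 * I.kap ^ 2) *
          w1 e (Real.log r)))
        have h6 := abs_add_le (I.kap ^ 2 * w2 e (Real.log r) + 3 * I.kap ^ 2 * w1 e (Real.log r) +
          lam * w e (Real.log r)) (((I.sA r / r) ^ 2 - I.kap ^ 2) * w2 e (Real.log r))
        linarith
      have h7 := sq_le_sq' (neg_le_of_abs_le hsum) (le_of_abs_le hsum)
      have hB : I.B r ≤ r ^ 2 := by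
        rw [B]
        linarith [sq_nonneg I.N]
      calc _ ≤ r ^ 2 * (C2 / n * E) ^ 2 := mul_le_mul hB h7 (sq_nonneg _) (sq_nonneg _)
        _ = C2 ^ 2 / n ^ 2 * r⁻¹ := by
          rw [mul_pow, hE2]
          field_simp
    · rw [Set.indicator_of_notMem hmem]
      obtain ⟨z0, z1, z2⟩ := hz e _ (hout hr0 hmem)
      simp [z0, z1, z2]
  have hsub : Set.Icc (Real.exp n) (Real.exp (2 * n)) ⊆ Set.Ioi I.rPlus := fun r hr =>
    hR.trans_le (hnR.trans hr.1)
  have hupI : ∀ e, ∫ r in Set.Ioi I.rPlus, I.B r * (I.radialOp (f e) r - lam * f e r) ^ 2 ≤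
      C2 ^ 2 / n := fun e => by
    have h1 : IntegrableOn (fun r : ℝ => C2 ^ 2 / n ^ 2 * r⁻¹)
        (Set.Icc (Real.exp n) (Real.exp (2 * n))) := (integrableOn_inv_log _ _).const_mul _
    refine (setIntegral_mono_on (((hprof e).radialOp_sub lam).integrableOn
      I.contDiff_B.continuous.continuousOn) ?_ measurableSet_Ioi (hup e)).trans (le_of_eq ?_)
    · exact ((integrable_indicator_iff measurableSet_Icc).2 h1).integrableOn
    · rw [setIntegral_indicator measurableSet_Icc, Set.inter_eq_right.2 hsub,
        integral_const_mul, integral_inv_log (by linarith)]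
      field_simp
      ring
  -- Where the cut-off equals one, f₀² + f₁² = r⁻³ and B ≥ r²/2, so the integrand is at least 1/(2r)
  -- over an interval of logarithmic length n/2.
  have hlow : n / 4 ≤ ∫ r in Set.Ioi I.rPlus, (I.B r * f 0 r ^ 2 + I.B r * f 1 r ^ 2) := by
    have h0 := ((hprof 0).integrableOn I.contDiff_B.continuous.continuousOn).add
      ((hprof 1).integrableOn I.contDiff_B.continuous.continuousOn)
    have hsub' : Set.Icc (Real.exp (5 / 4 * n)) (Real.exp (7 / 4 * n)) ⊆ Set.Ioi I.rPlus :=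
      fun r hr => hR.trans_le (hnR.trans ((Real.exp_le_exp.2 (by linarith)).trans hr.1))
    have h1 : ∫ r in Set.Icc (Real.exp (5 / 4 * n)) (Real.exp (7 / 4 * n)), 1 / 2 * r⁻¹ = n / 4 := by
      rw [integral_const_mul, integral_inv_log (by linarith)]
      ring
    rw [← h1]
    refine (setIntegral_mono_on ((integrableOn_inv_log _ _).const_mul _) (h0.mono_set hsub')
      measurableSet_Icc fun r hr => ?_).trans (setIntegral_mono_set h0
        ((ae_restrict_iff' measurableSet_Ioi).2 (Eventually.of_forall fun r hr => ?_))
        (Eventually.of_forall hsub'))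
    · have hr0 : 0 < r := (Real.exp_pos _).trans_le hr.1
      have h2 := hsq (Real.log r) ⟨(Real.le_log_iff_exp_le hr0).2 hr.1,
        (Real.log_le_iff_le_exp hr0).2 hr.2⟩
      have h3 : Real.exp (-3 * Real.log r) = r⁻¹ ^ 3 := by
        have : -3 * Real.log r = ((3 : ℕ) : ℝ) * Real.log r⁻¹ := by
          rw [Real.log_inv]
          push_cast
          ring
        rw [this, Real.exp_nat_mul, Real.exp_log (inv_pos.2 hr0)]
      have h4 : 2 * I.N ≤ r := hRN.trans (hnR.trans ((Real.exp_le_exp.2 (by linarith)).trans hr.1))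
      have hN := I.N_pos
      have hB : r ^ 2 / 2 ≤ I.B r := by
        rw [B]
        nlinarith
      simp only [Pi.add_apply, hfr _ r hr0]
      rw [← mul_add, h2, h3]
      calc 1 / 2 * r⁻¹ = r ^ 2 / 2 * r⁻¹ ^ 3 := by field_simp
        _ ≤ I.B r * r⁻¹ ^ 3 := by gcongr
    · have := I.B_pos hr
      simp only [Pi.add_apply, Pi.zero_apply]
      positivity
  have hfin : n / 4 ≤ 2 * k * (C2 ^ 2 / n) := by
    refine hlow.trans ?_
    rw [integral_add ((hprof 0).integrableOn I.contDiff_B.continuous.continuousOn)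
      ((hprof 1).integrableOn I.contDiff_B.continuous.continuousOn)]
    have h1 := (hcon _ (hprof 0)).trans (mul_le_mul_of_nonneg_left (hupI 0) hk)
    have h2 := (hcon _ (hprof 1)).trans (mul_le_mul_of_nonneg_left (hupI 1) hk)
    linarith
  have h5 : 2 * k * (C2 ^ 2 / n) * (4 * n) = 8 * k * C2 ^ 2 := by
    field_simp
    ring
  nlinarith

end Instanton

end AdSTaubNUT

end

noncomputable section

namespace AdSTaubNUT

open Matrix

/-! ### The continuous spectrum -/

namespace Instanton

variable {I : Instanton}

lemma continuousOn_riemann (a b c d : Fin 4) :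
    ContinuousOn (fun x => riemann I.metric x a b c d) dense := by
  have hC := fun k i j => (I.contDiffOn_christoffel k i j).continuousOn
  have hp := fun c k i j => (contDiffOn_pd (I.contDiffOn_christoffel k i j) c).continuousOn
  unfold riemann riemannUp
  exact continuousOn_finsetSum _ fun e _ => (I.contDiffOn_metric a e).continuousOn.mul
    (((hp _ _ _ _).sub (hp _ _ _ _)).add (continuousOn_finsetSum _ fun e _ =>
      ((hC _ _ _).mul (hC _ _ _)).sub ((hC _ _ _).mul (hC _ _ _))))

lemma IsC2.continuousOn_modLich {h : Field} (hh : I.IsC2 h) (a b : Fin 4) :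
    ContinuousOn (fun x => modLich I.metric h x a b) dense := by
  have hC := fun k i j => (I.contDiffOn_christoffel k i j).continuousOn
  have hg := fun i j => (I.contDiffOn_ginv i j).continuousOn
  have hf := fun a b => (hh.1 a b).continuousOn
  have h1 := fun c a b => (hh.contDiffOn_cov c a b).continuousOn
  have h2 : ∀ d c a b, ContinuousOn (fun x => cov2 I.metric h x d c a b) dense := fun d c a b => by
    unfold cov2
    exact (continuousOn_pd (hh.contDiffOn_cov c a b) d).sub (continuousOn_finsetSum _ fun e _ =>
      (((hC _ _ _).mul (h1 _ _ _)).add ((hC _ _ _).mul (h1 _ _ _))).add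
        ((hC _ _ _).mul (h1 _ _ _)))
  have h3 : ∀ c d, ContinuousOn (fun x => raise I.metric h x c d) dense := fun c d => by
    unfold raise
    exact continuousOn_finsetSum _ fun e _ => continuousOn_finsetSum _ fun f _ =>
      ((hg _ _).mul (hg _ _)).mul (hf _ _)
  unfold modLich
  exact (continuousOn_finsetSum _ fun c _ => continuousOn_finsetSum _ fun d _ =>
    (hg _ _).mul (h2 _ _ _ _)).neg.sub (continuousOn_const.mul
      (continuousOn_finsetSum _ fun c _ => continuousOn_finsetSum _ fun d _ =>
        (continuousOn_riemann _ _ _ _).mul (h3 _ _)))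

/-- The Riemannian density is positive on the dense chart, so continuous fields that agree almost
everywhere for the volume agree there pointwise. -/
lemma eq_of_ae_frameComp {h k : Field} (hh : ∀ a b, ContinuousOn (fun x => h x a b) dense)
    (hk : ∀ a b, ContinuousOn (fun x => k x a b) dense)
    (e : ∀ᵐ x ∂I.vol, I.frameComp h x = I.frameComp k x) {x : Pt} (hx : x ∈ dense) :
    h x = k x := by
  have h1 : ∀ a b, Set.EqOn (fun y => h y a b) (fun y => k y a b) dense := fun a b => by
    refine Measure.eqOn_open_of_ae_eq (μ := volume) ?_ isOpen_dense (hh a b) (hk a b)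
    filter_upwards [ae_volume_of_ae_vol e, ae_restrict_mem isOpen_dense.measurableSet] with y hy hd
    have h2 : ((-1 : ℝ) • h + k) y = 0 := eq_zero_of_frameComp (I := I) hd (by
      rw [frameComp_lin, hy, neg_one_smul, neg_add_cancel])
    have h3 := congrFun (congrFun h2 a) b
    simp only [Pi.add_apply, Pi.smul_apply, smul_eq_mul, Pi.zero_apply] at h3
    linarith
  ext a b
  exact h1 a b hx

lemma frameComp_smul (c : ℝ) (h : Field) (x : Pt) :
    I.frameComp (c • h) x = c • I.frameComp h x := by
  have := I.frameComp_lin (h := h) (k := 0) c x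
  simpa only [add_zero, frameComp_zero] using this

/-- A member of the domain is represented by a field of class C², for which both sides of the
eigenvalue equation are continuous; the equation in L² therefore holds pointwise. -/
lemma eq_zero_of_op_eq_smul {lam : ℝ} (hlam : 9 / 4 * I.kap ^ 2 < lam) {X : I.op.domain}
    (e : I.op X = lam • (X : I.H)) : X = 0 := by
  have h1 : ((X : I.H), I.op X) ∈ I.opGraph := I.op_graph ▸ I.op.mem_graph X
  obtain ⟨h, hc, ht, e1, e2⟩ := h1
  simp only at e1 e2
  have h2 : ∀ᵐ x ∂I.vol, I.frameComp (modLich I.metric h) x = I.frameComp (lam • h) x := by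
    filter_upwards [e1, e2, Lp.coeFn_smul lam ((X : I.H) : I.L2)] with x h1 h2 h3
    rw [frameComp_smul, ← h1, ← h2, e]
    exact h3
  have h3 : ∀ x ∈ dense, modLich I.metric h x = lam • h x := fun x hx =>
    eq_of_ae_frameComp (k := lam • h) hc.continuousOn_modLich
      (fun a b => continuousOn_const.mul (hc.1 a b).continuousOn) h2 hx
  have h4 : MemLp (I.frameComp h) 2 I.vol := (Lp.memLp ((X : I.H) : I.L2)).ae_eq e1
  refine Subtype.ext (Subtype.ext (Lp.ext ?_))
  filter_upwards [e1, ae_dense, Lp.coeFn_zero Comp 2 I.vol] with x h5 hx h6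
  rw [h5, frameComp_congr (k := 0) (eq_zero_of_modLich_eq_smul hc ht h3 hlam h4 hx),
    frameComp_zero]
  exact h6.symm

lemma notMem_pointSpectrum {lam : ℝ} (hlam : 9 / 4 * I.kap ^ 2 < lam) :
    (shift I.op lam).toFun.ker = ⊥ := by
  rw [LinearMap.ker_eq_bot']
  intro X hX
  exact eq_zero_of_op_eq_smul hlam (sub_eq_zero.1 hX)

/-- The element of `𝓗` given by a profile. -/
def IsProfile.toH {f : ℝ → ℝ} (hf : I.IsProfile f) : I.H :=
  ⟨hf.memLp.toLp, I.smoothTT.le_topologicalClosure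
    ⟨I.tens f, hf.isC2, hf.isTT, hf.memLp.coeFn_toLp⟩⟩

lemma IsProfile.mem_opGraph {f : ℝ → ℝ} (hf : I.IsProfile f) :
    (hf.toH, hf.radialOp.toH) ∈ I.opGraph := by
  refine ⟨I.tens f, hf.isC2, hf.isTT, hf.memLp.coeFn_toLp, ?_⟩
  filter_upwards [hf.radialOp.memLp.coeFn_toLp, ae_dense] with x h1 hx
  rw [frameComp_congr (hf.modLich_tens hx)]
  exact h1

lemma IsProfile.radialOp_sub_toH {f : ℝ → ℝ} (hf : I.IsProfile f) (lam : ℝ) :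
    hf.radialOp.toH - lam • hf.toH = (hf.radialOp_sub lam).toH := by
  refine Subtype.ext (Lp.ext ?_)
  filter_upwards [hf.radialOp.memLp.coeFn_toLp, hf.memLp.coeFn_toLp,
    (hf.radialOp_sub lam).memLp.coeFn_toLp,
    Lp.coeFn_sub hf.radialOp.memLp.toLp (lam • hf.memLp.toLp),
    Lp.coeFn_smul lam hf.memLp.toLp] with x h1 h2 h3 h4 h5
  refine h4.trans (Eq.trans ?_ h3.symm)
  rw [Pi.sub_apply, h5, Pi.smul_apply, h1, h2, ← frameComp_smul]
  have h6 : I.tens (I.radialOp f) x =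
      ((1 : ℝ) • I.tens (fun r => I.radialOp f r - lam * f r) + lam • I.tens f) x := by
    ext a b
    simp only [tens, Pi.add_apply, Pi.smul_apply, smul_eq_mul]
    ring
  rw [frameComp_congr h6, frameComp_lin, one_smul, add_sub_cancel_right]

/-- A bound k for the inverse would give ‖f‖ ≤ k ‖(Δ̃_L - λ)f‖ for every test tensor, against
`exists_profile`. -/
lemma not_bounded_inverse {lam : ℝ} (hlam : 9 / 4 * I.kap ^ 2 < lam) :
    ¬ ∃ k : ℝ, ∀ y : (shift I.op lam).inverse.domain,
      ‖(shift I.op lam).inverse y‖ ≤ k * ‖(y : I.H)‖ := by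
  rintro ⟨k, hk⟩
  -- The comparison is between squared norms, hence k²; it also provides the non-negative constant
  -- required, whatever the sign of k.
  obtain ⟨f, hf, hlt⟩ := I.exists_profile hlam (sq_nonneg k)
  have hg : (hf.toH, hf.radialOp.toH) ∈ I.op.graph := I.op_graph ▸ hf.mem_opGraph
  obtain ⟨X, hX, hY⟩ := I.op.mem_graph_iff.1 hg
  have hZ : shift I.op lam X = (hf.radialOp_sub lam).toH := by
    rw [← hf.radialOp_sub_toH]
    change I.op X - lam • (X : I.H) = _
    rw [hX, hY]
  have hd : (hf.radialOp_sub lam).toH ∈ (shift I.op lam).inverse.domain := by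
    rw [LinearPMap.inverse_domain]
    exact ⟨X, hZ⟩
  have h1 := hk ⟨_, hd⟩
  rw [LinearPMap.inverse_apply_eq (notMem_pointSpectrum hlam) (x := X) hZ, hX] at h1
  have h2 : ‖hf.toH‖ ^ 2 ≤ k ^ 2 * ‖(hf.radialOp_sub lam).toH‖ ^ 2 := by
    rw [← mul_pow]
    exact pow_le_pow_left₀ (norm_nonneg _) h1 2
  have h3 : ‖hf.toH‖ ^ 2 = _ := hf.norm_sq_toLp
  have h4 : ‖(hf.radialOp_sub lam).toH‖ ^ 2 = _ := (hf.radialOp_sub lam).norm_sq_toLp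
  rw [h3, h4] at h2
  have h5 : 0 < 32 * I.N * area := by
    have := I.N_pos
    have := area_pos
    positivity
  have h6 := mul_lt_mul_of_pos_left hlt h5
  linarith

end Instanton

end AdSTaubNUT

end

theorem mainTheorem1 (I : AdSTaubNUT.Instanton) :
    Set.Ioi (9 / (4 * I.ℓ ^ 2)) ⊆ AdSTaubNUT.continuousSpectrum I.op := by
  intro lam hlam
  have h : 9 / 4 * I.kap ^ 2 < lam := by
    refine lt_of_eq_of_lt ?_ (Set.mem_Ioi.1 hlam)
    rw [AdSTaubNUT.Instanton.kap]
    have := I.ℓ_pos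
    field_simp
  exact ⟨not_not.2 (AdSTaubNUT.Instanton.notMem_pointSpectrum h),
    AdSTaubNUT.Instanton.not_bounded_inverse h⟩
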